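/- Setting. Let $G\subset\mathbb R^3$ be a bounded open set with $C^\infty$ boundary (that is, $\overline G$ is a $C^\infty$ submanifold of $\mathbb R^3$ with boundary) whose closure is strictly convex, and let $\nu$ be its outward unit normal. Let $S=S'$ be the unit sphere of $\mathbb R^3$ with surface measure $d\omega$, and let $I=[E_0,E_m]$ with $0\le E_0<E_m<\infty$ and $I^\circ=(E_0,E_m)$. Put $$\Gamma_-=\{(y,\omega,E)\in\partial G\times S\times I:\ \omega\cdot\nu(y)<0\},\qquad \Gamma_0=\{(y,\omega,E)\in\partial G\times S\times I:\ \omega\cdot\nu(y)=0\}.$$ Spaces. Let $m\in\mathbb N_0$. * $H^{(m,0,0)}(G\times S\times I)$ is the space of real $\psi\in L^2(G\times S\times I)$ whose weak derivatives $\partial_x^\alpha\psi$, $|\alpha|\le m$, lie in $L^2(G\times S\times I)$, with norm $\big(\sum_{|\alpha|\le m}\|\partial_x^\alpha\psi\|_{L^2}^2\big)^{1/2}$. * For a Banach space $X$ and $k\in\mathbb N\cup\{\infty\}$, $C_0^{(k,0,0)}(\overline G\times S\times I,X,\Gamma_-)$ is the set of restrictions to $G\times S\times I^\circ$ of compactly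 supported functions $f:\mathbb R^3\times S\times\mathbb R\to X$ all of whose derivatives $\partial_x^\alpha f$, $|\alpha|\le k$, exist and are continuous in $(x,\omega,E)$, such that the support of the restriction, taken in $\overline G\times S\times I$, is disjoint from $\Gamma_-\cup\Gamma_0$. * $H_0^{(m,0,0)}(G\times S\times I,\Gamma_-)$ is the completion (equivalently, the closure in $H^{(m,0,0)}(G\times S\times I)$) of $\bigcap_{k\ge1}C_0^{(k,0,0)}(\overline G\times S\times I,\mathbb R,\Gamma_-)$ in the $H^{(m,0,0)}$-norm. * For a function $\sigma=\sigma(x,\omega',\omega,E)$ on $G\times S'\times S\times I$ with weak derivatives $\partial_x^\alpha\sigma$, $|\alpha|\le m$, put $$N_1(\sigma)=\max_{|\alpha|\le m}\ \operatorname*{ess\,sup}_{(x,\omega,E)\in G\times S\times I}\int_{S'}|\partial_x^\alpha\sigma(x,\omega',\omega,E)|\,d\omega',$$ $$N_2(\sigma)=\max_{|\alpha|\le m}\ \operatorname*{ess\,sup}_{(x,\omega',E)\in G\times S'\times I}\int_{S}|\partial_x^\alpha\sigma(x,\omega',\omega,E)|\,d\omega ;$$ these are the norms of $W^{\infty,(m,0,0)}(G\times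 S\times I,L^1(S'))$ and of $W^{\infty,(m,0,0)}(G\times S'\times I,L^1(S))$. * $\mathcal W_0^{\infty,(m,0,0)}(G\times S\times I,L^1(S'),\Gamma_-)$ is the completion of $C_0^{(\infty,0,0)}(\overline G\times S\times I,L^1(S'),\Gamma_-)\cap W^{\infty,(m,0,0)}(G\times S'\times I,L^1(S))$ with respect to the norm $N_1+N_2$; its elements are regarded as functions on $G\times S'\times S\times I$. Theorem. For every $m\in\mathbb N_0$ there is a constant $C_m>0$, depending only on $m$, such that the following holds for all $G$ and $I$ as above. Let $\sigma^2:G\times S'\times S\times I\to[0,\infty)$ be a Borel measurable function with $\sigma^2\in\mathcal W_0^{\infty,(m,0,0)}(G\times S\times I,L^1(S'),\Gamma_-)$. Then, for every $\psi\in H^{(m,0,0)}(G\times S\times I)$, the integral $$(K_r^2\psi)(x,\omega,E)=\int_{S'}\sigma^2(x,\omega',\omega,E)\,\psi(x,\omega',E)\,d\omega'$$ converges absolutely for a.e. $(x,\omega,E)\in G\times S\times I$ and does not depend, up to null sets, on the representative of $\psi$; $K_r^2$ is a bounded linear operator from $H^{(m,0,0)}(G\times S\times I)$ to $H_0^{(m,0,0)}(G\times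 S\times I,\Gamma_-)$; the norms $N_1(\sigma^2)$ and $N_2(\sigma^2)$ are finite; and $$\|K_r^2\|^2\le C_m\,N_1(\sigma^2)\,N_2(\sigma^2).$$ -/

import Mathlib

open Set Filter Topology MeasureTheory

noncomputable section

namespace Transport

/-- The Euclidean space `ℝ³`. -/
abbrev E3 : Type := EuclideanSpace ℝ (Fin 3)

/-- The unit sphere `S ⊂ ℝ³`. -/
abbrev S2 : Type := Metric.sphere (0 : E3) 1

/-- The usual surface measure `dω` on `S` (total mass `4π`). -/
def sphereMeasure : Measure S2 := (volume : Measure E3).toSphere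

/-- The ambient space of the variables `(x, ω, E)`. -/
abbrev Phase : Type := E3 × (S2 × ℝ)

/-- The ambient space of the variables `(x, ω', ω, E)`. -/
abbrev KernelDom : Type := E3 × (S2 × (S2 × ℝ))

/-! ### The spatial domain and its boundary -/

/-- `ρ` is a smooth local defining function of `G` at the boundary point `y`. -/
def IsLocalDefining (G : Set E3) (y : E3) (ρ : E3 → ℝ) : Prop :=
  ContDiff ℝ (⊤ : ℕ∞) ρ ∧ ρ y = 0 ∧ gradient ρ y ≠ 0 ∧ ∀ᶠ x in 𝓝 y, (x ∈ G ↔ ρ x < 0)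

/-- The boundary of `G` is of class `C^∞`: near each boundary point `G` is the sublevel set
`{ρ < 0}` of a smooth function with non-vanishing gradient, i.e. the closure of `G` is a smooth
three-dimensional submanifold with boundary. -/
def HasSmoothBoundary (G : Set E3) : Prop :=
  ∀ y ∈ frontier G, ∃ ρ : E3 → ℝ, IsLocalDefining G y ρ

/-- `n` is the outward unit normal `ν(y)` of `G` at `y`. -/
def IsOutwardNormal (G : Set E3) (y n : E3) : Prop :=
  ∃ ρ : E3 → ℝ, IsLocalDefining G y ρ ∧ n = ‖gradient ρ y‖⁻¹ • gradient ρ y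

/-- The inflow boundary `Γ₋`. -/
def GammaMinus (G : Set E3) (E₀ Em : ℝ) : Set Phase :=
  {p | p.1 ∈ frontier G ∧ p.2.2 ∈ Icc E₀ Em ∧
    ∃ n, IsOutwardNormal G p.1 n ∧ inner ℝ (p.2.1 : E3) n < 0}

/-- The characteristic boundary `Γ₀`. -/
def GammaZero (G : Set E3) (E₀ Em : ℝ) : Set Phase :=
  {p | p.1 ∈ frontier G ∧ p.2.2 ∈ Icc E₀ Em ∧
    ∃ n, IsOutwardNormal G p.1 n ∧ inner ℝ (p.2.1 : E3) n = 0}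

/-- The measure `dx dω dE` on `G × S × I`. -/
def phaseMeasure (G : Set E3) (E₀ Em : ℝ) : Measure Phase :=
  (volume.restrict G).prod (sphereMeasure.prod (volume.restrict (Icc E₀ Em)))

/-- The measure `dx dω' dω dE` on `G × S' × S × I`. -/
def kernelMeasure (G : Set E3) (E₀ Em : ℝ) : Measure KernelDom :=
  (volume.restrict G).prod
    (sphereMeasure.prod (sphereMeasure.prod (volume.restrict (Icc E₀ Em))))

/-! ### Spatial derivatives, classical and weak -/

/-- The partial derivative `∂g/∂x_i`. -/
def pd (i : Fin 3) (g : E3 → ℝ) : E3 → ℝ :=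
  fun x => fderiv ℝ g x (EuclideanSpace.single i 1)

/-- The spatial partial derivative `∂_x^α φ` of a function of `x` and further variables `y`. -/
def xPartial {Y : Type*} (α : Fin 3 → ℕ) (φ : E3 × Y → ℝ) : E3 × Y → ℝ :=
  fun p => ((pd 0)^[α 0] ((pd 1)^[α 1] ((pd 2)^[α 2] (fun x => φ (x, p.2))))) p.1

/-- The class `C^{(k,0,…)}(ℝ³ × Y)`: all spatial derivatives of order at most `k` exist and are
jointly continuous. The values lie in a normed space `X`. -/
def ClassCX {Y X : Type*} [TopologicalSpace Y] [NormedAddCommGroup X] [NormedSpace ℝ X]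
    (k : ℕ∞) (f : E3 × Y → X) : Prop :=
  (∀ y, ContDiff ℝ k (fun x => f (x, y))) ∧
    ∀ n : ℕ, (n : ℕ∞) ≤ k →
      Continuous fun p : E3 × Y => iteratedFDeriv ℝ n (fun x => f (x, p.2)) p.1

/-- Test functions on `G × V`: smooth in `x` with jointly continuous spatial derivatives, and
compactly supported in `G × V`. -/
def IsTest {Y : Type*} [TopologicalSpace Y] (G : Set E3) (V : Set Y) (φ : E3 × Y → ℝ) : Prop :=
  ClassCX ⊤ φ ∧ HasCompactSupport φ ∧ tsupport φ ⊆ G ×ˢ V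

/-- `v = ∂_x^α u` in the weak sense on `G × V`, where `μ` is the measure carried by `G × V`. The
integrals against test functions are required to converge (local integrability). -/
def HasWeakXDeriv {Y : Type*} [TopologicalSpace Y] [MeasurableSpace Y]
    (G : Set E3) (V : Set Y) (μ : Measure (E3 × Y)) (α : Fin 3 → ℕ) (u v : E3 × Y → ℝ) : Prop :=
  ∀ φ : E3 × Y → ℝ, IsTest G V φ →
    Integrable (fun p => u p * xPartial α φ p) μ ∧ Integrable (fun p => v p * φ p) μ ∧
      ∫ p, u p * xPartial α φ p ∂μ = (-1) ^ (∑ i, α i) * ∫ p, v p * φ p ∂μ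

/-- Multi-indices `α ∈ ℕ₀³` with `|α| ≤ m`. -/
abbrev MultiIdx (m : ℕ) : Type := {α : Fin 3 → Fin (m + 1) // ∑ i, (α i : ℕ) ≤ m}

/-- The multi-index as a function to `ℕ`. -/
def MultiIdx.toFun {m : ℕ} (α : MultiIdx m) : Fin 3 → ℕ := fun i => (α.1 i : ℕ)

/-- The multi-index `0`. -/
def MultiIdx.zero (m : ℕ) : MultiIdx m := ⟨fun _ => 0, by simp⟩

/-! ### The Sobolev spaces `H^{(m,0,0)}(G × S × I)` and `H₀^{(m,0,0)}(G × S × I, Γ₋)` -/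

/-- The space `L²(G × S × I)`. -/
abbrev L2Phase (G : Set E3) (E₀ Em : ℝ) : Type := Lp ℝ 2 (phaseMeasure G E₀ Em)

theorem HasWeakXDeriv.congr {Y : Type*} [TopologicalSpace Y] [MeasurableSpace Y]
    {G : Set E3} {V : Set Y} {μ : Measure (E3 × Y)} {α : Fin 3 → ℕ} {u v u' v' : E3 × Y → ℝ}
    (h : HasWeakXDeriv G V μ α u v) (hu : u =ᵐ[μ] u') (hv : v =ᵐ[μ] v') :
    HasWeakXDeriv G V μ α u' v' := by
  intro φ hφ
  obtain ⟨h1, h2, h3⟩ := h φ hφ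
  have e1 : (fun p => u p * xPartial α φ p) =ᵐ[μ] fun p => u' p * xPartial α φ p := by
    filter_upwards [hu] with p hp
    rw [hp]
  have e2 : (fun p => v p * φ p) =ᵐ[μ] fun p => v' p * φ p := by
    filter_upwards [hv] with p hp
    rw [hp]
  exact ⟨h1.congr e1, h2.congr e2, by rw [← integral_congr_ae e1, ← integral_congr_ae e2, h3]⟩

theorem HasWeakXDeriv.add {Y : Type*} [TopologicalSpace Y] [MeasurableSpace Y]
    {G : Set E3} {V : Set Y} {μ : Measure (E3 × Y)} {α : Fin 3 → ℕ} {u v u' v' : E3 × Y → ℝ}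
    (h : HasWeakXDeriv G V μ α u v) (h' : HasWeakXDeriv G V μ α u' v') :
    HasWeakXDeriv G V μ α (u + u') (v + v') := by
  intro φ hφ
  obtain ⟨h1, h2, h3⟩ := h φ hφ
  obtain ⟨h1', h2', h3'⟩ := h' φ hφ
  simp only [Pi.add_apply, add_mul]
  refine ⟨h1.add h1', h2.add h2', ?_⟩
  rw [integral_add h1 h1', integral_add h2 h2', h3, h3', mul_add]

theorem HasWeakXDeriv.smul {Y : Type*} [TopologicalSpace Y] [MeasurableSpace Y]
    {G : Set E3} {V : Set Y} {μ : Measure (E3 × Y)} {α : Fin 3 → ℕ} {u v : E3 × Y → ℝ}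
    (c : ℝ) (h : HasWeakXDeriv G V μ α u v) :
    HasWeakXDeriv G V μ α (c • u) (c • v) := by
  intro φ hφ
  obtain ⟨h1, h2, h3⟩ := h φ hφ
  simp only [Pi.smul_apply, smul_eq_mul, mul_assoc]
  refine ⟨h1.const_mul c, h2.const_mul c, ?_⟩
  rw [integral_const_mul, integral_const_mul, h3]
  ring

/-- The space `H^{(m,0,0)}(G × S × I)`. A function `ψ` is represented by the family
`(∂_x^α ψ)_{|α| ≤ m}` of its weak derivatives in `L²` (which `ψ` determines); the inherited norm is
`(∑_{|α| ≤ m} ‖∂_x^α ψ‖²)^{1/2}`. -/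
def sobolevH (m : ℕ) (G : Set E3) (E₀ Em : ℝ) :
    Submodule ℝ (PiLp 2 (fun _ : MultiIdx m => L2Phase G E₀ Em)) where
  carrier := {u | ∀ α : MultiIdx m,
    HasWeakXDeriv G (univ ×ˢ Ioo E₀ Em) (phaseMeasure G E₀ Em) α.toFun
      (u (MultiIdx.zero m)) (u α)}
  add_mem' := by
    intro u v hu hv α
    exact ((hu α).add (hv α)).congr (Lp.coeFn_add _ _).symm (Lp.coeFn_add _ _).symm
  zero_mem' := by
    intro α φ hφ
    have e : ((0 : L2Phase G E₀ Em) : Phase → ℝ) =ᵐ[phaseMeasure G E₀ Em] 0 := Lp.coeFn_zero _ _ _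
    refine HasWeakXDeriv.congr (u := 0) (v := 0) ?_ e.symm e.symm φ hφ
    intro φ _
    simp
  smul_mem' := by
    intro c u hu α
    exact ((hu α).smul c).congr (Lp.coeFn_smul _ _).symm (Lp.coeFn_smul _ _).symm

/-- The `L²` function `ψ` itself underlying an element of `H^{(m,0,0)}(G × S × I)`. -/
def toL2 {m : ℕ} {G : Set E3} {E₀ Em : ℝ} (ψ : sobolevH m G E₀ Em) : L2Phase G E₀ Em :=
  (ψ : PiLp 2 (fun _ : MultiIdx m => L2Phase G E₀ Em)) (MultiIdx.zero m)

/-- The class `C^{(k,0,0)}(closure G × S × I)` of restrictions to `G × S × I°` of compactly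
supported functions of class `C^{(k,0,0)}` on `ℝ³ × S × ℝ`, with values in `X`. -/
def ClassCBar {X : Type*} [NormedAddCommGroup X] [NormedSpace ℝ X]
    (k : ℕ∞) (G : Set E3) (E₀ Em : ℝ) (f : Phase → X) : Prop :=
  ∃ F : Phase → X, ClassCX k F ∧ HasCompactSupport F ∧
    EqOn f F (G ×ˢ (univ ×ˢ Ioo E₀ Em))

/-- The class `C₀^{(k,0,0)}(closure G × S × I, Γ₋)`: in addition, the support (taken in
`closure G × S × I`) does not meet `Γ₋ ∪ Γ₀`. -/
def ClassC0 {X : Type*} [NormedAddCommGroup X] [NormedSpace ℝ X]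
    (k : ℕ∞) (G : Set E3) (E₀ Em : ℝ) (f : Phase → X) : Prop :=
  ClassCBar k G E₀ Em f ∧
    Disjoint (closure (Function.support f ∩ (G ×ˢ (univ ×ˢ Ioo E₀ Em))))
      (GammaMinus G E₀ Em ∪ GammaZero G E₀ Em)

theorem ClassCX.add {Y X : Type*} [TopologicalSpace Y] [NormedAddCommGroup X] [NormedSpace ℝ X]
    {k : ℕ∞} {f g : E3 × Y → X} (hf : ClassCX k f) (hg : ClassCX k g) : ClassCX k (f + g) := by
  refine ⟨fun y => (hf.1 y).add (hg.1 y), fun n hn => ?_⟩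
  refine ((hf.2 n hn).add (hg.2 n hn)).congr fun p => ?_
  have hk : ((n : ℕ) : WithTop ℕ∞) ≤ (k : WithTop ℕ∞) := by exact_mod_cast hn
  exact (iteratedFDeriv_add_apply ((hf.1 p.2).contDiffAt.of_le hk)
    ((hg.1 p.2).contDiffAt.of_le hk)).symm

theorem ClassCX.smul {Y X : Type*} [TopologicalSpace Y] [NormedAddCommGroup X] [NormedSpace ℝ X]
    {k : ℕ∞} {f : E3 × Y → X} (c : ℝ) (hf : ClassCX k f) : ClassCX k (c • f) := by
  refine ⟨fun y => (hf.1 y).const_smul c, fun n hn => ?_⟩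
  refine ((hf.2 n hn).const_smul c).congr fun p => ?_
  have hk : ((n : ℕ) : WithTop ℕ∞) ≤ (k : WithTop ℕ∞) := by exact_mod_cast hn
  exact (iteratedFDeriv_const_smul_apply ((hf.1 p.2).contDiffAt.of_le hk)).symm

theorem ClassC0.add {X : Type*} [NormedAddCommGroup X] [NormedSpace ℝ X]
    {k : ℕ∞} {G : Set E3} {E₀ Em : ℝ} {f g : Phase → X}
    (hf : ClassC0 k G E₀ Em f) (hg : ClassC0 k G E₀ Em g) : ClassC0 k G E₀ Em (f + g) := by
  obtain ⟨⟨F, hF, hF', hfF⟩, df⟩ := hf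
  obtain ⟨⟨H, hH, hH', hgH⟩, dg⟩ := hg
  refine ⟨⟨F + H, hF.add hH, hF'.add hH',
    fun p hp => congrArg₂ (· + ·) (hfF hp) (hgH hp)⟩, ?_⟩
  refine Disjoint.mono_left ?_ (df.union_left dg)
  rw [← closure_union, ← union_inter_distrib_right]
  exact closure_mono (inter_subset_inter_left _ (Function.support_add f g))

theorem ClassC0.smul {X : Type*} [NormedAddCommGroup X] [NormedSpace ℝ X]
    {k : ℕ∞} {G : Set E3} {E₀ Em : ℝ} {f : Phase → X} (c : ℝ)
    (hf : ClassC0 k G E₀ Em f) : ClassC0 k G E₀ Em (c • f) := by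
  obtain ⟨⟨F, hF, hF', hfF⟩, df⟩ := hf
  refine ⟨⟨c • F, hF.smul c, hF'.smul_left (f := fun _ => c),
    fun p hp => congrArg (c • ·) (hfF hp)⟩, ?_⟩
  refine Disjoint.mono_left ?_ df
  exact closure_mono (inter_subset_inter_left _ (Function.support_const_smul_subset c f))

theorem ClassC0.zero {X : Type*} [NormedAddCommGroup X] [NormedSpace ℝ X]
    {k : ℕ∞} {G : Set E3} {E₀ Em : ℝ} : ClassC0 k G E₀ Em (0 : Phase → X) := by
  refine ⟨⟨0, ⟨fun _ => contDiff_const, fun n _ => ?_⟩, HasCompactSupport.zero,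
    fun _ _ => rfl⟩, by simp⟩
  simp only [Pi.zero_apply]
  refine (continuous_const (y := 0)).congr fun p => ?_
  exact (congrFun (iteratedFDeriv_fun_zero (𝕜 := ℝ) (E := E3) (F := X) (n := n)) p.1).symm

/-- The elements of `⋂_{k ≥ 1} C₀^{(k,0,0)}(closure G × S × I, Γ₋)`, as elements of
`H^{(m,0,0)}(G × S × I)`. -/
def smoothVanishing (m : ℕ) (G : Set E3) (E₀ Em : ℝ) : Submodule ℝ (sobolevH m G E₀ Em) where
  carrier := {ψ | ∃ f : Phase → ℝ, (∀ k : ℕ, 1 ≤ k → ClassC0 k G E₀ Em f) ∧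
    toL2 ψ =ᵐ[phaseMeasure G E₀ Em] f}
  add_mem' := by
    rintro ψ χ ⟨f, hf, hψ⟩ ⟨g, hg, hχ⟩
    exact ⟨f + g, fun k hk => (hf k hk).add (hg k hk), (Lp.coeFn_add _ _).trans (hψ.add hχ)⟩
  zero_mem' := ⟨0, fun _ _ => ClassC0.zero, Lp.coeFn_zero _ _ _⟩
  smul_mem' := by
    rintro c ψ ⟨f, hf, hψ⟩
    exact ⟨c • f, fun k hk => (hf k hk).smul c, (Lp.coeFn_smul _ _).trans (hψ.const_smul c)⟩

/-- The space `H₀^{(m,0,0)}(G × S × I, Γ₋)`: the completion of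
`⋂_{k ≥ 1} C₀^{(k,0,0)}(closure G × S × I, Γ₋)` in the norm of `H^{(m,0,0)}(G × S × I)`, i.e. its
closure in that Hilbert space. -/
def sobolevH0 (m : ℕ) (G : Set E3) (E₀ Em : ℝ) : Submodule ℝ (sobolevH m G E₀ Em) :=
  (smoothVanishing m G E₀ Em).topologicalClosure

/-! ### The kernel spaces -/

/-- The norm of `L^∞(G × S × I, L¹(S'))`. -/
def mixedNorm (G : Set E3) (E₀ Em : ℝ) (v : KernelDom → ℝ) : ENNReal :=
  essSup (fun p : Phase => ∫⁻ ω', ‖v (p.1, ω', p.2.1, p.2.2)‖ₑ ∂sphereMeasure)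
    (phaseMeasure G E₀ Em)

/-- The norm of `L^∞(G × S' × I, L¹(S))`. -/
def mixedNorm' (G : Set E3) (E₀ Em : ℝ) (v : KernelDom → ℝ) : ENNReal :=
  essSup (fun p : Phase => ∫⁻ ω, ‖v (p.1, p.2.1, ω, p.2.2)‖ₑ ∂sphereMeasure)
    (phaseMeasure G E₀ Em)

/-- The families of weak derivatives `(∂_x^α σ)_{|α| ≤ m}` on `G × S' × S × I`. Such a family is
unique up to null sets if it exists. -/
def weakDerivs (m : ℕ) (G : Set E3) (E₀ Em : ℝ) (σ : KernelDom → ℝ) :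
    Set (MultiIdx m → KernelDom → ℝ) :=
  {D | ∀ α : MultiIdx m, AEStronglyMeasurable (D α) (kernelMeasure G E₀ Em) ∧
    HasWeakXDeriv G (univ ×ˢ (univ ×ˢ Ioo E₀ Em)) (kernelMeasure G E₀ Em) α.toFun σ (D α)}

/-- The norm `max_{|α| ≤ m} ‖∂_x^α σ‖` of `W^{∞,(m,0,0)}(G × S × I, L¹(S'))`; it is `⊤` if `σ` is
not in that space. -/
def kernelNorm (m : ℕ) (G : Set E3) (E₀ Em : ℝ) (σ : KernelDom → ℝ) : ENNReal :=
  ⨅ D ∈ weakDerivs m G E₀ Em σ, ⨆ α, mixedNorm G E₀ Em (D α)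

/-- The norm `max_{|α| ≤ m} ‖∂_x^α σ‖` of `W^{∞,(m,0,0)}(G × S' × I, L¹(S))`; it is `⊤` if `σ` is
not in that space. -/
def kernelNorm' (m : ℕ) (G : Set E3) (E₀ Em : ℝ) (σ : KernelDom → ℝ) : ENNReal :=
  ⨅ D ∈ weakDerivs m G E₀ Em σ, ⨆ α, mixedNorm' G E₀ Em (D α)

/-- `τ` belongs to `C₀^{(∞,0,0)}(closure G × S × I, L¹(S'), Γ₋)`, as the function
`(x, ω, E) ↦ τ(x, ·, ω, E)` with values in `L¹(S')`. -/
def IsSmoothKernel (G : Set E3) (E₀ Em : ℝ) (τ : KernelDom → ℝ) : Prop :=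
  ∃ F : Phase → Lp ℝ 1 sphereMeasure, ClassC0 ⊤ G E₀ Em F ∧
    ∀ᵐ p ∂phaseMeasure G E₀ Em, ∀ᵐ ω' ∂sphereMeasure, τ (p.1, ω', p.2.1, p.2.2) = F p ω'

/-- `σ` belongs to `𝒲₀^{∞,(m,0,0)}(G × S × I, L¹(S'), Γ₋)`, the completion of
`C₀^{(∞,0,0)}(closure G × S × I, L¹(S'), Γ₋) ∩ W^{∞,(m,0,0)}(G × S' × I, L¹(S))` with respect to
the sum of the two norms. -/
def MemW0 (m : ℕ) (G : Set E3) (E₀ Em : ℝ) (σ : KernelDom → ℝ) : Prop :=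
  ∀ ε : ENNReal, 0 < ε → ∃ τ : KernelDom → ℝ,
    AEStronglyMeasurable τ (kernelMeasure G E₀ Em) ∧ IsSmoothKernel G E₀ Em τ ∧
      kernelNorm' m G E₀ Em τ < ⊤ ∧
      kernelNorm m G E₀ Em (σ - τ) + kernelNorm' m G E₀ Em (σ - τ) < ε

/-- The integrand `ω' ↦ σ(x, ω', ω, E) ψ(x, ω', E)` at the point `p = (x, ω, E)`. -/
def collisionIntegrand (σ : KernelDom → ℝ) (ψ : Phase → ℝ) (p : Phase) (ω' : S2) : ℝ :=
  σ (p.1, ω', p.2.1, p.2.2) * ψ (p.1, ω', p.2.2)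

/-- The collision operator
`(K_r ψ)(x, ω, E) = ∫_{S'} σ(x, ω', ω, E) ψ(x, ω', E) dω'`. -/
def collision (σ : KernelDom → ℝ) (ψ : Phase → ℝ) (p : Phase) : ℝ :=
  ∫ ω', collisionIntegrand σ ψ p ω' ∂sphereMeasure

end Transport

end

open Set Filter Topology MeasureTheory

noncomputable section

namespace Transport

open scoped ENNReal NNReal BoundedContinuousFunction

universe u v

/-! ### Calculus in the spatial variable -/

section ClassCX

variable {Y : Type v} [TopologicalSpace Y]

/-! Differentiating under the integral gives, formally, `∂^α(Kψ) = ∑ c_{αβγ} T_β(∂^γ ψ)`, where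
`T_β` is the integral operator with kernel `∂^β σ`. The Schur test bounds every `T_β` on `L²` by
`√(N₁ N₂)`. The right-hand side is therefore a bounded operator on families `(u_γ)` of `L²`
functions, with norm at most `∑ |c_{αβγ}| · √(N₁ N₂)`. The coefficients are universal, so the
constant depends only on `m`. This operator, `IsKernelFamily.op`, is defined on all families from
the outset. What remains is to show that it maps derivative families into the closure of the
families of smooth functions vanishing near `Γ₋ ∪ Γ₀`, and that its zeroth component is the
collision integral.

The range statement is proved by two approximations. First, `σ` is replaced by a smooth
`L¹(S')`-valued kernel `τ`. Weak derivatives are unique, so the difference of the two operators is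
the operator of `σ - τ`, which is small by the Schur test (`IsKernelFamily.norm_op_sub_le`). Second,
`ψ` is replaced by combinations of products `f(x) g(ω) h(E)`, which are dense in `H^{(m,0,0)}`
(`mem_closure_span_isTensorFamily`). The density uses convexity of `G`: contracting towards an
interior point leaves room to mollify in `x` without leaving `G`. For a smooth kernel and a product,
`Kψ` is explicitly `(∫ τ g dω') f h`. It is smooth in `x`, and its support is contained in that of
`τ`, so the boundary condition comes from the kernel alone (`IsSmoothKernel.classC0`).

The Leibniz rule is used in its dual form `f ∂^α φ = ∑ c ∂^β(φ ∂^γ f)`, which puts derivatives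
outside products of smooth functions and so pairs directly with the weak derivatives of `∫ σ g dω'`
(`hasWeakXDeriv_mul`).

The approximants `τ` come only with finite `N₂`. Finiteness of `N₁` follows by identifying their
scalar weak derivatives with the bounded `L¹`-valued classical ones
(`IsSmoothKernel.mixedNorm_lt_top`). Finally, `H^{(m,0,0)}` is closed in the space of families, so
closures in the two spaces agree (`exists_mem_sobolevH0`). -/

theorem ClassCX.continuous {X : Type u} [NormedAddCommGroup X] [NormedSpace ℝ X]
    {k : ℕ∞} {f : E3 × Y → X} (hf : ClassCX k f) : Continuous f := by
  have h := (continuousMultilinearCurryFin0 ℝ E3 X).continuous.comp (hf.2 0 (by simp))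
  refine h.congr fun p => ?_
  simp [continuousMultilinearCurryFin0]

theorem ClassCX.of_le {X : Type u} [NormedAddCommGroup X] [NormedSpace ℝ X]
    {k l : ℕ∞} {f : E3 × Y → X} (hf : ClassCX k f) (h : l ≤ k) : ClassCX l f :=
  ⟨fun y => (hf.1 y).of_le (by exact_mod_cast h), fun n hn => hf.2 n (hn.trans h)⟩

theorem classCX_top_iff {X : Type u} [NormedAddCommGroup X] [NormedSpace ℝ X]
    {f : E3 × Y → X} : ClassCX ⊤ f ↔ ∀ n : ℕ, ClassCX n f :=
  ⟨fun h _ => h.of_le le_top, fun h => ⟨fun y => contDiff_infty.2 fun n => (h n).1 y,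
    fun n _ => (h n).2 n le_rfl⟩⟩

theorem classCX_zero_iff {X : Type u} [NormedAddCommGroup X] [NormedSpace ℝ X]
    {f : E3 × Y → X} : ClassCX ((0 : ℕ) : ℕ∞) f ↔ Continuous f := by
  refine ⟨ClassCX.continuous, fun h => ⟨fun y => ?_, fun n hn => ?_⟩⟩
  · have : Continuous fun x => f (x, y) := by fun_prop
    simpa using (contDiff_zero (𝕜 := ℝ)).2 this
  · obtain rfl : n = 0 := by simpa using hn
    exact ((continuousMultilinearCurryFin0 ℝ E3 X).symm.continuous.comp h).congr
      fun p => by rw [iteratedFDeriv_zero_eq_comp]; rfl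

/-- A function is of class `C^{n+1}` in `x` iff it is continuous and its spatial derivative is of
class `C^n` in `x`. -/
theorem classCX_succ_iff {X : Type u} [NormedAddCommGroup X] [NormedSpace ℝ X]
    {n : ℕ} {f : E3 × Y → X} : ClassCX ((n + 1 : ℕ) : ℕ∞) f ↔
      Continuous f ∧ (∀ y, Differentiable ℝ fun x => f (x, y)) ∧
        ClassCX n fun p : E3 × Y => fderiv ℝ (fun x => f (x, p.2)) p.1 := by
  constructor
  · intro h
    refine ⟨h.continuous, fun y => (h.1 y).differentiable (by simp), fun y => ?_, fun j hj => ?_⟩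
    · exact (h.1 y).fderiv_right (by norm_cast)
    · have hj' : ((j + 1 : ℕ) : ℕ∞) ≤ ((n + 1 : ℕ) : ℕ∞) := by
        exact_mod_cast Nat.succ_le_succ (by exact_mod_cast hj)
      refine ((continuousMultilinearCurryRightEquiv' ℝ j E3 X).continuous.comp
        (h.2 (j + 1) hj')).congr fun p => ?_
      simp only [Function.comp_apply]
      rw [iteratedFDeriv_succ_eq_comp_right]
      simp only [Function.comp_apply, LinearIsometryEquiv.apply_symm_apply]
  · rintro ⟨hc, hd, h⟩
    refine ⟨fun y => ?_, fun j hj => ?_⟩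
    · have := (contDiff_succ_iff_fderiv (𝕜 := ℝ) (n := (n : WithTop ℕ∞))
        (f := fun x => f (x, y))).2 ⟨hd y, by simp, h.1 y⟩
      exact_mod_cast this
    · rcases j with _ | j
      · exact (classCX_zero_iff.2 hc).2 0 le_rfl
      · have hj' : (j : ℕ∞) ≤ n := by
          have : j + 1 ≤ n + 1 := by exact_mod_cast hj
          exact_mod_cast Nat.le_of_succ_le_succ this
        refine ((continuousMultilinearCurryRightEquiv' ℝ j E3 X).symm.continuous.comp
          (h.2 j hj')).congr fun p => ?_
        rw [iteratedFDeriv_succ_eq_comp_right]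
        rfl

theorem ClassCX.fderiv_top {X : Type u} [NormedAddCommGroup X] [NormedSpace ℝ X]
    {f : E3 × Y → X} (hf : ClassCX ⊤ f) :
    ClassCX ⊤ fun p : E3 × Y => fderiv ℝ (fun x => f (x, p.2)) p.1 :=
  classCX_top_iff.2 fun n => (classCX_succ_iff.1 (classCX_top_iff.1 hf (n + 1))).2.2

theorem ClassCX.differentiable {X : Type u} [NormedAddCommGroup X] [NormedSpace ℝ X]
    {f : E3 × Y → X} (hf : ClassCX ⊤ f) (y : Y) : Differentiable ℝ fun x => f (x, y) :=
  (hf.1 y).differentiable (by simp)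

theorem ClassCX.clm_comp {X : Type u} [NormedAddCommGroup X] [NormedSpace ℝ X]
    {X' : Type*} [NormedAddCommGroup X'] [NormedSpace ℝ X'] (L : X →L[ℝ] X')
    {k : ℕ∞} {f : E3 × Y → X} (hf : ClassCX k f) : ClassCX k fun p => L (f p) := by
  refine ⟨fun y => L.contDiff.comp (hf.1 y), fun n hn => ?_⟩
  have hk : ((n : ℕ) : WithTop ℕ∞) ≤ (k : WithTop ℕ∞) := by exact_mod_cast hn
  refine ((ContinuousLinearMap.compContinuousMultilinearMapL ℝ (fun _ : Fin n => E3) X X'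
    L).continuous.comp (hf.2 n hn)).congr fun p => ?_
  exact (L.iteratedFDeriv_comp_left ((hf.1 p.2).contDiffAt) hk).symm

/-- The derivative of `B(f, g)` is `B(f, g') + B(f', g)`, again a sum of bilinear expressions but
with values in spaces of operators. The induction therefore runs over all bilinear maps and all
normed spaces of one universe at once. -/
theorem ClassCX.bilin_nat (n : ℕ) : ∀ {X₁ X₂ X₃ : Type u}
    [NormedAddCommGroup X₁] [NormedSpace ℝ X₁] [NormedAddCommGroup X₂] [NormedSpace ℝ X₂]
    [NormedAddCommGroup X₃] [NormedSpace ℝ X₃] (B : X₁ →L[ℝ] X₂ →L[ℝ] X₃)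
    {f : E3 × Y → X₁} {g : E3 × Y → X₂}, ClassCX n f → ClassCX n g →
    ClassCX n fun p => B (f p) (g p) := by
  induction n with
  | zero =>
    intro X₁ X₂ X₃ _ _ _ _ _ _ B f g hf hg
    rw [classCX_zero_iff] at *
    exact (B.continuous.comp hf).clm_apply hg
  | succ n ih =>
    intro X₁ X₂ X₃ _ _ _ _ _ _ B f g hf hg
    have hf₀ := hf.of_le (l := n) (by exact_mod_cast Nat.le_succ n)
    have hg₀ := hg.of_le (l := n) (by exact_mod_cast Nat.le_succ n)
    rw [classCX_succ_iff] at *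
    obtain ⟨hfc, hfd, hf'⟩ := hf
    obtain ⟨hgc, hgd, hg'⟩ := hg
    refine ⟨(B.continuous.comp hfc).clm_apply hgc, fun y x =>
      (B.hasFDerivAt_of_bilinear (hfd y x).hasFDerivAt (hgd y x).hasFDerivAt).differentiableAt, ?_⟩
    have h := (ih (B.precompR E3) hf₀ hg').add (ih (B.precompL E3) hf' hg₀)
    convert h using 1
    funext p
    exact B.fderiv_of_bilinear (hfd p.2 p.1) (hgd p.2 p.1)

theorem ClassCX.bilin {X₁ X₂ X₃ : Type u}
    [NormedAddCommGroup X₁] [NormedSpace ℝ X₁] [NormedAddCommGroup X₂] [NormedSpace ℝ X₂]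
    [NormedAddCommGroup X₃] [NormedSpace ℝ X₃] (B : X₁ →L[ℝ] X₂ →L[ℝ] X₃)
    {f : E3 × Y → X₁} {g : E3 × Y → X₂} (hf : ClassCX ⊤ f) (hg : ClassCX ⊤ g) :
    ClassCX ⊤ fun p => B (f p) (g p) :=
  classCX_top_iff.2 fun n =>
    ClassCX.bilin_nat n B (classCX_top_iff.1 hf n) (classCX_top_iff.1 hg n)

theorem ClassCX.mul {f g : E3 × Y → ℝ} (hf : ClassCX ⊤ f) (hg : ClassCX ⊤ g) :
    ClassCX ⊤ fun p => f p * g p :=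
  ClassCX.bilin (ContinuousLinearMap.mul ℝ ℝ) hf hg

theorem ClassCX.comp_right {X : Type u} [NormedAddCommGroup X] [NormedSpace ℝ X]
    {Y' : Type*} [TopologicalSpace Y'] {k : ℕ∞} {f : E3 × Y → X} (hf : ClassCX k f)
    {q : Y' → Y} (hq : Continuous q) : ClassCX k fun p : E3 × Y' => f (p.1, q p.2) :=
  ⟨fun y => hf.1 (q y), fun n hn =>
    (hf.2 n hn).comp (continuous_fst.prodMk (hq.comp continuous_snd))⟩

theorem classCX_of_contDiff {X : Type u} [NormedAddCommGroup X] [NormedSpace ℝ X]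
    {f : E3 → X} (hf : ContDiff ℝ (⊤ : ℕ∞) f) : ClassCX ⊤ fun p : E3 × Y => f p.1 :=
  ⟨fun _ => hf, fun _ _ => (hf.continuous_iteratedFDeriv (by exact_mod_cast le_top)).comp
    continuous_fst⟩

theorem classCX_of_continuous {X : Type u} [NormedAddCommGroup X] [NormedSpace ℝ X]
    {g : Y → X} (hg : Continuous g) : ClassCX ⊤ fun p : E3 × Y => g p.2 := by
  refine classCX_top_iff.2 fun n => ?_
  have h0 : ∀ n : ℕ, ClassCX n fun _ : E3 × Y => (0 : E3 →L[ℝ] X) := fun n => by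
    have := classCX_of_contDiff (Y := Y) (f := fun _ : E3 => (0 : E3 →L[ℝ] X)) contDiff_const
    exact classCX_top_iff.1 this n
  cases n with
  | zero => exact classCX_zero_iff.2 (hg.comp continuous_snd)
  | succ n =>
    refine classCX_succ_iff.2 ⟨hg.comp continuous_snd, fun y => differentiable_const (g y), ?_⟩
    simpa using h0 n

/-- The spatial partial derivative of a function with values in a normed space. -/
def xpd {X : Type u} [NormedAddCommGroup X] [NormedSpace ℝ X] {Y : Type v} (i : Fin 3)
    (f : E3 × Y → X) : E3 × Y → X :=
  fun p => fderiv ℝ (fun x => f (x, p.2)) p.1 (EuclideanSpace.single i 1)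

theorem ClassCX.xpd {X : Type u} [NormedAddCommGroup X] [NormedSpace ℝ X]
    {f : E3 × Y → X} (hf : ClassCX ⊤ f) (i : Fin 3) : ClassCX ⊤ (xpd i f) :=
  hf.fderiv_top.clm_comp (ContinuousLinearMap.apply ℝ X (EuclideanSpace.single i 1))

/-- Off the topological support `f` vanishes on a full neighbourhood, hence on the slice through the
point. -/
theorem support_xpd_subset {X : Type u} [NormedAddCommGroup X] [NormedSpace ℝ X]
    (i : Fin 3) (f : E3 × Y → X) : Function.support (Transport.xpd i f) ⊆ tsupport f := by
  intro p hp
  by_contra hpf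
  apply hp
  have h0 : f =ᶠ[𝓝 p] 0 := notMem_tsupport_iff_eventuallyEq.1 hpf
  have h1 : (fun x => f (x, p.2)) =ᶠ[𝓝 p.1] fun _ => 0 := by
    have : Tendsto (fun x : E3 => (x, p.2)) (𝓝 p.1) (𝓝 p) := by
      have : Continuous fun x : E3 => (x, p.2) := by fun_prop
      exact this.tendsto p.1
    exact this.eventually h0
  simp [Transport.xpd, h1.fderiv_eq]

theorem tsupport_xpd_subset {X : Type u} [NormedAddCommGroup X] [NormedSpace ℝ X]
    (i : Fin 3) (f : E3 × Y → X) : tsupport (Transport.xpd i f) ⊆ tsupport f :=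
  closure_minimal (support_xpd_subset i f) (isClosed_tsupport f)

theorem HasCompactSupport.xpd {X : Type u} [NormedAddCommGroup X] [NormedSpace ℝ X]
    {f : E3 × Y → X} (hf : HasCompactSupport f) (i : Fin 3) :
    HasCompactSupport (Transport.xpd i f) :=
  IsCompact.of_isClosed_subset hf (isClosed_tsupport _) (tsupport_xpd_subset i f)

end ClassCX

/-! ### Iterated partial derivatives -/

/-- The partial derivative `∂^α` of a function on `ℝ³`. -/
def mpd (α : Fin 3 → ℕ) (g : E3 → ℝ) : E3 → ℝ :=
  (pd 0)^[α 0] ((pd 1)^[α 1] ((pd 2)^[α 2] g))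

theorem xPartial_apply {Y : Type v} (α : Fin 3 → ℕ) (φ : E3 × Y → ℝ) (p : E3 × Y) :
    xPartial α φ p = mpd α (fun x => φ (x, p.2)) p.1 := rfl

theorem iterate_xpd_apply {Y : Type v} (i : Fin 3) (n : ℕ) (φ : E3 × Y → ℝ) (x : E3) (y : Y) :
    (xpd i)^[n] φ (x, y) = (pd i)^[n] (fun x => φ (x, y)) x := by
  induction n generalizing x with
  | zero => rfl
  | succ n ih =>
    rw [Function.iterate_succ_apply', Function.iterate_succ_apply']
    simp only [xpd, pd, ih]

theorem xPartial_eq_iterate_xpd {Y : Type v} (α : Fin 3 → ℕ) (φ : E3 × Y → ℝ) :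
    xPartial α φ = (xpd 0)^[α 0] ((xpd 1)^[α 1] ((xpd 2)^[α 2] φ)) := by
  funext ⟨x, y⟩
  simp only [xPartial, iterate_xpd_apply]

/-- Induction along the partial derivatives making up `∂_x^α`. -/
theorem xPartial_induction {Y : Type v} (P : (E3 × Y → ℝ) → Prop)
    (h : ∀ i φ, P φ → P (xpd i φ)) (α : Fin 3 → ℕ) {φ : E3 × Y → ℝ} (hφ : P φ) :
    P (xPartial α φ) := by
  have it : ∀ i n φ, P φ → P ((xpd i)^[n] φ) := by
    intro i n
    induction n with
    | zero => exact fun φ h => h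
    | succ n ih =>
      intro φ hφ
      rw [Function.iterate_succ_apply]
      exact ih _ (h i φ hφ)
  rw [xPartial_eq_iterate_xpd]
  exact it _ _ _ (it _ _ _ (it _ _ _ hφ))

theorem ClassCX.xPartial {Y : Type v} [TopologicalSpace Y] {φ : E3 × Y → ℝ} (h : ClassCX ⊤ φ)
    (α : Fin 3 → ℕ) : ClassCX ⊤ (xPartial α φ) :=
  xPartial_induction (ClassCX ⊤) (fun i _ h => h.xpd i) α h

theorem IsTest.mul_classCX {Y : Type v} [TopologicalSpace Y] {G : Set E3} {V : Set Y}
    {φ χ : E3 × Y → ℝ} (h : IsTest G V φ) (hχ : ClassCX ⊤ χ) :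
    IsTest G V fun p => φ p * χ p :=
  ⟨h.1.mul hχ, h.2.1.mul_right, (tsupport_mul_subset_left).trans h.2.2⟩

/-! ### Algebra of partial derivatives of smooth functions on `ℝ³`. -/

theorem pd_contDiff {g : E3 → ℝ} (hg : ContDiff ℝ (⊤ : ℕ∞) g) (i : Fin 3) :
    ContDiff ℝ (⊤ : ℕ∞) (pd i g) :=
  (hg.fderiv_right (m := ((⊤ : ℕ∞) : WithTop ℕ∞)) (by norm_cast)).clm_apply contDiff_const

theorem iterate_pd_contDiff {g : E3 → ℝ} (hg : ContDiff ℝ (⊤ : ℕ∞) g) (i : Fin 3) (n : ℕ) :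
    ContDiff ℝ (⊤ : ℕ∞) ((pd i)^[n] g) := by
  induction n with
  | zero => exact hg
  | succ n ih => rw [Function.iterate_succ_apply']; exact pd_contDiff ih i

theorem mpd_contDiff {g : E3 → ℝ} (hg : ContDiff ℝ (⊤ : ℕ∞) g) (α : Fin 3 → ℕ) :
    ContDiff ℝ (⊤ : ℕ∞) (mpd α g) :=
  iterate_pd_contDiff (iterate_pd_contDiff (iterate_pd_contDiff hg _ _) _ _) _ _

theorem pd_comm {g : E3 → ℝ} (hg : ContDiff ℝ (⊤ : ℕ∞) g) (i j : Fin 3) :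
    pd i (pd j g) = pd j (pd i g) := by
  funext x
  have hd : DifferentiableAt ℝ (fderiv ℝ g) x :=
    ((hg.fderiv_right (m := ((⊤ : ℕ∞) : WithTop ℕ∞)) (by norm_cast)).differentiable (by simp)) x
  have key : ∀ a b : Fin 3, pd a (pd b g) x =
      fderiv ℝ (fderiv ℝ g) x (EuclideanSpace.single a 1) (EuclideanSpace.single b 1) := by
    intro a b
    have := fderiv_clm_apply hd (differentiableAt_const (EuclideanSpace.single b (1 : ℝ)))
    change fderiv ℝ (fun y => fderiv ℝ g y (EuclideanSpace.single b 1)) x _ = _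
    rw [this]
    simp
  rw [key, key]
  exact (hg.contDiffAt.isSymmSndFDerivAt (by
    rw [minSmoothness_of_isRCLikeNormedField]
    exact WithTop.coe_le_coe.2 (le_top : (2 : ℕ∞) ≤ ⊤))) _ _

theorem iterate_pd_comm {g : E3 → ℝ} (hg : ContDiff ℝ (⊤ : ℕ∞) g) (i j : Fin 3) (n : ℕ) :
    pd i ((pd j)^[n] g) = (pd j)^[n] (pd i g) := by
  induction n with
  | zero => rfl
  | succ n ih =>
    rw [Function.iterate_succ_apply', pd_comm (iterate_pd_contDiff hg j n), ih,
      Function.iterate_succ_apply']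

theorem pd_mpd {g : E3 → ℝ} (hg : ContDiff ℝ (⊤ : ℕ∞) g) (i : Fin 3) (α : Fin 3 → ℕ) :
    pd i (mpd α g) = mpd α (pd i g) := by
  unfold mpd
  rw [iterate_pd_comm (iterate_pd_contDiff (iterate_pd_contDiff hg _ _) _ _),
    iterate_pd_comm (iterate_pd_contDiff hg _ _), iterate_pd_comm hg]

/-- `mpd` applies its derivatives in a fixed order. Symmetry of second derivatives lets the extra
one be applied first, which is the form needed for induction on `|α|`. -/
theorem mpd_add_single {g : E3 → ℝ} (hg : ContDiff ℝ (⊤ : ℕ∞) g) (i : Fin 3) (α : Fin 3 → ℕ) :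
    mpd (α + Pi.single i 1) g = mpd α (pd i g) := by
  have h2 := iterate_pd_contDiff hg 2 (α 2)
  fin_cases i
  · simp only [mpd, Pi.add_apply]
    simp [iterate_pd_comm hg, iterate_pd_comm h2]
  · simp only [mpd, Pi.add_apply]
    simp [iterate_pd_comm hg]
  · simp [mpd]

theorem pd_add {f g : E3 → ℝ} (hf : ContDiff ℝ (⊤ : ℕ∞) f) (hg : ContDiff ℝ (⊤ : ℕ∞) g)
    (i : Fin 3) : pd i (f + g) = pd i f + pd i g := by
  funext x
  simp [pd, fderiv_add (hf.differentiable (by simp) x) (hg.differentiable (by simp) x)]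

theorem pd_const_smul {f : E3 → ℝ} (hf : ContDiff ℝ (⊤ : ℕ∞) f) (c : ℝ)
    (i : Fin 3) : pd i (c • f) = c • pd i f := by
  funext x
  simp [pd, fderiv_const_smul (hf.differentiable (by simp) x)]

theorem pd_mul {f g : E3 → ℝ} (hf : ContDiff ℝ (⊤ : ℕ∞) f) (hg : ContDiff ℝ (⊤ : ℕ∞) g)
    (i : Fin 3) : pd i (f * g) = f * pd i g + g * pd i f := by
  funext x
  simp [pd, fderiv_mul (hf.differentiable (by simp) x) (hg.differentiable (by simp) x)]

theorem iterate_pd_add {f g : E3 → ℝ} (hf : ContDiff ℝ (⊤ : ℕ∞) f) (hg : ContDiff ℝ (⊤ : ℕ∞) g)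
    (i : Fin 3) (n : ℕ) : (pd i)^[n] (f + g) = (pd i)^[n] f + (pd i)^[n] g := by
  induction n with
  | zero => rfl
  | succ n ih =>
    simp only [Function.iterate_succ_apply', ih]
    exact pd_add (iterate_pd_contDiff hf i n) (iterate_pd_contDiff hg i n) i

theorem iterate_pd_const_smul {f : E3 → ℝ} (hf : ContDiff ℝ (⊤ : ℕ∞) f) (c : ℝ)
    (i : Fin 3) (n : ℕ) : (pd i)^[n] (c • f) = c • (pd i)^[n] f := by
  induction n with
  | zero => rfl
  | succ n ih =>
    simp only [Function.iterate_succ_apply', ih]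
    exact pd_const_smul (iterate_pd_contDiff hf i n) c i

theorem mpd_add {f g : E3 → ℝ} (hf : ContDiff ℝ (⊤ : ℕ∞) f) (hg : ContDiff ℝ (⊤ : ℕ∞) g)
    (α : Fin 3 → ℕ) : mpd α (f + g) = mpd α f + mpd α g := by
  unfold mpd
  rw [iterate_pd_add hf hg, iterate_pd_add, iterate_pd_add] <;>
  repeat' first | exact hf | exact hg | apply iterate_pd_contDiff

theorem mpd_const_smul {f : E3 → ℝ} (hf : ContDiff ℝ (⊤ : ℕ∞) f) (c : ℝ)
    (α : Fin 3 → ℕ) : mpd α (c • f) = c • mpd α f := by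
  unfold mpd
  rw [iterate_pd_const_smul hf, iterate_pd_const_smul, iterate_pd_const_smul] <;>
  repeat' first | exact hf | apply iterate_pd_contDiff

theorem xPartial_const_mul {Y : Type v} [TopologicalSpace Y] {φ : E3 × Y → ℝ} (h : ClassCX ⊤ φ)
    (g : Y → ℝ) (α : Fin 3 → ℕ) (p : E3 × Y) :
    xPartial α (fun p => g p.2 * φ p) p = g p.2 * xPartial α φ p := by
  have := congrFun (mpd_const_smul (h.1 p.2) (g p.2) α) p.1
  exact this

/-! ### The Leibniz rule with derivatives on the outside -/

/-- Smooth functions on `ℝ³`. -/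
abbrev SmoothFn : Type := {f : E3 → ℝ // ContDiff ℝ (⊤ : ℕ∞) f}

/-- The expression `∂^β (φ ∂^γ f)`, as a function of `f` and `φ`. -/
def outerLeibnizTerm (β γ : Fin 3 → ℕ) : SmoothFn → SmoothFn → E3 → ℝ :=
  fun f φ => mpd β (φ.1 * mpd γ f.1)

/-- Induction on `|α|`: substituting `∂_i φ` for `φ` is linear on functions of the pair `(f, φ)`,
and the product rule shows that it maps each spanning term into the span of the next order. Taking
spans in the space of functions of `(f, φ)` is what makes the coefficients independent of `f` and
`φ`. -/
theorem mul_mpd_mem_span (n : ℕ) : ∀ α : Fin 3 → ℕ, ∑ i, α i = n →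
    (fun f φ : SmoothFn => f.1 * mpd α φ.1) ∈ Submodule.span ℝ
      {b | ∃ β γ : Fin 3 → ℕ, ∑ i, β i + ∑ i, γ i ≤ n ∧ b = outerLeibnizTerm β γ} := by
  induction n with
  | zero =>
    intro α hα
    have : α = 0 := by
      funext i
      simpa using (Finset.sum_eq_zero_iff.1 hα) i (Finset.mem_univ i)
    subst this
    refine Submodule.subset_span ⟨0, 0, by simp, ?_⟩
    funext f φ
    simp [outerLeibnizTerm, mpd, mul_comm]
  | succ n ih =>
    intro α hα
    obtain ⟨i, hi⟩ : ∃ i, α i ≠ 0 := by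
      by_contra! h
      simp [h] at hα
    obtain ⟨α', rfl⟩ : ∃ α' : Fin 3 → ℕ, α = α' + Pi.single i 1 := by
      refine ⟨fun j => α j - (Pi.single i 1 : Fin 3 → ℕ) j, ?_⟩
      funext j
      by_cases h : j = i
      · subst h
        have h1 : (Pi.single j 1 : Fin 3 → ℕ) j = 1 := Pi.single_eq_same j 1
        change α j = α j - (Pi.single j 1 : Fin 3 → ℕ) j + (Pi.single j 1 : Fin 3 → ℕ) j
        omega
      · have h1 : (Pi.single i 1 : Fin 3 → ℕ) j = 0 := Pi.single_eq_of_ne h 1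
        change α j = α j - (Pi.single i 1 : Fin 3 → ℕ) j + (Pi.single i 1 : Fin 3 → ℕ) j
        omega
    have hsingle : ∑ j, (Pi.single i 1 : Fin 3 → ℕ) j = 1 := by
      rw [Finset.sum_pi_single' i 1 Finset.univ]; simp
    have hα' : ∑ i, α' i = n := by
      simp only [Pi.add_apply, Finset.sum_add_distrib] at hα
      omega
    let R : (SmoothFn → SmoothFn → E3 → ℝ) →ₗ[ℝ] (SmoothFn → SmoothFn → E3 → ℝ) :=
      { toFun := fun b f φ => b f ⟨pd i φ.1, pd_contDiff φ.2 i⟩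
        map_add' := fun _ _ => rfl
        map_smul' := fun _ _ => rfl }
    have hR := Submodule.mem_map_of_mem (f := R) (ih α' hα')
    have e : (fun f φ : SmoothFn => f.1 * mpd (α' + Pi.single i 1) φ.1) =
        R (fun f φ : SmoothFn => f.1 * mpd α' φ.1) := by
      funext f φ
      simp only [R, LinearMap.coe_mk, AddHom.coe_mk]
      rw [mpd_add_single φ.2]
    rw [e]
    refine (?_ : Submodule.map R _ ≤ _) hR
    rw [Submodule.map_span, Submodule.span_le]
    rintro _ ⟨_, ⟨β, γ, hs, rfl⟩, rfl⟩
    -- This is `∂^β(∂_i φ ∂^γ f) = ∂^{β+e_i}(φ ∂^γ f) - ∂^β(φ ∂^{γ+e_i} f)`.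
    have e2 : R (outerLeibnizTerm β γ) = outerLeibnizTerm (β + Pi.single i 1) γ +
        (-1 : ℝ) • outerLeibnizTerm β (γ + Pi.single i 1) := by
      funext f φ
      simp only [R, LinearMap.coe_mk, AddHom.coe_mk, outerLeibnizTerm, Pi.add_apply, Pi.smul_apply]
      have h1 := mpd_contDiff f.2 γ
      have h2 := pd_contDiff φ.2 i
      have h3 := pd_contDiff h1 i
      have h4 : ContDiff ℝ (⊤ : ℕ∞) (φ.1 * mpd γ f.1) := φ.2.mul h1
      have h5 : ContDiff ℝ (⊤ : ℕ∞) (φ.1 * pd i (mpd γ f.1)) := φ.2.mul h3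
      have h6 : ContDiff ℝ (⊤ : ℕ∞) (mpd γ f.1 * pd i φ.1) := h1.mul h2
      rw [mpd_add_single h4, mpd_add_single f.2, ← pd_mpd f.2, pd_mul φ.2 h1, mpd_add h5 h6,
        mul_comm (mpd γ f.1)]
      simp
    rw [e2]
    refine Submodule.add_mem _ (Submodule.subset_span ⟨_, _, ?_, rfl⟩)
      (Submodule.smul_mem _ _ (Submodule.subset_span ⟨_, _, ?_, rfl⟩)) <;>
    · simp only [Pi.add_apply, Finset.sum_add_distrib]
      omega

theorem MultiIdx.exists_toFun_eq {m : ℕ} {β : Fin 3 → ℕ} (h : ∑ i, β i ≤ m) :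
    ∃ β' : MultiIdx m, β'.toFun = β := by
  have hb : ∀ i, β i < m + 1 := fun i =>
    Nat.lt_succ_of_le ((Finset.single_le_sum (fun _ _ => Nat.zero_le _) (Finset.mem_univ i)).trans h)
  exact ⟨⟨fun i => ⟨β i, hb i⟩, h⟩, rfl⟩

theorem MultiIdx.toFun_zero (m : ℕ) : (MultiIdx.zero m).toFun = 0 := by
  funext i
  simp [MultiIdx.toFun, MultiIdx.zero]

/-- Existence of universal coefficients in the Leibniz rule
`f ∂^α φ = ∑_{β, γ} c_{αβγ} ∂^β (φ ∂^γ f)`. -/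
theorem exists_outerLeibniz_coeff (m : ℕ) :
    ∃ c : MultiIdx m → MultiIdx m → MultiIdx m → ℝ,
      (∀ α, ∀ f φ : E3 → ℝ, ContDiff ℝ (⊤ : ℕ∞) f → ContDiff ℝ (⊤ : ℕ∞) φ → ∀ x,
        f x * mpd α.toFun φ x =
          ∑ β, ∑ γ, c α β γ * mpd β.toFun (fun x => φ x * mpd γ.toFun f x) x) ∧
      ∀ β γ, c (MultiIdx.zero m) β γ =
        if β = MultiIdx.zero m ∧ γ = MultiIdx.zero m then 1 else 0 := by
  classical
  have key : ∀ α : MultiIdx m, ∃ c : MultiIdx m × MultiIdx m → ℝ,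
      ∑ q, c q • outerLeibnizTerm q.1.toFun q.2.toFun =
        fun f φ : SmoothFn => f.1 * mpd α.toFun φ.1 := by
    intro α
    have h := mul_mpd_mem_span _ α.toFun rfl
    rw [← Submodule.mem_span_range_iff_exists_fun ℝ]
    refine Submodule.span_mono ?_ h
    rintro _ ⟨β, γ, hs, rfl⟩
    have hα : ∑ i, α.toFun i ≤ m := α.2
    obtain ⟨β', rfl⟩ := MultiIdx.exists_toFun_eq (m := m) (β := β) (by omega)
    obtain ⟨γ', rfl⟩ := MultiIdx.exists_toFun_eq (m := m) (β := γ) (by omega)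
    exact ⟨(β', γ'), rfl⟩
  choose c hc using key
  -- Membership in a span does not single out coefficients. For `α = 0` the obvious ones are
  -- imposed, so that the zeroth component of the resulting operator is exactly the integral
  -- operator.
  refine ⟨fun α β γ => if α = MultiIdx.zero m then
    (if β = MultiIdx.zero m ∧ γ = MultiIdx.zero m then 1 else 0) else c α (β, γ), ?_, by simp⟩
  intro α f φ hf hφ x
  by_cases hα : α = MultiIdx.zero m
  · subst hα
    simp only [if_true, ite_mul, one_mul, zero_mul, ite_and]
    rw [Finset.sum_eq_single (MultiIdx.zero m), Finset.sum_eq_single (MultiIdx.zero m)]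
    · simp [MultiIdx.toFun_zero, mpd, mul_comm]
    · intro b _ hb; simp [hb]
    · simp
    · intro b _ hb; simp [hb]
    · simp
  · have := congrFun (congrFun (congrFun (hc α) ⟨f, hf⟩) ⟨φ, hφ⟩) x
    simp only [Finset.sum_apply, Pi.smul_apply, outerLeibnizTerm, smul_eq_mul, Pi.mul_apply] at this
    rw [← this, Fintype.sum_prod_type]
    simp only [hα, if_false]
    rfl

/-! ### Separation of integrable functions by test functions -/

section Separation

/-- Splitting `w` into positive and negative parts turns the statement that `w` integrates to zero
against certain functions into an equality of two finite positive measures, to which uniqueness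
theorems for measures apply. -/
theorem integral_mul_comp_eq_sub {Ω C : Type*} [MeasurableSpace Ω] {μ : Measure Ω} {w : Ω → ℝ}
    (hw : Integrable w μ) [MeasurableSpace C] [TopologicalSpace C] [OpensMeasurableSpace C]
    {Z : Ω → C} (hZ : Measurable Z) (H : C →ᵇ ℝ) :
    ∫ a, w a * H (Z a) ∂μ =
      ∫ c, H c ∂((μ.withDensity fun a => ENNReal.ofReal (w a)).map Z) -
      ∫ c, H c ∂((μ.withDensity fun a => ENNReal.ofReal (-w a)).map Z) := by
  have hH : Measurable H := H.continuous.measurable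
  have hn : AEMeasurable (fun a => ENNReal.ofReal (-w a)) μ :=
    hw.neg.aemeasurable.ennreal_ofReal
  rw [integral_map hZ.aemeasurable hH.aestronglyMeasurable,
    integral_map hZ.aemeasurable hH.aestronglyMeasurable,
    integral_withDensity_eq_integral_toReal_smul₀ hw.aemeasurable.ennreal_ofReal (by simp),
    integral_withDensity_eq_integral_toReal_smul₀ hn (by simp)]
  have hb : ∀ v : Ω → ℝ, Integrable v μ →
      Integrable (fun a => (ENNReal.ofReal (v a)).toReal • H (Z a)) μ := by
    intro v hv
    have h1 : Integrable (fun a => (ENNReal.ofReal (v a)).toReal) μ := by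
      simpa [ENNReal.toReal_ofReal'] using hv.pos_part
    exact h1.mul_bdd (c := ‖H‖) (hH.comp hZ).aestronglyMeasurable
      (ae_of_all _ fun a => H.norm_coe_le_norm _)
  rw [← integral_sub (hb w hw) (hb (fun a => -w a) hw.neg)]
  refine integral_congr_ae (ae_of_all _ fun a => ?_)
  simp only [ENNReal.toReal_ofReal', smul_eq_mul, ← sub_mul]
  congr 1
  rcases le_total 0 (w a) with h | h
  · rw [max_eq_left h, max_eq_right (by linarith)]; ring
  · rw [max_eq_right h, max_eq_left (by linarith)]; ring

/-- A finite Borel measure on a product is determined by its integrals of products `f ⊗ g`. The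
images of `w⁺ μ` and `w⁻ μ` under `(X, Y)` therefore coincide. -/
theorem integral_mul_comp_prod_eq_zero {Ω A B : Type*} [MeasurableSpace Ω] {μ : Measure Ω}
    {w : Ω → ℝ} (hw : Integrable w μ)
    [TopologicalSpace A] [MeasurableSpace A] [BorelSpace A] [HasOuterApproxClosed A]
    [TopologicalSpace B] [MeasurableSpace B] [BorelSpace B] [HasOuterApproxClosed B]
    [OpensMeasurableSpace (A × B)]
    {X : Ω → A} {Y : Ω → B} (hX : Measurable X) (hY : Measurable Y)
    (h : ∀ (f : A →ᵇ ℝ) (g : B →ᵇ ℝ), ∫ a, w a * (f (X a) * g (Y a)) ∂μ = 0) (F : (A × B) →ᵇ ℝ) :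
    ∫ a, w a * F (X a, Y a) ∂μ = 0 := by
  have hXY : Measurable fun a => (X a, Y a) := hX.prodMk hY
  have := isFiniteMeasure_withDensity_ofReal hw.2
  have := isFiniteMeasure_withDensity_ofReal hw.neg.2
  have e := Measure.ext_of_integral_mul_boundedContinuousFunction
    (μ := (μ.withDensity fun a => ENNReal.ofReal (w a)).map fun a => (X a, Y a))
    (ν := (μ.withDensity fun a => ENNReal.ofReal (-w a)).map fun a => (X a, Y a)) (by
      intro f g
      have h1 := integral_mul_comp_eq_sub hw hXY
        ((f.compContinuous ⟨Prod.fst, continuous_fst⟩) *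
          (g.compContinuous ⟨Prod.snd, continuous_snd⟩))
      simp only [BoundedContinuousFunction.coe_mul, Pi.mul_apply,
        BoundedContinuousFunction.compContinuous_apply, ContinuousMap.coe_mk] at h1
      rw [h f g] at h1
      exact (sub_eq_zero.1 h1.symm))
  rw [integral_mul_comp_eq_sub hw hXY F, e, sub_self]

theorem ae_eq_zero_of_integral_mul_bcf {C : Type*} [MeasurableSpace C] {μ : Measure C}
    [TopologicalSpace C] [BorelSpace C] [HasOuterApproxClosed C] {w : C → ℝ}
    (hw : Integrable w μ) (h : ∀ F : C →ᵇ ℝ, ∫ a, w a * F a ∂μ = 0) : w =ᵐ[μ] 0 := by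
  have := isFiniteMeasure_withDensity_ofReal hw.2
  have := isFiniteMeasure_withDensity_ofReal hw.neg.2
  have e := ext_of_forall_integral_eq_of_IsFiniteMeasure
    (μ := μ.withDensity fun a => ENNReal.ofReal (w a))
    (ν := μ.withDensity fun a => ENNReal.ofReal (-w a)) (by
      intro F
      have h1 := integral_mul_comp_eq_sub hw measurable_id F
      simp only [id, Measure.map_id] at h1
      rw [h F] at h1
      exact sub_eq_zero.1 h1.symm)
  have hfin : ∫⁻ a, ENNReal.ofReal (w a) ∂μ ≠ ∞ := by
    refine ((lintegral_mono fun x => ?_).trans_lt hw.2).ne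
    exact Real.ofReal_le_enorm (w x)
  have hn : AEMeasurable (fun a => ENNReal.ofReal (-w a)) μ :=
    hw.neg.aemeasurable.ennreal_ofReal
  rw [withDensity_eq_iff hw.aemeasurable.ennreal_ofReal hn hfin] at e
  -- Almost everywhere `w⁺ = w⁻`, while at each point one of the two is zero.
  filter_upwards [e] with a ha
  rcases le_total 0 (w a) with h0 | h0
  · rw [ENNReal.ofReal_of_nonpos (neg_nonpos.2 h0), ENNReal.ofReal_eq_zero] at ha
    exact le_antisymm ha h0
  · rw [ENNReal.ofReal_of_nonpos h0, eq_comm, ENNReal.ofReal_eq_zero] at ha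
    exact le_antisymm h0 (by simpa using ha)

theorem ae_eq_zero_of_integral_mul_tensor {A B : Type*}
    [TopologicalSpace A] [MeasurableSpace A] [BorelSpace A] [HasOuterApproxClosed A]
    [TopologicalSpace B] [MeasurableSpace B] [BorelSpace B] [HasOuterApproxClosed B]
    [BorelSpace (A × B)] [HasOuterApproxClosed (A × B)] {μ : Measure (A × B)}
    {w : A × B → ℝ} (hw : Integrable w μ)
    (h : ∀ (f : A →ᵇ ℝ) (g : B →ᵇ ℝ), ∫ a, w a * (f a.1 * g a.2) ∂μ = 0) : w =ᵐ[μ] 0 :=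
  ae_eq_zero_of_integral_mul_bcf hw
    (integral_mul_comp_prod_eq_zero hw measurable_fst measurable_snd h)

theorem isTest_tensor {Y : Type*} [TopologicalSpace Y] {G : Set E3} {V : Set Y}
    {f : E3 → ℝ} (hf : ContDiff ℝ (⊤ : ℕ∞) f) (hfc : HasCompactSupport f) (hfG : tsupport f ⊆ G)
    {g : Y → ℝ} (hg : Continuous g) (hgc : HasCompactSupport g) (hgV : tsupport g ⊆ V) :
    IsTest G V fun p : E3 × Y => f p.1 * g p.2 := by
  have hsub : tsupport (fun p : E3 × Y => f p.1 * g p.2) ⊆ tsupport f ×ˢ tsupport g := by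
    refine closure_minimal (fun p hp => ?_) ((isClosed_tsupport f).prod (isClosed_tsupport g))
    have hp' : f p.1 * g p.2 ≠ 0 := hp
    exact ⟨subset_tsupport f (left_ne_zero_of_mul hp'),
      subset_tsupport g (right_ne_zero_of_mul hp')⟩
  exact ⟨(classCX_of_contDiff hf).mul (classCX_of_continuous hg),
    IsCompact.of_isClosed_subset (hfc.prod hgc) (isClosed_tsupport _) hsub,
    hsub.trans (prod_mono hfG hgV)⟩

theorem exists_isTest_ne_zero {Y : Type*} [TopologicalSpace Y] [RegularSpace Y]
    [LocallyCompactSpace Y] {G : Set E3} {V : Set Y} (hG : IsOpen G) (hV : IsOpen V)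
    {p : E3 × Y} (hp : p ∈ G ×ˢ V) : ∃ φ, IsTest G V φ ∧ φ p ≠ 0 := by
  obtain ⟨f, hfG, hfc, hf, -, hf1⟩ := exists_contDiff_tsupport_subset (n := ⊤) (hG.mem_nhds hp.1)
  obtain ⟨k, k_comp, k_closed, sk, kV⟩ := exists_compact_closed_between
    (isCompact_singleton (x := p.2)) hV (singleton_subset_iff.2 hp.2)
  obtain ⟨g, hg1, hg0, hgc, -⟩ := exists_continuous_one_zero_of_isCompact
    (isCompact_singleton (x := p.2)) (isOpen_interior (s := k)).isClosed_compl
    (disjoint_compl_right_iff_subset.2 sk)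
  have hgk : tsupport g ⊆ k := closure_minimal (fun y hy => by
    by_contra hyk
    exact hy (hg0 fun h => hyk (interior_subset h))) k_closed
  refine ⟨_, isTest_tensor hf hfc hfG g.continuous hgc (hgk.trans kV), ?_⟩
  have : g p.2 = 1 := hg1 rfl
  simp [hf1, this]

/-- The fundamental lemma of the calculus of variations for the test functions on `G × V`. -/
theorem ae_eq_zero_of_forall_isTest {Y : Type*} [MetricSpace Y] [LocallyCompactSpace Y]
    [SecondCountableTopology Y] [MeasurableSpace Y] [BorelSpace Y] {G : Set E3} {V : Set Y}
    (hG : IsOpen G) (hV : IsOpen V) {μ : Measure (E3 × Y)} (hμ : μ (G ×ˢ V)ᶜ = 0)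
    {w : E3 × Y → ℝ}
    (hw : ∀ φ, IsTest G V φ → Integrable (fun p => w p * φ p) μ ∧ ∫ p, w p * φ p ∂μ = 0) :
    w =ᵐ[μ] 0 := by
  -- Multiplying by a test function makes `w` globally integrable, so that separation by tensor
  -- products of bounded continuous functions applies to `w φ`.
  have step : ∀ φ, IsTest G V φ → (fun p => w p * φ p) =ᵐ[μ] 0 := by
    intro φ hφ
    have h_int := (hw φ hφ).1
    refine ae_eq_zero_of_integral_mul_tensor h_int fun f g => ?_
    have hgm : Measurable fun p : E3 × Y => g p.2 := by
      exact g.continuous.measurable.comp measurable_snd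
    have hbd : ∀ f' : E3 → ℝ, Continuous f' → (∃ C, ∀ x, ‖f' x‖ ≤ C) →
        Integrable (fun p => w p * φ p * (f' p.1 * g p.2)) μ := by
      rintro f' hf' ⟨C, hC⟩
      refine h_int.mul_bdd (c := C * ‖g‖)
        ((hf'.measurable.comp measurable_fst).mul hgm).aestronglyMeasurable
        (ae_of_all _ fun p => ?_)
      rw [norm_mul]
      exact mul_le_mul (hC _) (g.norm_coe_le_norm _) (norm_nonneg _)
        ((norm_nonneg _).trans (hC p.1))
    have hle : ∀ ε : ℝ, 0 < ε → |∫ a, w a * φ a * (f a.1 * g a.2) ∂μ| ≤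
        ε * (‖g‖ * ∫ a, ‖w a * φ a‖ ∂μ) := by
      intro ε hε
      -- The factor in `x` is merely continuous. A uniformly close smooth `f'` makes `φ f' g` a test
      -- function, against which `w` integrates to zero.
      obtain ⟨f', hf', hd, -⟩ := f.continuous.exists_contDiff_approx ⊤
        (continuous_const (y := ε)) (fun _ => hε)
      have h0 : ∫ a, w a * φ a * (f' a.1 * g a.2) ∂μ = 0 := by
        have := (hw _ (hφ.mul_classCX ((classCX_of_contDiff (Y := Y) hf').mul
          (classCX_of_continuous g.continuous)))).2
        simpa [mul_assoc] using this
      have hb' : ∃ C, ∀ x, ‖f' x‖ ≤ C := by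
        refine ⟨‖f‖ + ε, fun x => ?_⟩
        have h1 : ‖f' x‖ ≤ ‖f x‖ + ‖f' x - f x‖ := by
          simpa using norm_add_le (f x) (f' x - f x)
        have h2 := (hd x).le
        rw [dist_eq_norm] at h2
        linarith [f.norm_coe_le_norm x]
      have hi1 := hbd f f.continuous ⟨‖f‖, f.norm_coe_le_norm⟩
      have hi2 := hbd f' hf'.continuous hb'
      have e : ∫ a, w a * φ a * (f a.1 * g a.2) ∂μ =
          ∫ a, w a * φ a * (f a.1 * g a.2) - w a * φ a * (f' a.1 * g a.2) ∂μ := by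
        rw [integral_sub hi1 hi2, h0, sub_zero]
      rw [e, ← Real.norm_eq_abs, ← integral_const_mul, ← integral_const_mul]
      refine norm_integral_le_of_norm_le ((h_int.norm.const_mul _).const_mul _)
        (ae_of_all _ fun a => ?_)
      have h2 := (hd a.1).le
      rw [dist_comm, dist_eq_norm] at h2
      rw [← mul_sub, ← sub_mul, norm_mul, norm_mul (f a.1 - f' a.1)]
      calc ‖w a * φ a‖ * (‖f a.1 - f' a.1‖ * ‖g a.2‖)
          ≤ ‖w a * φ a‖ * (ε * ‖g‖) := by
            gcongr
            exact g.norm_coe_le_norm _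
        _ = ε * (‖g‖ * ‖w a * φ a‖) := by ring
    have hI : 0 ≤ ‖g‖ * ∫ a, ‖w a * φ a‖ ∂μ :=
      mul_nonneg (norm_nonneg _) (integral_nonneg fun _ => norm_nonneg _)
    set I := ‖g‖ * ∫ a, ‖w a * φ a‖ ∂μ
    have : |∫ a, w a * φ a * (f a.1 * g a.2) ∂μ| ≤ 0 := by
      refine le_of_forall_pos_le_add fun δ hδ => ?_
      have := hle (δ / (I + 1)) (by positivity)
      have h2 : δ / (I + 1) * I ≤ δ := by
        rw [div_mul_eq_mul_div, div_le_iff₀ (by positivity)]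
        nlinarith
      linarith
    exact abs_eq_zero.1 (le_antisymm this (abs_nonneg _))
  -- Near each point of `G × V` some test function does not vanish, so `w` vanishes a.e. locally.
  -- Second countability makes this global.
  have hnull : μ ({p | w p ≠ 0} ∩ G ×ˢ V) = 0 := by
    refine measure_null_of_locally_null _ fun p hp => ?_
    obtain ⟨φ, hφ, hφp⟩ := exists_isTest_ne_zero hG hV hp.2
    refine ⟨{q | w q * φ q ≠ 0}, ?_, step φ hφ⟩
    have h1 : {q | φ q ≠ 0} ∈ 𝓝 p := (hφ.1.continuous.isOpen_preimage _ isOpen_ne).mem_nhds hφp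
    filter_upwards [mem_nhdsWithin_of_mem_nhds h1, self_mem_nhdsWithin] with q hq hq'
    exact mul_ne_zero hq'.1 hq
  refine measure_mono_null (fun p hp => ?_) (measure_union_null hnull hμ)
  by_cases hpG : p ∈ G ×ˢ V
  · exact Or.inl ⟨hp, hpG⟩
  · exact Or.inr hpG

theorem HasWeakXDeriv.ae_unique {Y : Type*} [MetricSpace Y] [LocallyCompactSpace Y]
    [SecondCountableTopology Y] [MeasurableSpace Y] [BorelSpace Y] {G : Set E3} {V : Set Y}
    (hG : IsOpen G) (hV : IsOpen V) {μ : Measure (E3 × Y)} (hμ : μ (G ×ˢ V)ᶜ = 0)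
    {α : Fin 3 → ℕ} {u v v' : E3 × Y → ℝ} (h : HasWeakXDeriv G V μ α u v)
    (h' : HasWeakXDeriv G V μ α u v') : v =ᵐ[μ] v' := by
  have : (v - v') =ᵐ[μ] 0 := by
    refine ae_eq_zero_of_forall_isTest hG hV hμ fun φ hφ => ?_
    obtain ⟨-, h2, h3⟩ := h φ hφ
    obtain ⟨-, h2', h3'⟩ := h' φ hφ
    simp only [Pi.sub_apply, sub_mul]
    refine ⟨h2.sub h2', ?_⟩
    rw [integral_sub h2 h2', sub_eq_zero]
    rw [h3] at h3'
    exact mul_left_cancel₀ (pow_ne_zero _ (by norm_num)) h3'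
  filter_upwards [this] with p hp
  exact sub_eq_zero.1 hp

end Separation

/-! ### Integral operators and the Schur test -/

section Schur

set_option linter.unusedSectionVars false

variable {P A : Type*} [MeasurableSpace P] [MeasurableSpace A] {μ : Measure P} {ν : Measure A}
  {s : P × A → P × A} {κ : P × A → ℝ} {N₁ N₂ : ℝ≥0}

/-- Cauchy–Schwarz for the measure `k dν`, applied to the functions `1` and `f`. -/
theorem sq_lintegral_mul_le {k f : A → ℝ≥0∞} (hk : Measurable k) (hf : Measurable f) :
    (∫⁻ b, k b * f b ∂ν) ^ 2 ≤ (∫⁻ b, k b ∂ν) * ∫⁻ b, k b * f b ^ 2 ∂ν := by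
  have h := ENNReal.lintegral_mul_le_Lp_mul_Lq (ν.withDensity k) Real.HolderConjugate.two_two
    (f := fun _ => 1) (g := f) aemeasurable_const hf.aemeasurable
  simp only [Pi.mul_apply, one_mul, ENNReal.one_rpow] at h
  rw [lintegral_withDensity_eq_lintegral_mul _ hk hf,
    lintegral_withDensity_eq_lintegral_mul _ hk measurable_const,
    lintegral_withDensity_eq_lintegral_mul _ hk (hf.pow_const _)] at h
  simp only [Pi.mul_apply, mul_one] at h
  calc (∫⁻ b, k b * f b ∂ν) ^ 2 ≤ ((∫⁻ b, k b ∂ν) ^ (1 / (2 : ℝ)) *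
        (∫⁻ b, k b * f b ^ (2 : ℝ) ∂ν) ^ (1 / (2 : ℝ))) ^ 2 := by gcongr
    _ = _ := by
      rw [mul_pow, ← ENNReal.rpow_natCast, ← ENNReal.rpow_mul, ← ENNReal.rpow_natCast,
        ← ENNReal.rpow_mul]
      norm_num

/-- `κ` is the kernel of an integral operator on the fibres of `μ × ν` which satisfies the
hypotheses of the Schur test. The involution `s` exchanges the two integration variables. -/
structure SchurKernel (μ : Measure P) (ν : Measure A) (s : P × A → P × A) (κ : P × A → ℝ)
    (N₁ N₂ : ℝ≥0) : Prop where
  mp : MeasurePreserving s (μ.prod ν) (μ.prod ν)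
  invol : ∀ r, s (s r) = r
  measurable : Measurable κ
  bound : ∀ᵐ p ∂μ, ∫⁻ b, ‖κ (p, b)‖ₑ ∂ν ≤ N₁
  bound' : ∀ᵐ p ∂μ, ∫⁻ b, ‖κ (s (p, b))‖ₑ ∂ν ≤ N₂

/-- The integral operator with kernel `κ`. -/
def schurFun (ν : Measure A) (s : P × A → P × A) (κ : P × A → ℝ) (f : P → ℝ) (p : P) : ℝ :=
  ∫ b, κ (p, b) * f (s (p, b)).1 ∂ν

/-- The kernel of the adjoint operator, with the two bounds interchanged. -/
theorem SchurKernel.symm (h : SchurKernel μ ν s κ N₁ N₂) :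
    SchurKernel μ ν s (fun r => κ (s r)) N₂ N₁ :=
  ⟨h.mp, h.invol, h.measurable.comp h.mp.measurable, h.bound', by simpa [h.invol] using h.bound⟩

variable [SFinite μ] [SFinite ν]

/-- The Schur test: weighted Cauchy–Schwarz on each fibre costs `N₁`. After the measure-preserving
exchange of variables `f` no longer depends on the fibre variable, and integrating the kernel out
costs `N₂`. -/
theorem SchurKernel.lintegral_sq_le (h : SchurKernel μ ν s κ N₁ N₂) {f : P → ℝ}
    (hf : Measurable f) :
    ∫⁻ p, (∫⁻ b, ‖κ (p, b)‖ₑ * ‖f (s (p, b)).1‖ₑ ∂ν) ^ 2 ∂μ ≤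
      N₁ * N₂ * ∫⁻ p, ‖f p‖ₑ ^ 2 ∂μ := by
  have hκ := h.measurable
  have hs := h.mp.measurable
  have hfs : Measurable fun r => f (s r).1 := hf.comp (measurable_fst.comp hs)
  have m1 : Measurable fun r : P × A => ‖κ r‖ₑ * ‖f (s r).1‖ₑ ^ 2 :=
    hκ.enorm.mul (hfs.enorm.pow_const 2)
  have m2 : Measurable fun r : P × A => ‖κ (s r)‖ₑ * ‖f r.1‖ₑ ^ 2 :=
    (hκ.comp hs).enorm.mul ((hf.comp measurable_fst).enorm.pow_const 2)
  calc ∫⁻ p, (∫⁻ b, ‖κ (p, b)‖ₑ * ‖f (s (p, b)).1‖ₑ ∂ν) ^ 2 ∂μ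
      ≤ ∫⁻ p, N₁ * ∫⁻ b, ‖κ (p, b)‖ₑ * ‖f (s (p, b)).1‖ₑ ^ 2 ∂ν ∂μ := by
        refine lintegral_mono_ae ?_
        filter_upwards [h.bound] with p hp
        refine (sq_lintegral_mul_le (hκ.comp measurable_prodMk_left).enorm
          (hfs.comp measurable_prodMk_left).enorm).trans ?_
        exact mul_le_mul' hp le_rfl
    _ = N₁ * ∫⁻ r, ‖κ r‖ₑ * ‖f (s r).1‖ₑ ^ 2 ∂(μ.prod ν) := by
        rw [lintegral_const_mul _ m1.lintegral_prod_right', lintegral_prod _ m1.aemeasurable]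
    _ = N₁ * ∫⁻ r, ‖κ (s r)‖ₑ * ‖f r.1‖ₑ ^ 2 ∂(μ.prod ν) := by
        rw [← h.mp.lintegral_comp m1]
        simp only [h.invol]
    _ = N₁ * ∫⁻ p, (∫⁻ b, ‖κ (s (p, b))‖ₑ ∂ν) * ‖f p‖ₑ ^ 2 ∂μ := by
        rw [lintegral_prod _ m2.aemeasurable]
        congr 1
        refine lintegral_congr fun p => ?_
        have hm : Measurable fun b => ‖κ (s (p, b))‖ₑ :=
          ((hκ.comp hs).comp measurable_prodMk_left).enorm
        exact lintegral_mul_const (μ := ν) (‖f p‖ₑ ^ 2) hm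
    _ ≤ N₁ * ∫⁻ p, N₂ * ‖f p‖ₑ ^ 2 ∂μ := by
        refine mul_le_mul' le_rfl (lintegral_mono_ae ?_)
        filter_upwards [h.bound'] with p hp
        exact mul_le_mul' hp le_rfl
    _ = _ := by rw [lintegral_const_mul _ (hf.enorm.pow_const 2), mul_assoc]

theorem eLpNorm_two_sq {f : P → ℝ} : eLpNorm f 2 μ ^ 2 = ∫⁻ p, ‖f p‖ₑ ^ 2 ∂μ := by
  have := eLpNorm_nnreal_pow_eq_lintegral (μ := μ) (f := f) (p := 2) (by norm_num)
  simpa using this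

theorem SchurKernel.measurable_integrand (h : SchurKernel μ ν s κ N₁ N₂) {f : P → ℝ}
    (hf : Measurable f) : Measurable fun r => κ r * f (s r).1 :=
  h.measurable.mul (hf.comp (measurable_fst.comp h.mp.measurable))

theorem SchurKernel.lintegral_sq_lt_top (h : SchurKernel μ ν s κ N₁ N₂) {f : P → ℝ}
    (hf : Measurable f) (hf2 : MemLp f 2 μ) :
    ∫⁻ p, (∫⁻ b, ‖κ (p, b)‖ₑ * ‖f (s (p, b)).1‖ₑ ∂ν) ^ 2 ∂μ < ∞ := by
  refine (h.lintegral_sq_le hf).trans_lt ?_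
  rw [← eLpNorm_two_sq]
  exact ENNReal.mul_lt_top (ENNReal.mul_lt_top ENNReal.coe_lt_top ENNReal.coe_lt_top)
    (ENNReal.pow_lt_top hf2.2)

theorem SchurKernel.measurable_lintegral (h : SchurKernel μ ν s κ N₁ N₂) {f : P → ℝ}
    (hf : Measurable f) :
    Measurable fun p => ∫⁻ b, ‖κ (p, b)‖ₑ * ‖f (s (p, b)).1‖ₑ ∂ν := by
  have := (h.measurable_integrand hf).enorm.lintegral_prod_right' (ν := ν)
  simpa [enorm_mul] using this

theorem SchurKernel.ae_integrable (h : SchurKernel μ ν s κ N₁ N₂) {f : P → ℝ}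
    (hf : Measurable f) (hf2 : MemLp f 2 μ) :
    ∀ᵐ p ∂μ, Integrable (fun b => κ (p, b) * f (s (p, b)).1) ν := by
  have h1 := ae_lt_top ((h.measurable_lintegral hf).pow_const 2) (h.lintegral_sq_lt_top hf hf2).ne
  filter_upwards [h1] with p hp
  refine ⟨((h.measurable_integrand hf).comp measurable_prodMk_left).aestronglyMeasurable, ?_⟩
  rw [HasFiniteIntegral]
  simp only [enorm_mul]
  by_contra hc
  rw [not_lt, top_le_iff] at hc
  rw [hc] at hp
  simp at hp

theorem SchurKernel.measurable_schurFun (h : SchurKernel μ ν s κ N₁ N₂) {f : P → ℝ}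
    (hf : Measurable f) : StronglyMeasurable (schurFun ν s κ f) :=
  (h.measurable_integrand hf).stronglyMeasurable.integral_prod_right'

theorem enorm_schurFun_le (f : P → ℝ) (p : P) :
    ‖schurFun ν s κ f p‖ₑ ≤ ∫⁻ b, ‖κ (p, b)‖ₑ * ‖f (s (p, b)).1‖ₑ ∂ν := by
  refine (enorm_integral_le_lintegral_enorm _).trans ?_
  simp [enorm_mul]

theorem SchurKernel.eLpNorm_sq_le (h : SchurKernel μ ν s κ N₁ N₂) {f : P → ℝ}
    (hf : Measurable f) :
    eLpNorm (schurFun ν s κ f) 2 μ ^ 2 ≤ N₁ * N₂ * eLpNorm f 2 μ ^ 2 := by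
  rw [eLpNorm_two_sq, eLpNorm_two_sq]
  refine (lintegral_mono fun p => ?_).trans (h.lintegral_sq_le hf)
  gcongr
  exact enorm_schurFun_le f p

theorem SchurKernel.memLp (h : SchurKernel μ ν s κ N₁ N₂) {f : P → ℝ}
    (hf : Measurable f) (hf2 : MemLp f 2 μ) : MemLp (schurFun ν s κ f) 2 μ := by
  refine ⟨(h.measurable_schurFun hf).aestronglyMeasurable, ?_⟩
  have h1 : eLpNorm (schurFun ν s κ f) 2 μ ^ 2 < ∞ := (h.eLpNorm_sq_le hf).trans_lt
    (ENNReal.mul_lt_top (ENNReal.mul_lt_top ENNReal.coe_lt_top ENNReal.coe_lt_top)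
    (ENNReal.pow_lt_top hf2.2))
  by_contra hc
  rw [not_lt, top_le_iff] at hc
  simp [hc] at h1

/-- This gives independence of the representative: changing `f` on a null set changes almost every
fibre integrand only on a null set. -/
theorem MeasurePreserving.ae_ae_comp_fst {Q : P → Prop}
    (hs : MeasurePreserving s (μ.prod ν) (μ.prod ν)) (hQ : ∀ᵐ p ∂μ, Q p) :
    ∀ᵐ p ∂μ, ∀ᵐ b ∂ν, Q (s (p, b)).1 := by
  have h1 : ∀ᵐ r ∂(μ.prod ν), Q r.1 := Measure.quasiMeasurePreserving_fst.ae hQ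
  exact Measure.ae_ae_of_ae_prod (hs.quasiMeasurePreserving.ae h1)

theorem schurFun_congr {f g : P → ℝ} (hs : MeasurePreserving s (μ.prod ν) (μ.prod ν))
    (hfg : f =ᵐ[μ] g) : schurFun ν s κ f =ᵐ[μ] schurFun ν s κ g := by
  filter_upwards [MeasurePreserving.ae_ae_comp_fst hs hfg] with p hp
  refine integral_congr_ae ?_
  filter_upwards [hp] with b hb
  rw [hb]

/-- The bounded operator on `L²` with kernel `κ`. -/
def SchurKernel.toCLM (h : SchurKernel μ ν s κ N₁ N₂) : Lp ℝ 2 μ →L[ℝ] Lp ℝ 2 μ :=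
  LinearMap.mkContinuous
    { toFun := fun f => (h.memLp (Lp.stronglyMeasurable f).measurable (Lp.memLp f)).toLp _
      map_add' := fun f g => by
        rw [← MemLp.toLp_add]
        refine (MemLp.toLp_eq_toLp_iff _ _).2 ?_
        refine (schurFun_congr h.mp (Lp.coeFn_add f g)).trans ?_
        filter_upwards [h.ae_integrable (Lp.stronglyMeasurable f).measurable (Lp.memLp f),
          h.ae_integrable (Lp.stronglyMeasurable g).measurable (Lp.memLp g)] with p h1 h2
        simp only [schurFun, Pi.add_apply, mul_add]
        exact integral_add h1 h2
      map_smul' := fun c f => by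
        rw [RingHom.id_apply, ← MemLp.toLp_const_smul]
        refine (MemLp.toLp_eq_toLp_iff _ _).2 ?_
        refine (schurFun_congr h.mp (Lp.coeFn_smul c f)).trans (ae_of_all _ fun p => ?_)
        simp only [schurFun, Pi.smul_apply, smul_eq_mul, mul_left_comm _ c]
        exact integral_const_mul _ _ }
    (NNReal.sqrt (N₁ * N₂)) fun f => by
      rw [LinearMap.coe_mk, AddHom.coe_mk, Lp.norm_toLp, Lp.norm_def]
      have h1 := h.eLpNorm_sq_le (Lp.stronglyMeasurable f).measurable
      have h2 : (eLpNorm (schurFun ν s κ f) 2 μ) ≤ NNReal.sqrt (N₁ * N₂) * eLpNorm f 2 μ := by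
        rw [← ENNReal.pow_le_pow_left_iff (n := 2) two_ne_zero, mul_pow]
        refine h1.trans_eq ?_
        rw [← ENNReal.coe_pow, NNReal.sq_sqrt, ENNReal.coe_mul]
      have h3 := ENNReal.toReal_mono
        (ENNReal.mul_ne_top ENNReal.coe_ne_top (Lp.eLpNorm_ne_top f)) h2
      simpa [ENNReal.toReal_mul] using h3

theorem SchurKernel.coeFn_toCLM (h : SchurKernel μ ν s κ N₁ N₂) (f : Lp ℝ 2 μ) :
    h.toCLM f =ᵐ[μ] schurFun ν s κ f :=
  MemLp.coeFn_toLp (h.memLp (Lp.stronglyMeasurable f).measurable (Lp.memLp f))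

theorem SchurKernel.norm_toCLM_le (h : SchurKernel μ ν s κ N₁ N₂) :
    ‖h.toCLM‖ ≤ √(N₁ * N₂) := by
  refine (LinearMap.mkContinuous_norm_le _ (NNReal.coe_nonneg _) _).trans_eq ?_
  simp

/-- The fibre integrals of absolute values lie in `L²` by the Schur test, so Hölder against `φ`
gives absolute convergence, as Fubini requires for the adjoint formula. -/
theorem SchurKernel.integrable_mul (h : SchurKernel μ ν s κ N₁ N₂) {f φ : P → ℝ}
    (hf : Measurable f) (hf2 : MemLp f 2 μ) (hφ : Measurable φ) (hφ2 : MemLp φ 2 μ) :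
    Integrable (fun r => κ r * f (s r).1 * φ r.1) (μ.prod ν) := by
  have hm : Measurable fun r => κ r * f (s r).1 * φ r.1 :=
    (h.measurable_integrand hf).mul (hφ.comp measurable_fst)
  refine ⟨hm.aestronglyMeasurable, ?_⟩
  rw [HasFiniteIntegral, lintegral_prod _ hm.enorm.aemeasurable]
  have hm' := h.measurable_lintegral hf
  have e : ∀ p, ∫⁻ b, ‖κ (p, b) * f (s (p, b)).1 * φ p‖ₑ ∂ν =
      (∫⁻ b, ‖κ (p, b)‖ₑ * ‖f (s (p, b)).1‖ₑ ∂ν) * ‖φ p‖ₑ := by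
    intro p
    have := ((h.measurable_integrand hf).comp (measurable_prodMk_left (x := p))).enorm
    simp only [Function.comp_def, enorm_mul] at this
    rw [← lintegral_mul_const _ this]
    simp only [enorm_mul]
  simp only [e]
  have hold := ENNReal.lintegral_mul_le_Lp_mul_Lq μ Real.HolderConjugate.two_two
    hm'.aemeasurable hφ.enorm.aemeasurable
  refine hold.trans_lt (ENNReal.mul_lt_top ?_ ?_)
  · refine ENNReal.rpow_lt_top_of_nonneg (by norm_num) ?_
    simpa using (h.lintegral_sq_lt_top hf hf2).ne
  · refine ENNReal.rpow_lt_top_of_nonneg (by norm_num) ?_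
    have : ∫⁻ p, ‖φ p‖ₑ ^ 2 ∂μ < ∞ := by
      rw [← eLpNorm_two_sq]; exact ENNReal.pow_lt_top hφ2.2
    simpa using this.ne

theorem SchurKernel.integral_schurFun_mul (h : SchurKernel μ ν s κ N₁ N₂) {f φ : P → ℝ}
    (hf : Measurable f) (hf2 : MemLp f 2 μ) (hφ : Measurable φ) (hφ2 : MemLp φ 2 μ) :
    ∫ p, schurFun ν s κ f p * φ p ∂μ = ∫ r, κ r * f (s r).1 * φ r.1 ∂(μ.prod ν) := by
  rw [integral_prod _ (h.integrable_mul hf hf2 hφ hφ2)]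
  refine integral_congr_ae (ae_of_all _ fun p => ?_)
  simp only [schurFun]
  rw [integral_mul_const]

/-- The adjoint of an integral operator. -/
theorem SchurKernel.integral_schurFun_mul_comm (h : SchurKernel μ ν s κ N₁ N₂) {f φ : P → ℝ}
    (hf : Measurable f) (hf2 : MemLp f 2 μ) (hφ : Measurable φ) (hφ2 : MemLp φ 2 μ) :
    ∫ p, schurFun ν s κ f p * φ p ∂μ = ∫ p, f p * schurFun ν s (fun r => κ (s r)) φ p ∂μ := by
  simp only [mul_comm (f _)]
  rw [h.integral_schurFun_mul hf hf2 hφ hφ2, h.symm.integral_schurFun_mul hφ hφ2 hf hf2]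
  have hm : Measurable fun r => κ r * f (s r).1 * φ r.1 :=
    (h.measurable_integrand hf).mul (hφ.comp measurable_fst)
  have := integral_map (μ := μ.prod ν) h.mp.measurable.aemeasurable
    (f := fun r => κ r * f (s r).1 * φ r.1) hm.aestronglyMeasurable
  rw [h.mp.map_eq] at this
  rw [this]
  refine integral_congr_ae (ae_of_all _ fun r => ?_)
  simp only [h.invol]
  ring

end Schur

/-! ### The measures -/

instance : IsFiniteMeasure sphereMeasure :=
  inferInstanceAs (IsFiniteMeasure (volume : Measure E3).toSphere)

/-- The measure `dω dE` on `S × I`. -/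
def angleEnergyMeasure (E₀ Em : ℝ) : Measure (S2 × ℝ) :=
  sphereMeasure.prod (volume.restrict (Icc E₀ Em))

instance (E₀ Em : ℝ) : IsFiniteMeasure (angleEnergyMeasure E₀ Em) := by
  unfold angleEnergyMeasure; infer_instance

theorem phaseMeasure_eq (G : Set E3) (E₀ Em : ℝ) :
    phaseMeasure G E₀ Em = (volume.restrict G).prod (angleEnergyMeasure E₀ Em) := rfl

instance (G : Set E3) (E₀ Em : ℝ) : SFinite (phaseMeasure G E₀ Em) := by
  have : SFinite ((volume : Measure E3).restrict G) := inferInstance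
  rw [phaseMeasure_eq]; infer_instance

theorem isFiniteMeasure_restrict_of_isBounded {G : Set E3} (hG : Bornology.IsBounded G) :
    IsFiniteMeasure ((volume : Measure E3).restrict G) :=
  isFiniteMeasure_restrict.2 hG.measure_lt_top.ne

theorem isFiniteMeasure_phaseMeasure {G : Set E3} (hG : Bornology.IsBounded G) (E₀ Em : ℝ) :
    IsFiniteMeasure (phaseMeasure G E₀ Em) := by
  have := isFiniteMeasure_restrict_of_isBounded hG
  rw [phaseMeasure_eq]; infer_instance

/-- The measure is taken over the closed energy interval while test functions live over the open
one; the endpoints are null. -/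
theorem phaseMeasure_compl_eq_zero {G : Set E3} (hG : IsOpen G) (E₀ Em : ℝ) :
    phaseMeasure G E₀ Em (G ×ˢ ((univ : Set S2) ×ˢ Ioo E₀ Em))ᶜ = 0 := by
  have h1 : ∀ᵐ p ∂phaseMeasure G E₀ Em, p.1 ∈ G :=
    Measure.quasiMeasurePreserving_fst.ae (ae_restrict_mem hG.measurableSet)
  have h0 : ∀ᵐ e ∂((volume : Measure ℝ).restrict (Icc E₀ Em)), e ∈ Ioo E₀ Em := by
    rw [restrict_Ioo_eq_restrict_Icc.symm]
    exact ae_restrict_mem measurableSet_Ioo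
  have h2 : ∀ᵐ p ∂phaseMeasure G E₀ Em, p.2.2 ∈ Ioo E₀ Em :=
    Measure.quasiMeasurePreserving_snd.ae (Measure.quasiMeasurePreserving_snd.ae h0)
  have : ∀ᵐ p ∂phaseMeasure G E₀ Em, p ∈ G ×ˢ ((univ : Set S2) ×ˢ Ioo E₀ Em) := by
    filter_upwards [h1, h2] with p hp hp'
    exact ⟨hp, mem_univ _, hp'⟩
  exact this

theorem kernelMeasure_compl_eq_zero {G : Set E3} (hG : IsOpen G) (E₀ Em : ℝ) :
    kernelMeasure G E₀ Em (G ×ˢ ((univ : Set S2) ×ˢ ((univ : Set S2) ×ˢ Ioo E₀ Em)))ᶜ = 0 := by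
  have h1 : ∀ᵐ p ∂kernelMeasure G E₀ Em, p.1 ∈ G :=
    Measure.quasiMeasurePreserving_fst.ae (ae_restrict_mem hG.measurableSet)
  have h0 : ∀ᵐ e ∂((volume : Measure ℝ).restrict (Icc E₀ Em)), e ∈ Ioo E₀ Em := by
    rw [restrict_Ioo_eq_restrict_Icc.symm]
    exact ae_restrict_mem measurableSet_Ioo
  have h2 : ∀ᵐ p ∂kernelMeasure G E₀ Em, p.2.2.2 ∈ Ioo E₀ Em :=
    Measure.quasiMeasurePreserving_snd.ae (Measure.quasiMeasurePreserving_snd.ae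
      (Measure.quasiMeasurePreserving_snd.ae h0))
  have : ∀ᵐ p ∂kernelMeasure G E₀ Em,
      p ∈ G ×ˢ ((univ : Set S2) ×ˢ ((univ : Set S2) ×ˢ Ioo E₀ Em)) := by
    filter_upwards [h1, h2] with p hp hp'
    exact ⟨hp, mem_univ _, mem_univ _, hp'⟩
  exact this

/-- Exchange of the first and the last variable. -/
def swapOuter {A Y : Type*} (r : (A × Y) × A) : (A × Y) × A := ((r.2, r.1.2), r.1.1)

theorem measurePreserving_swapOuter {A Y : Type*} [MeasurableSpace A] [MeasurableSpace Y]
    (γ : Measure A) (ρ : Measure Y) [SFinite γ] [SFinite ρ] :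
    MeasurePreserving (swapOuter (A := A) (Y := Y)) ((γ.prod ρ).prod γ) ((γ.prod ρ).prod γ) := by
  have h1 := measurePreserving_prodAssoc γ ρ γ
  have h2 := Measure.measurePreserving_swap (μ := γ) (ν := ρ.prod γ)
  have h3 := (Measure.measurePreserving_swap (μ := ρ) (ν := γ)).prod (MeasurePreserving.id γ)
  exact h3.comp (h2.comp h1)

/-- Exchange of the two directions in `((x, ω, E), ω')`. -/
def swapAngles (r : Phase × S2) : Phase × S2 := ((r.1.1, r.2, r.1.2.2), r.1.2.1)

theorem measurePreserving_swapAngles (G : Set E3) (E₀ Em : ℝ) :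
    MeasurePreserving swapAngles ((phaseMeasure G E₀ Em).prod sphereMeasure)
      ((phaseMeasure G E₀ Em).prod sphereMeasure) := by
  have h1 := measurePreserving_prodAssoc ((volume : Measure E3).restrict G)
    (angleEnergyMeasure E₀ Em) sphereMeasure
  have h2 := (MeasurePreserving.id ((volume : Measure E3).restrict G)).prod
    (measurePreserving_swapOuter sphereMeasure ((volume : Measure ℝ).restrict (Icc E₀ Em)))
  exact (h1.symm.comp h2).comp h1

/-- The rearrangement `((x, ω, E), ω') ↦ (x, ω', ω, E)`. -/
def toKernelDom : Phase × S2 ≃ᵐ KernelDom :=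
  MeasurableEquiv.prodAssoc.trans
    (MeasurableEquiv.prodCongr (MeasurableEquiv.refl E3) MeasurableEquiv.prodComm)

theorem toKernelDom_apply (p : Phase) (ω' : S2) :
    toKernelDom (p, ω') = (p.1, ω', p.2.1, p.2.2) := rfl

theorem measurePreserving_toKernelDom (G : Set E3) (E₀ Em : ℝ) :
    MeasurePreserving toKernelDom ((phaseMeasure G E₀ Em).prod sphereMeasure)
      (kernelMeasure G E₀ Em) := by
  have h1 := measurePreserving_prodAssoc ((volume : Measure E3).restrict G)
    (angleEnergyMeasure E₀ Em) sphereMeasure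
  have h2 := (MeasurePreserving.id ((volume : Measure E3).restrict G)).prod
    (Measure.measurePreserving_swap (μ := angleEnergyMeasure E₀ Em) (ν := sphereMeasure))
  exact h2.comp h1

/-! ### Integrals depending on a parameter -/

section ParamIntegral

variable {Y : Type v} {γ : Measure E3}
  {φ : E3 × Y → ℝ} {M : ℝ} {r : ℝ} {L : E3 → E3}

/-- The function `(z, y) ↦ ∫ φ(x, y) η(r z + L x) dγ(x)`. -/
def paramInt {X : Type u} [NormedAddCommGroup X] [NormedSpace ℝ X] {Y : Type v} (γ : Measure E3)
    (φ : E3 × Y → ℝ) (r : ℝ) (L : E3 → E3) (η : E3 → X) : E3 × Y → X :=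
  fun p => ∫ x, φ (x, p.2) • η (r • p.1 + L x) ∂γ

/-- Differentiation under the integral sign falls only on `η` and yields an integral of the same
shape with `r • Dη` in place of `η`, so it can be iterated. -/
theorem hasFDerivAt_paramInt [IsFiniteMeasure γ] {X : Type u} [NormedAddCommGroup X]
    [NormedSpace ℝ X]
    (hφm : ∀ y, Measurable fun x => φ (x, y)) (hφb : ∀ p, ‖φ p‖ ≤ M) (hL : Continuous L)
    {η : E3 → X} (hη : ContDiff ℝ (⊤ : ℕ∞) η) (hηc : HasCompactSupport η) (y : Y) (z : E3) :
    HasFDerivAt (fun z => paramInt γ φ r L η (z, y))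
      (paramInt γ φ r L (fun x => r • fderiv ℝ η x) (z, y)) z := by
  have hη' : Continuous (fderiv ℝ η) := hη.continuous_fderiv (by simp)
  obtain ⟨C, hC⟩ := hη'.bounded_above_of_compact_support (hηc.fderiv ℝ)
  obtain ⟨C₀, hC₀⟩ := hη.continuous.bounded_above_of_compact_support hηc
  refine hasFDerivAt_integral_of_dominated_of_fderiv_le
    (F := fun z x => φ (x, y) • η (r • z + L x))
    (F' := fun z x => φ (x, y) • (r • fderiv ℝ η (r • z + L x)))
    (bound := fun _ => M * (|r| * C)) (s := univ) univ_mem ?_ ?_ ?_ ?_ ?_ ?_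
  · refine Eventually.of_forall fun z => ?_
    exact (hφm y).aestronglyMeasurable.smul
      (hη.continuous.comp (continuous_const.add hL)).aestronglyMeasurable
  · refine Integrable.of_bound ((hφm y).aestronglyMeasurable.smul
      (hη.continuous.comp (continuous_const.add hL)).aestronglyMeasurable) (M * C₀)
      (ae_of_all _ fun x => ?_)
    rw [norm_smul]
    exact mul_le_mul (hφb _) (hC₀ _) (norm_nonneg _) ((norm_nonneg _).trans (hφb (x, y)))
  · exact (hφm y).aestronglyMeasurable.smul
      ((hη'.comp (continuous_const.add hL)).const_smul r).aestronglyMeasurable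
  · refine ae_of_all _ fun x z _ => ?_
    rw [norm_smul, norm_smul, Real.norm_eq_abs r]
    exact mul_le_mul (hφb _) (mul_le_mul_of_nonneg_left (hC _) (abs_nonneg r))
      (by positivity) ((norm_nonneg _).trans (hφb (x, y)))
  · exact integrable_const _
  · refine ae_of_all _ fun x z _ => ?_
    have h1 : HasFDerivAt (fun z : E3 => r • z + L x) (r • ContinuousLinearMap.id ℝ E3) z :=
      ((hasFDerivAt_id z).const_smul r).add_const _
    have h2 := ((hη.differentiable (by simp) (r • z + L x)).hasFDerivAt.comp z h1).const_smul
      (φ (x, y))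
    have e : φ (x, y) • (fderiv ℝ η (r • z + L x)) ∘SL (r • ContinuousLinearMap.id ℝ E3) =
        φ (x, y) • (r • fderiv ℝ η (r • z + L x)) := by
      ext v
      simp
    rw [e] at h2
    exact h2

/-- All smoothness in `z` comes from `η`; `φ` contributes measurability in `x`, a bound and
continuity in `y`. The value space is general because each differentiation replaces it by a space of
operators. -/
theorem classCX_paramInt [IsFiniteMeasure γ] [TopologicalSpace Y] [FirstCountableTopology Y]
    (hφm : ∀ y, Measurable fun x => φ (x, y)) (hφc : ∀ x, Continuous fun y => φ (x, y))
    (hφb : ∀ p, ‖φ p‖ ≤ M) (hL : Continuous L) (n : ℕ) :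
    ∀ {X : Type u} [NormedAddCommGroup X] [NormedSpace ℝ X]
    {η : E3 → X}, ContDiff ℝ (⊤ : ℕ∞) η → HasCompactSupport η →
      ClassCX n (paramInt γ φ r L η) := by
  have hcont : ∀ {X : Type u} [NormedAddCommGroup X] [NormedSpace ℝ X]
    {η : E3 → X}, ContDiff ℝ (⊤ : ℕ∞) η → HasCompactSupport η →
      Continuous (paramInt γ φ r L η) := by
    intro X _ _ η hη hηc
    obtain ⟨C, hC⟩ := hη.continuous.bounded_above_of_compact_support hηc
    refine continuous_of_dominated (bound := fun _ => M * C) (fun p => ?_)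
      (fun p => ae_of_all _ fun x => ?_) (integrable_const _) (ae_of_all _ fun x => ?_)
    · exact (hφm p.2).aestronglyMeasurable.smul
        (hη.continuous.comp (continuous_const.add hL)).aestronglyMeasurable
    · rw [norm_smul]
      exact mul_le_mul (hφb _) (hC _) (norm_nonneg _) ((norm_nonneg _).trans (hφb (x, p.2)))
    · exact ((hφc x).comp continuous_snd).smul (hη.continuous.comp
        ((continuous_fst.const_smul r).add continuous_const))
  induction n with
  | zero => exact fun hη hηc => classCX_zero_iff.2 (hcont hη hηc)
  | succ n ih =>
    intro X _ _ η hη hηc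
    have hd := hasFDerivAt_paramInt (γ := γ) (r := r) hφm hφb hL hη hηc
    refine classCX_succ_iff.2 ⟨hcont hη hηc, fun y z => (hd y z).differentiableAt, ?_⟩
    have h1 : ContDiff ℝ (⊤ : ℕ∞) fun x => r • fderiv ℝ η x :=
      (hη.fderiv_right (m := ((⊤ : ℕ∞) : WithTop ℕ∞)) (by norm_cast)).const_smul r
    have h2 : HasCompactSupport fun x => r • fderiv ℝ η x :=
      (hηc.fderiv ℝ).smul_left (f := fun _ => r)
    convert ih h1 h2 using 1
    funext p
    exact (hd p.2 p.1).fderiv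

theorem pd_hasCompactSupport {η : E3 → ℝ} (h : HasCompactSupport η) (i : Fin 3) :
    HasCompactSupport (pd i η) :=
  h.fderiv_apply ℝ (EuclideanSpace.single i 1)

theorem iterate_pd_hasCompactSupport {η : E3 → ℝ} (h : HasCompactSupport η) (i : Fin 3) (n : ℕ) :
    HasCompactSupport ((pd i)^[n] η) := by
  induction n with
  | zero => exact h
  | succ n ih => rw [Function.iterate_succ_apply']; exact pd_hasCompactSupport ih i

theorem mpd_hasCompactSupport {η : E3 → ℝ} (h : HasCompactSupport η) (α : Fin 3 → ℕ) :
    HasCompactSupport (mpd α η) :=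
  iterate_pd_hasCompactSupport (iterate_pd_hasCompactSupport
    (iterate_pd_hasCompactSupport h _ _) _ _) _ _

theorem iterate_xpd_paramInt [IsFiniteMeasure γ]
    (hφm : ∀ y, Measurable fun x => φ (x, y))
    (hφb : ∀ p, ‖φ p‖ ≤ M) (hL : Continuous L) {η : E3 → ℝ} (hη : ContDiff ℝ (⊤ : ℕ∞) η)
    (hηc : HasCompactSupport η) (i : Fin 3) (n : ℕ) (c : ℝ) :
    (xpd i)^[n] (fun p => c * paramInt γ φ r L η p) =
      fun p => c * r ^ n * paramInt γ φ r L ((pd i)^[n] η) p := by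
  induction n with
  | zero => simp
  | succ n ih =>
    rw [Function.iterate_succ_apply', ih]
    funext p
    have h1 := iterate_pd_contDiff hη i n
    have h2 := iterate_pd_hasCompactSupport hηc i n
    have hd := (hasFDerivAt_paramInt (γ := γ) (r := r) hφm hφb hL h1 h2 p.2 p.1).const_mul
      (c * r ^ n)
    obtain ⟨C, hC⟩ := (h1.continuous_fderiv (by simp)).bounded_above_of_compact_support
      (h2.fderiv ℝ)
    simp only [xpd]
    rw [hd.fderiv]
    have h_int : Integrable (fun x => φ (x, p.2) •
        (r • fderiv ℝ ((pd i)^[n] η) (r • p.1 + L x))) γ := by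
      refine Integrable.of_bound ((hφm p.2).aestronglyMeasurable.smul
        (((h1.continuous_fderiv (by simp)).comp
        (continuous_const.add hL)).const_smul r).aestronglyMeasurable) (M * (|r| * C))
        (ae_of_all _ fun x => ?_)
      rw [norm_smul, norm_smul, Real.norm_eq_abs r]
      exact mul_le_mul (hφb _) (mul_le_mul_of_nonneg_left (hC _) (abs_nonneg r))
        (by positivity) ((norm_nonneg _).trans (hφb (x, p.2)))
    simp only [smul_apply, paramInt, smul_eq_mul]
    have hc : c * r ^ (n + 1) = c * r ^ n * r := by rw [pow_succ, mul_assoc]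
    rw [ContinuousLinearMap.integral_apply h_int, hc, mul_assoc (c * r ^ n),
      Function.iterate_succ_apply', ← integral_const_mul r]
    congr 1
    refine integral_congr_ae (ae_of_all γ fun x => ?_)
    simp only [smul_apply, smul_eq_mul, pd]
    ring

theorem xPartial_paramInt [IsFiniteMeasure γ]
    (hφm : ∀ y, Measurable fun x => φ (x, y))
    (hφb : ∀ p, ‖φ p‖ ≤ M) (hL : Continuous L) {η : E3 → ℝ} (hη : ContDiff ℝ (⊤ : ℕ∞) η)
    (hηc : HasCompactSupport η) (α : Fin 3 → ℕ) :
    xPartial α (paramInt γ φ r L η) =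
      fun p => r ^ (∑ i, α i) * paramInt γ φ r L (mpd α η) p := by
  rw [xPartial_eq_iterate_xpd]
  have h0 : paramInt γ φ r L η = fun p => 1 * paramInt γ φ r L η p := by simp
  have h2 := iterate_pd_contDiff hη 2 (α 2)
  have h2c := iterate_pd_hasCompactSupport hηc 2 (α 2)
  rw [h0, iterate_xpd_paramInt hφm hφb hL hη hηc, iterate_xpd_paramInt hφm hφb hL h2 h2c,
    iterate_xpd_paramInt hφm hφb hL (iterate_pd_contDiff h2 1 (α 1))
      (iterate_pd_hasCompactSupport h2c 1 (α 1)), Fin.sum_univ_three]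
  funext p
  rw [mpd]
  ring

end ParamIntegral

/-! ### Mollification -/

section Mollify

variable {G : Set E3} {E₀ Em : ℝ} {θ η : E3 → ℝ} {c : E3} {t : ℝ}

/-- The kernel `θ(c + t x - w)` of a mollification composed with a dilation. -/
def mollKer (θ : E3 → ℝ) (c : E3) (t : ℝ) : Phase × E3 → ℝ :=
  fun r => θ (c + t • r.1.1 - r.2)

/-- The `L¹` norm. -/
def lOneNorm (θ : E3 → ℝ) : ℝ≥0 := (∫⁻ z, ‖θ z‖ₑ).toNNReal

theorem coe_lOneNorm (hθ : Continuous θ) (hθc : HasCompactSupport θ) :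
    (lOneNorm θ : ℝ≥0∞) = ∫⁻ z, ‖θ z‖ₑ :=
  ENNReal.coe_toNNReal (hθ.integrable_of_hasCompactSupport hθc).2.ne

/-- In `w` the kernel is a reflected translate of `θ`, with the same `L¹` norm. In `x` there is also
a dilation by `t` of `ℝ³`, costing `t⁻³ ≤ 8` for `t ≥ 1/2`. -/
theorem schurKernel_mollKer (G : Set E3) (E₀ Em : ℝ) (hθ : Continuous θ)
    (hθc : HasCompactSupport θ) (c : E3) (ht : 1 / 2 ≤ t) :
    SchurKernel (phaseMeasure G E₀ Em) (volume.restrict G) swapOuter (mollKer θ c t)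
      (lOneNorm θ) (8 * lOneNorm θ) where
  mp := measurePreserving_swapOuter _ _
  invol := fun _ => rfl
  measurable := by
    have : Continuous (mollKer θ c t) := by unfold mollKer; fun_prop
    exact this.measurable
  bound := ae_of_all _ fun p => by
    rw [coe_lOneNorm hθ hθc]
    refine (setLIntegral_le_lintegral _ _).trans_eq ?_
    exact lintegral_sub_left_eq_self (μ := (volume : Measure E3)) (fun z => ‖θ z‖ₑ)
      (c + t • p.1)
  bound' := ae_of_all _ fun p => by
    rw [ENNReal.coe_mul, coe_lOneNorm hθ hθc]
    refine (setLIntegral_le_lintegral _ _).trans ?_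
    have ht0 : t ≠ 0 := by linarith
    have hm : Measurable fun z : E3 => ‖θ (z + (c - p.1))‖ₑ := by
      have : Continuous fun z : E3 => θ (z + (c - p.1)) := by fun_prop
      exact this.measurable.enorm
    calc ∫⁻ b, ‖mollKer θ c t (swapOuter (p, b))‖ₑ
        = ∫⁻ b : E3, (fun z : E3 => ‖θ (z + (c - p.1))‖ₑ) (t • b) := by
          refine lintegral_congr fun b => ?_
          simp only [mollKer, swapOuter]
          congr 2
          abel
      _ = ∫⁻ z, ‖θ (z + (c - p.1))‖ₑ ∂(Measure.map (fun x : E3 => t • x) volume) := by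
          rw [lintegral_map hm (measurable_const_smul t)]
      _ = ENNReal.ofReal |(t ^ 3)⁻¹| * ∫⁻ z, ‖θ z‖ₑ := by
          rw [Measure.map_addHaar_smul _ ht0, lintegral_smul_measure,
            lintegral_add_right_eq_self (fun z => ‖θ z‖ₑ)]
          simp
      _ ≤ _ := by
          gcongr
          have h8 : |(t ^ 3)⁻¹| ≤ 8 := by
            have h3 : (1 / 8 : ℝ) ≤ t ^ 3 := by
              calc (1 / 8 : ℝ) = (1 / 2) ^ 3 := by norm_num
                _ ≤ t ^ 3 := by gcongr
            rw [abs_of_nonneg (by positivity)]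
            exact inv_le_of_inv_le₀ (by positivity) (by linarith)
          calc ENNReal.ofReal |(t ^ 3)⁻¹| ≤ ENNReal.ofReal 8 := ENNReal.ofReal_le_ofReal h8
            _ = ((8 : ℝ≥0) : ℝ≥0∞) := by simp

/-- A continuous function with compact support is square integrable on the phase space. -/
theorem memLp_of_continuous_hasCompactSupport {μ : Measure Phase} [IsFiniteMeasure μ]
    {φ : Phase → ℝ} (hφ : Continuous φ) (hφc : HasCompactSupport φ) : MemLp φ 2 μ := by
  obtain ⟨C, hC⟩ := hφ.bounded_above_of_compact_support hφc
  exact MemLp.of_bound hφ.measurable.aestronglyMeasurable C (ae_of_all _ hC)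

/-- The adjoint of the mollification has the form `paramInt` with `r = -1`, so it turns test
functions into smooth functions whose derivatives are known. -/
theorem schurFun_mollKer_symm (φ : Phase → ℝ) :
    schurFun (volume.restrict G) swapOuter (fun r => mollKer θ c t (swapOuter r)) φ =
      paramInt (volume.restrict G) φ (-1) (fun x => c + t • x) θ := by
  funext p
  simp only [schurFun, mollKer, swapOuter, paramInt, smul_eq_mul]
  refine integral_congr_ae (ae_of_all _ fun x => ?_)
  simp only []
  rw [mul_comm]
  congr 2
  simp only [neg_smul, one_smul]
  abel

/-- A point where the integral is nonzero has `x`-coordinate `c + t x - ζ` with `x` in the support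
of `φ` and `ζ` in that of `η`. The hypothesis `hgeo` places all such points in `G`, and the set of
them is compact. -/
theorem isTest_paramInt {Y : Type*} [MetricSpace Y] {V : Set Y} (hGb : Bornology.IsBounded G)
    (hη : ContDiff ℝ (⊤ : ℕ∞) η) (hηc : HasCompactSupport η)
    (hgeo : ∀ x ∈ G, ∀ z ∈ tsupport η, c + t • x - z ∈ G) {φ : E3 × Y → ℝ} (hφ : IsTest G V φ) :
    IsTest G V (paramInt (volume.restrict G) φ (-1) (fun x => c + t • x) η) := by
  have := isFiniteMeasure_restrict_of_isBounded hGb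
  obtain ⟨M, hM⟩ := hφ.1.continuous.bounded_above_of_compact_support hφ.2.1
  have hL : Continuous fun x : E3 => c + t • x := by fun_prop
  have hφc := hφ.1.continuous
  have hφm : ∀ y, Measurable fun x => φ (x, y) := fun y =>
    (hφc.comp (Continuous.prodMk_left y)).measurable
  have hφy : ∀ x, Continuous fun y => φ (x, y) := fun x => hφc.comp (Continuous.prodMk_right x)
  let q : (E3 × Y) × E3 → E3 × Y := fun r => (c + t • r.1.1 - r.2, r.1.2)
  have hq : Continuous q := by fun_prop
  have hK : IsCompact (q '' (tsupport φ ×ˢ tsupport η)) := (hφ.2.1.isCompact.prod hηc).image hq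
  have hsub : tsupport (paramInt (volume.restrict G) φ (-1) (fun x => c + t • x) η) ⊆
      q '' (tsupport φ ×ˢ tsupport η) := by
    refine closure_minimal (fun p hp => ?_) hK.isClosed
    by_contra hpK
    apply hp
    refine (integral_congr_ae (ae_of_all _ fun x => ?_)).trans (integral_zero _ _)
    simp only [smul_eq_mul]
    by_contra hne
    refine hpK ⟨((x, p.2), (-1 : ℝ) • p.1 + (c + t • x)),
      ⟨subset_tsupport _ (left_ne_zero_of_mul hne),
        subset_tsupport _ (right_ne_zero_of_mul hne)⟩, ?_⟩
    simp only [q, neg_smul, one_smul]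
    ext1
    · simp only; abel
    · rfl
  refine ⟨classCX_top_iff.2 fun n => classCX_paramInt hφm hφy hM hL n hη hηc,
    IsCompact.of_isClosed_subset hK (isClosed_tsupport _) hsub, hsub.trans ?_⟩
  rintro _ ⟨r, ⟨h1, h2⟩, rfl⟩
  exact ⟨hgeo _ (hφ.2.2 h1).1 _ h2, (hφ.2.2 h1).2⟩

/-- The mollification operator on `L²`. -/
def mollCLM (G : Set E3) (E₀ Em : ℝ) (hθ : Continuous θ) (hθc : HasCompactSupport θ) (c : E3)
    (ht : 1 / 2 ≤ t) : L2Phase G E₀ Em →L[ℝ] L2Phase G E₀ Em :=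
  (schurKernel_mollKer G E₀ Em hθ hθc c ht).toCLM

theorem coeFn_mollCLM (hθ : Continuous θ) (hθc : HasCompactSupport θ) (c : E3)
    (ht : 1 / 2 ≤ t) (v : L2Phase G E₀ Em) :
    mollCLM G E₀ Em hθ hθc c ht v =ᵐ[phaseMeasure G E₀ Em]
      schurFun (volume.restrict G) swapOuter (mollKer θ c t) v :=
  SchurKernel.coeFn_toCLM _ v

/-- Weak derivatives may be moved from the function to the mollifier. -/
theorem mollCLM_mpd_eq (hG : IsOpen G) (hGb : Bornology.IsBounded G)
    (hη : ContDiff ℝ (⊤ : ℕ∞) η) (hηc : HasCompactSupport η) (ht : 1 / 2 ≤ t)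
    (hgeo : ∀ x ∈ G, ∀ z ∈ tsupport η, c + t • x - z ∈ G) {α : Fin 3 → ℕ}
    {u v : L2Phase G E₀ Em}
    (h : HasWeakXDeriv G (univ ×ˢ Ioo E₀ Em) (phaseMeasure G E₀ Em) α u v) :
    mollCLM G E₀ Em (mpd_contDiff hη α).continuous (mpd_hasCompactSupport hηc α) c ht u =
      mollCLM G E₀ Em hη.continuous hηc c ht v := by
  have := isFiniteMeasure_phaseMeasure hGb E₀ Em
  have := isFiniteMeasure_restrict_of_isBounded hGb
  refine Lp.ext ?_
  have hαc := (mpd_contDiff hη α).continuous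
  have hαs := mpd_hasCompactSupport hηc α
  set a := mollCLM G E₀ Em hαc hαs c ht u with ha
  set b := mollCLM G E₀ Em hη.continuous hηc c ht v with hb
  have key : (fun p => a p - b p) =ᵐ[phaseMeasure G E₀ Em] 0 := by
    refine ae_eq_zero_of_forall_isTest hG (isOpen_univ.prod isOpen_Ioo)
      (phaseMeasure_compl_eq_zero hG E₀ Em) fun φ hφ => ?_
    have hφ2 : MemLp φ 2 (phaseMeasure G E₀ Em) :=
      memLp_of_continuous_hasCompactSupport hφ.1.continuous hφ.2.1
    have hφm := hφ.1.continuous.measurable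
    have ia : Integrable (fun p => a p * φ p) (phaseMeasure G E₀ Em) :=
      (Lp.memLp a).integrable_mul hφ2
    have ib : Integrable (fun p => b p * φ p) (phaseMeasure G E₀ Em) :=
      (Lp.memLp b).integrable_mul hφ2
    simp only [sub_mul]
    refine ⟨ia.sub ib, ?_⟩
    rw [integral_sub ia ib, sub_eq_zero]
    have e1 : ∫ p, a p * φ p ∂phaseMeasure G E₀ Em = ∫ p, u p *
        paramInt (volume.restrict G) φ (-1) (fun x => c + t • x) (mpd α η) p
          ∂phaseMeasure G E₀ Em := by
      rw [← schurFun_mollKer_symm, ← (schurKernel_mollKer G E₀ Em hαc hαs c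
        ht).integral_schurFun_mul_comm (Lp.stronglyMeasurable u).measurable (Lp.memLp u) hφm hφ2]
      refine integral_congr_ae ?_
      filter_upwards [coeFn_mollCLM hαc hαs c ht u] with p hp
      rw [ha, hp]
    have e2 : ∫ p, b p * φ p ∂phaseMeasure G E₀ Em = ∫ p, v p *
        paramInt (volume.restrict G) φ (-1) (fun x => c + t • x) η p
          ∂phaseMeasure G E₀ Em := by
      rw [← schurFun_mollKer_symm, ← (schurKernel_mollKer G E₀ Em hη.continuous hηc c
        ht).integral_schurFun_mul_comm (Lp.stronglyMeasurable v).measurable (Lp.memLp v) hφm hφ2]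
      refine integral_congr_ae ?_
      filter_upwards [coeFn_mollCLM hη.continuous hηc c ht v] with p hp
      rw [hb, hp]
    obtain ⟨-, -, h3⟩ := h _ (isTest_paramInt hGb hη hηc hgeo hφ)
    obtain ⟨M, hM⟩ := hφ.1.continuous.bounded_above_of_compact_support hφ.2.1
    have hL : Continuous fun x : E3 => c + t • x := by fun_prop
    -- With `r = -1` each derivative of the adjoint produces a sign; together these cancel the
    -- `(-1)^|α|` in the definition of the weak derivative.
    rw [xPartial_paramInt (M := M) (fun y =>
      (hφ.1.continuous.comp (Continuous.prodMk_left y)).measurable) hM hL hη hηc] at h3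
    simp only [mul_left_comm (u _)] at h3
    rw [integral_const_mul] at h3
    rw [e1, e2]
    exact mul_left_cancel₀ (pow_ne_zero _ (by norm_num)) h3
  filter_upwards [key] with p hp
  exact sub_eq_zero.1 hp

end Mollify

/-! ### Tensor products -/

section Tensor

variable {G : Set E3} {E₀ Em : ℝ}

/-- The function `a(x) g(ω) h(E)`. -/
def tensorFn (a : E3 → ℝ) (g : S2 → ℝ) (h : ℝ → ℝ) : Phase → ℝ :=
  fun p => a p.1 * (g p.2.1 * h p.2.2)

theorem continuous_tensorFn {a : E3 → ℝ} {g : S2 → ℝ} {h : ℝ → ℝ} (ha : Continuous a)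
    (hg : Continuous g) (hh : Continuous h) : Continuous (tensorFn a g h) := by
  unfold tensorFn; fun_prop

theorem exists_ae_bound_of_continuous (hG : IsOpen G) (hGb : Bornology.IsBounded G)
    {f : Phase → ℝ} (hf : Continuous f) :
    ∃ C, ∀ᵐ p ∂phaseMeasure G E₀ Em, ‖f p‖ ≤ C := by
  have hK : IsCompact (closure G ×ˢ ((univ : Set S2) ×ˢ Icc E₀ Em)) :=
    hGb.isCompact_closure.prod (isCompact_univ.prod isCompact_Icc)
  obtain ⟨C, hC⟩ := hK.exists_bound_of_continuousOn hf.continuousOn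
  refine ⟨C, ?_⟩
  have h : ∀ᵐ p ∂phaseMeasure G E₀ Em, p ∈ G ×ˢ ((univ : Set S2) ×ˢ Ioo E₀ Em) :=
    phaseMeasure_compl_eq_zero hG E₀ Em
  filter_upwards [h] with p hp
  exact hC p ⟨subset_closure hp.1, mem_univ _, Ioo_subset_Icc_self hp.2.2⟩

theorem memLp_of_continuous (hG : IsOpen G) (hGb : Bornology.IsBounded G)
    {f : Phase → ℝ} (hf : Continuous f) : MemLp f 2 (phaseMeasure G E₀ Em) := by
  have := isFiniteMeasure_phaseMeasure hGb E₀ Em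
  obtain ⟨C, hC⟩ := exists_ae_bound_of_continuous (E₀ := E₀) (Em := Em) hG hGb hf
  exact MemLp.of_bound hf.measurable.aestronglyMeasurable C hC

/-- The family `(∂^γ f ⊗ g ⊗ h)_γ` of derivatives of a tensor product. -/
def IsTensorFamily (m : ℕ) (G : Set E3) (E₀ Em : ℝ)
    (u : PiLp 2 (fun _ : MultiIdx m => L2Phase G E₀ Em)) : Prop :=
  ∃ (f : E3 → ℝ) (g : S2 → ℝ) (h : ℝ → ℝ), ContDiff ℝ (⊤ : ℕ∞) f ∧ Continuous g ∧
    Continuous h ∧ ∀ γ, u γ =ᵐ[phaseMeasure G E₀ Em] tensorFn (mpd γ.toFun f) g h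

/-- The orthogonal complement is trivial: the measure is finite, so an orthogonal `u` is integrable.
Separation by products is then applied twice, first joining `ω` with `E` and then `x` with `(ω, E)`.
-/
theorem dense_span_tensor (hGb : Bornology.IsBounded G) :
    (Submodule.span ℝ {v : L2Phase G E₀ Em | ∃ (a : E3 →ᵇ ℝ) (g : S2 →ᵇ ℝ) (h : ℝ →ᵇ ℝ),
      v =ᵐ[phaseMeasure G E₀ Em] tensorFn a g h}).topologicalClosure = ⊤ := by
  have := isFiniteMeasure_phaseMeasure hGb E₀ Em
  rw [Submodule.topologicalClosure_eq_top_iff, Submodule.eq_bot_iff]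
  intro u hu
  have hui : Integrable u (phaseMeasure G E₀ Em) := (Lp.memLp u).integrable one_le_two
  have key : ∀ (a : E3 →ᵇ ℝ) (g : S2 →ᵇ ℝ) (h : ℝ →ᵇ ℝ),
      ∫ p, u p * (a p.1 * (g p.2.1 * h p.2.2)) ∂phaseMeasure G E₀ Em = 0 := by
    intro a g h
    have hc := continuous_tensorFn a.continuous g.continuous h.continuous
    have hm : MemLp (tensorFn a g h) 2 (phaseMeasure G E₀ Em) := by
      refine MemLp.of_bound hc.measurable.aestronglyMeasurable (‖a‖ * (‖g‖ * ‖h‖))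
        (ae_of_all _ fun p => ?_)
      rw [tensorFn, norm_mul, norm_mul]
      gcongr
      exacts [a.norm_coe_le_norm _, g.norm_coe_le_norm _, h.norm_coe_le_norm _]
    have h0 := (Submodule.mem_orthogonal _ u).1 hu (hm.toLp _)
      (Submodule.subset_span ⟨a, g, h, hm.coeFn_toLp⟩)
    rw [L2.inner_def] at h0
    rw [← h0]
    refine integral_congr_ae ?_
    filter_upwards [hm.coeFn_toLp] with p hp
    rw [hp]
    simp [tensorFn]
  have h1 : ∀ (a : E3 →ᵇ ℝ) (b : (S2 × ℝ) →ᵇ ℝ),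
      ∫ p, u p * (a p.1 * b p.2) ∂phaseMeasure G E₀ Em = 0 := by
    intro a b
    have hw : Integrable (fun p => u p * a p.1) (phaseMeasure G E₀ Em) := by
      refine hui.mul_bdd (c := ‖a‖) ?_ (ae_of_all _ fun p => a.norm_coe_le_norm _)
      exact (a.continuous.measurable.comp measurable_fst).aestronglyMeasurable
    have := integral_mul_comp_prod_eq_zero hw (X := fun p : Phase => p.2.1)
      (Y := fun p : Phase => p.2.2) (measurable_fst.comp measurable_snd)
      (measurable_snd.comp measurable_snd) (fun g h => by
        simpa only [mul_assoc] using key a g h) b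
    simpa only [mul_assoc] using this
  have h2 := ae_eq_zero_of_integral_mul_tensor hui h1
  exact Lp.ext (h2.trans (Lp.coeFn_zero _ _ _).symm)

/-- Mollification acts only on the factor in `x`. Reading the same kernel with `r = t` and `L w = c
- w` displays the smoothness of the output in `x`; the `Unit` parameter is a placeholder. -/
theorem mollCLM_tensorFn {θ : E3 → ℝ} (hθ : Continuous θ) (hθc : HasCompactSupport θ) {c : E3}
    {t : ℝ} (ht : 1 / 2 ≤ t) {v : L2Phase G E₀ Em} {a : E3 → ℝ} {g : S2 → ℝ} {h : ℝ → ℝ}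
    (hv : v =ᵐ[phaseMeasure G E₀ Em] tensorFn a g h) :
    mollCLM G E₀ Em hθ hθc c ht v =ᵐ[phaseMeasure G E₀ Em] tensorFn
      (fun x => paramInt (volume.restrict G) (fun q : E3 × Unit => a q.1) t (fun w => c - w) θ
        (x, ())) g h := by
  refine (coeFn_mollCLM hθ hθc c ht v).trans ((schurFun_congr
    (schurKernel_mollKer G E₀ Em hθ hθc c ht).mp hv).trans (ae_of_all _ fun p => ?_))
  simp only [schurFun, mollKer, swapOuter, tensorFn, paramInt, smul_eq_mul]
  rw [← integral_mul_const]
  refine integral_congr_ae (ae_of_all _ fun w => ?_)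
  simp only []
  rw [show c + t • p.1 - w = t • p.1 + (c - w) by abel]
  ring

/-- The mollification of any `L²` function, together with its derivatives, is a limit of
combinations of tensor products. -/
theorem moll_family_mem_closure (m : ℕ) (hGb : Bornology.IsBounded G) {η : E3 → ℝ}
    (hη : ContDiff ℝ (⊤ : ℕ∞) η) (hηc : HasCompactSupport η) {c : E3} {t : ℝ} (ht : 1 / 2 ≤ t)
    (v : L2Phase G E₀ Em) :
    (WithLp.toLp 2 fun α : MultiIdx m => t ^ (∑ i, α.toFun i) •
        mollCLM G E₀ Em (mpd_contDiff hη α.toFun).continuous (mpd_hasCompactSupport hηc α.toFun)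
          c ht v : PiLp 2 (fun _ : MultiIdx m => L2Phase G E₀ Em)) ∈
      (Submodule.span ℝ {u | IsTensorFamily m G E₀ Em u}).topologicalClosure := by
  have := isFiniteMeasure_restrict_of_isBounded hGb
  let T : L2Phase G E₀ Em →L[ℝ] PiLp 2 (fun _ : MultiIdx m => L2Phase G E₀ Em) :=
    ((PiLp.continuousLinearEquiv 2 ℝ (fun _ : MultiIdx m => L2Phase G E₀ Em)).symm :
      (∀ _ : MultiIdx m, L2Phase G E₀ Em) →L[ℝ] _).comp
    (ContinuousLinearMap.pi fun α : MultiIdx m => t ^ (∑ i, α.toFun i) •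
        mollCLM G E₀ Em (mpd_contDiff hη α.toFun).continuous (mpd_hasCompactSupport hηc α.toFun)
          c ht)
  change T v ∈ _
  -- The map from `v` to its mollified family is continuous and the target is closed, so it suffices
  -- to treat `v` in the dense span of tensor products.
  have hle : (⊤ : Submodule ℝ (L2Phase G E₀ Em)) ≤
      (Submodule.span ℝ {u | IsTensorFamily m G E₀ Em u}).topologicalClosure.comap
        (T : L2Phase G E₀ Em →ₗ[ℝ] _) := by
    rw [← dense_span_tensor hGb]
    refine Submodule.topologicalClosure_minimal _ ?_
      ((Submodule.isClosed_topologicalClosure _).preimage T.continuous)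
    rw [Submodule.span_le]
    rintro w ⟨a, g, h, hw⟩
    refine Submodule.le_topologicalClosure _ (Submodule.subset_span ?_)
    have hL : Continuous fun w : E3 => c - w := by fun_prop
    have ham : ∀ y : Unit, Measurable fun x => (fun q : E3 × Unit => a q.1) (x, y) :=
      fun _ => a.continuous.measurable
    have hab : ∀ p : E3 × Unit, ‖(fun q : E3 × Unit => a q.1) p‖ ≤ ‖a‖ :=
      fun p => a.norm_coe_le_norm _
    refine ⟨fun x => paramInt (volume.restrict G) (fun q : E3 × Unit => a q.1) t
      (fun w => c - w) η (x, ()), g, h, ?_, g.continuous, h.continuous, fun γ => ?_⟩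
    · exact contDiff_infty.2 fun n =>
        (classCX_paramInt ham (fun x => continuous_const (y := a x)) hab hL n hη hηc).1 ()
    · have e := mollCLM_tensorFn (mpd_contDiff hη γ.toFun).continuous
        (mpd_hasCompactSupport hηc γ.toFun) (c := c) ht hw
      change (t ^ (∑ i, γ.toFun i) • mollCLM G E₀ Em _ _ c ht w : L2Phase G E₀ Em) =ᵐ[_] _
      filter_upwards [Lp.coeFn_smul (t ^ (∑ i, γ.toFun i)) (mollCLM G E₀ Em
        (mpd_contDiff hη γ.toFun).continuous (mpd_hasCompactSupport hηc γ.toFun) c ht w), e]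
        with p h1 h2
      rw [h1, Pi.smul_apply, h2]
      have h3 := congrFun (xPartial_paramInt (γ := volume.restrict G) (r := t) ham hab hL hη hηc
        γ.toFun) (p.1, ())
      rw [xPartial_apply] at h3
      simp only [tensorFn, smul_eq_mul]
      rw [h3]
      ring
  exact hle trivial

end Tensor

/-! ### Density of the tensor products -/

section Density

variable {G : Set E3} {E₀ Em : ℝ}

/-- A smooth probability density with support in the ball of radius `ρ`. -/
structure IsMollifier (η : E3 → ℝ) (ρ : ℝ) : Prop where
  contDiff : ContDiff ℝ (⊤ : ℕ∞) η
  hasCompactSupport : HasCompactSupport η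
  nonneg : ∀ z, 0 ≤ η z
  integral_eq : ∫ z, η z = 1
  norm_le : ∀ z ∈ tsupport η, ‖z‖ ≤ ρ

theorem exists_isMollifier {ρ : ℝ} (hρ : 0 < ρ) : ∃ η, IsMollifier η ρ := by
  let f : ContDiffBump (0 : E3) := ⟨ρ / 2, ρ, by positivity, by linarith⟩
  refine ⟨f.normed volume, f.contDiff_normed, f.hasCompactSupport_normed, f.nonneg_normed,
    f.integral_normed, fun z hz => ?_⟩
  rw [f.tsupport_normed_eq] at hz
  simpa using hz

theorem IsMollifier.lOneNorm_eq {η : E3 → ℝ} {ρ : ℝ} (h : IsMollifier η ρ) : lOneNorm η = 1 := by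
  have h1 := ofReal_integral_eq_lintegral_ofReal
    (h.contDiff.continuous.integrable_of_hasCompactSupport h.hasCompactSupport)
    (ae_of_all volume h.nonneg)
  rw [h.integral_eq] at h1
  have h2 : ∫⁻ z, ‖η z‖ₑ = 1 := by
    rw [← ENNReal.ofReal_one, h1]
    refine lintegral_congr fun z => ?_
    rw [← ofReal_norm, Real.norm_of_nonneg (h.nonneg z)]
  simp [lOneNorm, h2]

/-- The Schur bound is `√(1 · 8) ≤ 3`; what matters is that it is uniform in the mollifier. -/
theorem IsMollifier.norm_mollCLM_le {η : E3 → ℝ} {ρ : ℝ} (h : IsMollifier η ρ) (c : E3) {t : ℝ}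
    (ht : 1 / 2 ≤ t) :
    ‖mollCLM G E₀ Em h.contDiff.continuous h.hasCompactSupport c ht‖ ≤ 3 := by
  refine (SchurKernel.norm_toCLM_le _).trans ?_
  rw [h.lOneNorm_eq]
  rw [Real.sqrt_le_left (by norm_num)]
  norm_num

/-- By `hgeo` the whole unit mass of `w ↦ η(c + t x - w)` lies in `G`, so restricting the integral
to `G` loses nothing and the result is an average of values of `g` close to `g x`. -/
theorem mollify_sub_le {η : E3 → ℝ} {ρ ε : ℝ} (h : IsMollifier η ρ) {c x : E3} {t : ℝ}
    (hgeo : ∀ z ∈ tsupport η, c + t • x - z ∈ G) {g : E3 → ℝ} (hg : Continuous g)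
    (hgc : ∃ C, ∀ x, ‖g x‖ ≤ C)
    (hclose : ∀ z ∈ tsupport η, ‖g (c + t • x - z) - g x‖ ≤ ε) :
    ‖(∫ w in G, η (c + t • x - w) * g w) - g x‖ ≤ ε := by
  have hηi : Integrable (fun w => η (c + t • x - w)) := by
    exact (h.contDiff.continuous.integrable_of_hasCompactSupport
      h.hasCompactSupport).comp_sub_left _
  have h1 : ∫ w, η (c + t • x - w) = 1 := by
    rw [integral_sub_left_eq_self η volume (c + t • x), h.integral_eq]
  have h0 : ∀ w ∉ G, η (c + t • x - w) * g w = 0 := by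
    intro w hw
    by_contra hne
    have hz := subset_tsupport η (left_ne_zero_of_mul hne)
    have := hgeo _ hz
    rw [sub_sub_cancel] at this
    exact hw this
  obtain ⟨C, hC⟩ := hgc
  have hi2 : Integrable (fun w => η (c + t • x - w) * g w) :=
    hηi.mul_bdd (c := C) hg.aestronglyMeasurable (ae_of_all _ hC)
  rw [setIntegral_eq_integral_of_forall_compl_eq_zero h0]
  have e : (∫ w, η (c + t • x - w) * g w) - g x =
      ∫ w, (η (c + t • x - w) * g w - η (c + t • x - w) * g x) := by
    rw [integral_sub hi2 (hηi.mul_const _), integral_mul_const, h1, one_mul]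
  rw [e]
  have hε : ∫ w, η (c + t • x - w) * ε = ε := by rw [integral_mul_const, h1, one_mul]
  rw [← hε]
  refine norm_integral_le_of_norm_le (hηi.mul_const _) (ae_of_all _ fun w => ?_)
  rw [← mul_sub, norm_mul, Real.norm_of_nonneg (h.nonneg _)]
  by_cases hz : c + t • x - w ∈ tsupport η
  · have := hclose _ hz
    rw [sub_sub_cancel] at this
    exact mul_le_mul_of_nonneg_left this (h.nonneg _)
  · simp [image_eq_zero_of_notMem_tsupport hz]

/-- The operators are uniformly bounded, so strong convergence need only be checked on the dense set
of compactly supported continuous functions, where uniform continuity gives it. -/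
theorem tendsto_mollCLM (hG : IsOpen G) (hGb : Bornology.IsBounded G) {x₀ : E3}
    {δ : ℕ → ℝ} (hδ0 : ∀ n, 0 ≤ δ n) (hδ : Tendsto δ atTop (𝓝 0)) {r : ℝ} {η : ℕ → E3 → ℝ}
    (hη : ∀ n, IsMollifier (η n) (δ n * r)) (ht : ∀ n, 1 / 2 ≤ 1 - δ n)
    (hgeo : ∀ n, ∀ x ∈ G, ∀ z ∈ tsupport (η n), δ n • x₀ + (1 - δ n) • x - z ∈ G)
    (v : L2Phase G E₀ Em) :
    Tendsto (fun n => mollCLM G E₀ Em (hη n).contDiff.continuous (hη n).hasCompactSupport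
      (δ n • x₀) (ht n) v) atTop (𝓝 v) := by
  have hfin := isFiniteMeasure_phaseMeasure hGb E₀ Em
  rw [Metric.tendsto_atTop]
  intro ε hε
  -- The square root of the total mass, which converts a uniform bound into an `L²` bound.
  set N : ℝ := (measureUnivNNReal (phaseMeasure G E₀ Em) : ℝ) ^ (2 : ℝ≥0∞).toReal⁻¹ with hN
  have hN0 : 0 ≤ N := by positivity
  obtain ⟨g, hgc, hgv, hg, hg2⟩ := (Lp.memLp v).exists_hasCompactSupport_eLpNorm_sub_le
    (by simp) (ε := ENNReal.ofReal (ε / 8)) (by simpa using hε)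
  set g' : L2Phase G E₀ Em := hg2.toLp g with hg'
  have hvg : ‖v - g'‖ ≤ ε / 8 := by
    have h1 : v - g' = ((Lp.memLp v).sub hg2).toLp _ := by
      rw [MemLp.toLp_sub (Lp.memLp v) hg2, Lp.toLp_coeFn]
    rw [h1, Lp.norm_toLp]
    exact ENNReal.toReal_le_of_le_ofReal (by positivity) hgv
  obtain ⟨κ, hκ, hκg⟩ := Metric.uniformContinuous_iff.1
    (hgc.uniformContinuous_of_continuous hg) (ε / (4 * (N + 1))) (by positivity)
  obtain ⟨R, hR⟩ := (Metric.isBounded_iff_subset_closedBall x₀).1 hGb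
  have hδ' : Tendsto (fun n => δ n * (R + r)) atTop (𝓝 0) := by simpa using hδ.mul_const (R + r)
  obtain ⟨n₀, hn₀⟩ := (Metric.tendsto_atTop.1 hδ') κ hκ
  refine ⟨n₀, fun n hn => ?_⟩
  set T := mollCLM G E₀ Em (hη n).contDiff.continuous (hη n).hasCompactSupport
      (δ n • x₀) (ht n) with hT
  have hTg : ‖T g' - g'‖ ≤ N * (ε / (4 * (N + 1))) := by
    refine Lp.norm_le_of_ae_bound (by positivity) ?_
    have hmem : ∀ᵐ p ∂phaseMeasure G E₀ Em, p ∈ G ×ˢ ((univ : Set S2) ×ˢ Ioo E₀ Em) :=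
      phaseMeasure_compl_eq_zero hG E₀ Em
    filter_upwards [Lp.coeFn_sub (T g') g', hg2.coeFn_toLp,
      (coeFn_mollCLM (hη n).contDiff.continuous (hη n).hasCompactSupport (δ n • x₀) (ht n) g').trans
        (schurFun_congr (schurKernel_mollKer G E₀ Em (hη n).contDiff.continuous
          (hη n).hasCompactSupport (δ n • x₀) (ht n)).mp hg2.coeFn_toLp), hmem]
      with p h1 h2 h3 h4
    rw [h1, Pi.sub_apply, h3, h2]
    obtain ⟨C, hC⟩ := hg.bounded_above_of_compact_support hgc
    refine mollify_sub_le (G := G) (x := p.1) (g := fun w => g (w, p.2)) (hη n) (hgeo n _ h4.1)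
      (hg.comp (Continuous.prodMk_left _)) ⟨C, fun x => hC _⟩ fun z hz => ?_
    rw [← dist_eq_norm]
    refine (hκg ?_).le
    have h5 : ‖p.1 - x₀‖ ≤ R := by simpa [dist_eq_norm] using hR h4.1
    have h6 := (hη n).norm_le z hz
    have h7 := hn₀ n hn
    rw [dist_zero_right] at h7
    have h8 := (le_abs_self _).trans_lt h7
    rw [Prod.dist_eq, dist_self, max_eq_left dist_nonneg, dist_eq_norm]
    -- The averaging points are within `δ (R + r)` of `x`: at most `δ R` from the contraction and `δ
    -- r` from the mollifier.
    have e : δ n • x₀ + (1 - δ n) • p.1 - z - p.1 = -(δ n • (p.1 - x₀)) - z := by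
      rw [sub_smul, smul_sub, one_smul]; abel
    rw [e]
    refine (norm_sub_le _ _).trans_lt ?_
    rw [norm_neg, norm_smul, Real.norm_of_nonneg (hδ0 n)]
    have := mul_le_mul_of_nonneg_left h5 (hδ0 n)
    nlinarith
  have hTn : ‖T (v - g')‖ ≤ 3 * (ε / 8) :=
    (T.le_opNorm _).trans (mul_le_mul ((hη n).norm_mollCLM_le _ _) hvg (norm_nonneg _) (by norm_num))
  have hsmall : N * (ε / (4 * (N + 1))) ≤ ε / 4 := by
    rw [mul_div_assoc', div_le_div_iff₀ (by positivity) (by norm_num)]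
    nlinarith
  have e : T v - v = T (v - g') + (T g' - g') - (v - g') := by
    rw [map_sub]; abel
  rw [dist_eq_norm, e]
  calc ‖T (v - g') + (T g' - g') - (v - g')‖ ≤ ‖T (v - g')‖ + ‖T g' - g'‖ + ‖v - g'‖ :=
        (norm_sub_le _ _).trans (add_le_add_left (norm_add_le _ _) _)
    _ < ε := by linarith

/-- Combinations of tensor products are dense in `H^{(m,0,0)}(G × S × I)` for convex `G`. -/
theorem mem_closure_span_isTensorFamily {m : ℕ} (hG : IsOpen G) (hGb : Bornology.IsBounded G)
    (hconv : Convex ℝ G) (ψ : sobolevH m G E₀ Em) :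
    (ψ : PiLp 2 (fun _ : MultiIdx m => L2Phase G E₀ Em)) ∈
      (Submodule.span ℝ {u | IsTensorFamily m G E₀ Em u}).topologicalClosure := by
  -- The contraction needs a centre in `G`. For empty `G` the measure is zero and there is nothing
  -- to approximate.
  rcases G.eq_empty_or_nonempty with rfl | ⟨x₀, hx₀⟩
  · have h0 : phaseMeasure ∅ E₀ Em = 0 := by simp [phaseMeasure]
    have : (ψ : PiLp 2 (fun _ : MultiIdx m => L2Phase ∅ E₀ Em)) = 0 := by
      ext α : 1
      refine Lp.ext ?_
      have : ∀ f g : Phase → ℝ, f =ᵐ[phaseMeasure ∅ E₀ Em] g := by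
        intro f g
        rw [h0]
        simp [Filter.EventuallyEq]
      exact this _ _
    rw [this]
    exact Submodule.zero_mem _
  obtain ⟨r, hr, hball⟩ := Metric.isOpen_iff.1 hG x₀ hx₀
  let δ : ℕ → ℝ := fun n => 1 / ((n : ℝ) + 2)
  have hδpos : ∀ n, 0 < δ n := fun n => by positivity
  have hδle : ∀ n, δ n ≤ 1 / 2 := fun n =>
    one_div_le_one_div_of_le (by norm_num) (by linarith [(Nat.cast_nonneg n : (0 : ℝ) ≤ n)])
  have hδ : Tendsto δ atTop (𝓝 0) := by
    have h1 : Tendsto (fun n : ℕ => (n : ℝ) + 2) atTop atTop :=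
      tendsto_atTop_add_const_right _ _ tendsto_natCast_atTop_atTop
    have h2 : δ = (fun n : ℕ => (n : ℝ) + 2)⁻¹ := by funext n; simp [δ]
    rw [h2]
    exact h1.inv_tendsto_atTop
  have hex : ∀ n, ∃ η, IsMollifier η (δ n * (r / 2)) := fun n =>
    exists_isMollifier (mul_pos (hδpos n) (by positivity))
  choose η hη using hex
  have ht : ∀ n, 1 / 2 ≤ 1 - δ n := fun n => by linarith [hδle n]
  have hgeo : ∀ n, ∀ x ∈ G, ∀ z ∈ tsupport (η n), δ n • x₀ + (1 - δ n) • x - z ∈ G := by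
    intro n x hx z hz
    have hz' := (hη n).norm_le z hz
    -- The point is the convex combination of `x₀ - z/δ` and `x` with weights `δ` and `1 - δ`. The
    -- mollifier radius `δ r/2` keeps the first of these in the ball of radius `r` about `x₀`.
    have hy : x₀ - (δ n)⁻¹ • z ∈ G := by
      apply hball
      rw [Metric.mem_ball, dist_eq_norm, sub_sub_cancel_left, norm_neg, norm_smul, norm_inv,
        Real.norm_of_nonneg (hδpos n).le, inv_mul_lt_iff₀ (hδpos n)]
      have := mul_lt_mul_of_pos_left (half_lt_self hr) (hδpos n)
      linarith
    have h1 := hconv hy hx (hδpos n).le (by linarith [ht n]) (add_sub_cancel (δ n) 1)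
    rw [smul_sub, smul_inv_smul₀ (hδpos n).ne'] at h1
    have e : δ n • x₀ + (1 - δ n) • x - z = δ n • x₀ - z + (1 - δ n) • x := by abel
    rw [e]
    exact h1
  set u : PiLp 2 (fun _ : MultiIdx m => L2Phase G E₀ Em) := ψ.1 with hu
  have hw : ∀ α : MultiIdx m, HasWeakXDeriv G (univ ×ˢ Ioo E₀ Em) (phaseMeasure G E₀ Em) α.toFun
      (u (MultiIdx.zero m)) (u α) := ψ.2
  have hmem : ∀ n, (WithLp.toLp 2 fun α : MultiIdx m => (1 - δ n) ^ (∑ i, α.toFun i) •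
        mollCLM G E₀ Em (hη n).contDiff.continuous (hη n).hasCompactSupport
          (δ n • x₀) (ht n) (u α) : PiLp 2 (fun _ : MultiIdx m => L2Phase G E₀ Em)) ∈
      (Submodule.span ℝ {u | IsTensorFamily m G E₀ Em u}).topologicalClosure := by
    intro n
    have h1 := moll_family_mem_closure (E₀ := E₀) (Em := Em) m hGb (hη n).contDiff
      (hη n).hasCompactSupport (c := δ n • x₀) (ht n) (u (MultiIdx.zero m))
    -- Differentiating the contracted mollification gives `(1 - δ)^|α|` times the mollification of
    -- `u₀` by `∂^α η`. Moving the derivative back replaces this by the mollification of `u α`,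
    -- which converges.
    have e : ∀ α : MultiIdx m, mollCLM G E₀ Em (mpd_contDiff (hη n).contDiff α.toFun).continuous
        (mpd_hasCompactSupport (hη n).hasCompactSupport α.toFun) (δ n • x₀) (ht n)
          (u (MultiIdx.zero m)) = mollCLM G E₀ Em (hη n).contDiff.continuous
          (hη n).hasCompactSupport (δ n • x₀) (ht n) (u α) := fun α =>
      mollCLM_mpd_eq hG hGb (hη n).contDiff (hη n).hasCompactSupport (ht n) (hgeo n) (hw α)
    simpa only [e] using h1
  have hlim : Tendsto (fun n => (WithLp.toLp 2 fun α : MultiIdx m =>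
      (1 - δ n) ^ (∑ i, α.toFun i) •
        mollCLM G E₀ Em (hη n).contDiff.continuous (hη n).hasCompactSupport
          (δ n • x₀) (ht n) (u α) : PiLp 2 (fun _ : MultiIdx m => L2Phase G E₀ Em)))
      atTop (𝓝 u) := by
    have hc := ((PiLp.continuousLinearEquiv 2 ℝ
      (fun _ : MultiIdx m => L2Phase G E₀ Em)).symm.continuous.tendsto (fun α => u α))
    refine hc.comp (tendsto_pi_nhds.2 fun α => ?_)
    have h1 : Tendsto (fun n => (1 - δ n) ^ (∑ i, α.toFun i)) atTop (𝓝 1) := by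
      simpa using (hδ.const_sub 1).pow (∑ i, α.toFun i)
    have h2 := tendsto_mollCLM hG hGb (fun n => (hδpos n).le) hδ hη ht hgeo (u α)
    simpa using h1.smul h2
  exact (Submodule.isClosed_topologicalClosure _).mem_of_tendsto hlim
    (Eventually.of_forall hmem)

/-- A set with smooth boundary whose closure is convex is itself convex. -/
theorem convex_of_hasSmoothBoundary (hG : IsOpen G) (hs : HasSmoothBoundary G)
    (hc : Convex ℝ (closure G)) : Convex ℝ G := by
  suffices h : interior (closure G) = G by
    rw [← h]
    exact hc.interior
  refine Subset.antisymm (fun y hy => ?_) (interior_maximal subset_closure hG)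
  by_contra hyG
  obtain ⟨ρ, hρ, hρy, hgrad, hev⟩ := hs y ⟨interior_subset hy, by rwa [hG.interior_eq]⟩
  have hd : DifferentiableAt ℝ ρ y := hρ.differentiable (by simp) y
  have hev2 : ∀ᶠ x in 𝓝 y, x ∈ interior (closure G) ∧ (x ∈ G ↔ ρ x < 0) :=
    (isOpen_interior.eventually_mem hy).and hev
  -- Near a boundary point interior to the closure, `{ρ > 0}` would be an open set missing `G` but
  -- inside its closure. Hence `ρ` has a local maximum at `y`, contradicting the nonzero gradient.
  have hle : ∀ᶠ x in 𝓝 y, ρ x ≤ 0 := by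
    filter_upwards [hev2.eventually_nhds] with x hx
    by_contra hpos
    have hpos' : ∀ᶠ z in 𝓝 x, 0 < ρ z := hρ.continuous.continuousAt.eventually (lt_mem_nhds
      (not_le.1 hpos))
    have hx' : x ∈ closure G := interior_subset hx.self_of_nhds.1
    obtain ⟨z, ⟨h1, h2⟩, h3⟩ := mem_closure_iff_nhds.1 hx' _ (hpos'.and hx)
    exact absurd (h2.2.1 h3) (not_lt.2 h1.le)
  have hmax : IsLocalMax ρ y := by
    filter_upwards [hle] with x hx
    rwa [hρy]
  apply hgrad
  simp [gradient, hmax.fderiv_eq_zero]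

end Density

/-! ### Kernels and their norms -/

section Kernel

variable {G : Set E3} {E₀ Em : ℝ} {m : ℕ}

theorem collision_eq_schurFun (D : KernelDom → ℝ) (f : Phase → ℝ) :
    collision D f = schurFun sphereMeasure swapAngles (fun r => D (toKernelDom r)) f := rfl

theorem ae_ae_of_ae_kernelMeasure {Q : KernelDom → Prop}
    (h : ∀ᵐ q ∂kernelMeasure G E₀ Em, Q q) :
    ∀ᵐ p ∂phaseMeasure G E₀ Em, ∀ᵐ ω' ∂sphereMeasure, Q (p.1, ω', p.2.1, p.2.2) :=
  Measure.ae_ae_of_ae_prod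
    ((measurePreserving_toKernelDom G E₀ Em).quasiMeasurePreserving.ae h)

theorem ae_ae_of_ae_kernelMeasure' {Q : KernelDom → Prop}
    (h : ∀ᵐ q ∂kernelMeasure G E₀ Em, Q q) :
    ∀ᵐ p ∂phaseMeasure G E₀ Em, ∀ᵐ ω ∂sphereMeasure, Q (p.1, p.2.1, ω, p.2.2) :=
  Measure.ae_ae_of_ae_prod ((measurePreserving_swapAngles G E₀ Em).quasiMeasurePreserving.ae
    ((measurePreserving_toKernelDom G E₀ Em).quasiMeasurePreserving.ae h))

theorem mixedNorm_congr {D D' : KernelDom → ℝ} (h : D =ᵐ[kernelMeasure G E₀ Em] D') :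
    mixedNorm G E₀ Em D = mixedNorm G E₀ Em D' := by
  refine essSup_congr_ae ?_
  filter_upwards [ae_ae_of_ae_kernelMeasure h] with p hp
  refine lintegral_congr_ae ?_
  filter_upwards [hp] with ω' hω'
  rw [hω']

theorem mixedNorm'_congr {D D' : KernelDom → ℝ} (h : D =ᵐ[kernelMeasure G E₀ Em] D') :
    mixedNorm' G E₀ Em D = mixedNorm' G E₀ Em D' := by
  refine essSup_congr_ae ?_
  filter_upwards [ae_ae_of_ae_kernelMeasure' h] with p hp
  refine lintegral_congr_ae ?_
  filter_upwards [hp] with ω hω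
  rw [hω]

theorem measurable_kernel_section {D : KernelDom → ℝ} (hD : Measurable D) (p : Phase) :
    Measurable fun ω' : S2 => D (p.1, ω', p.2.1, p.2.2) := by
  refine hD.comp ?_
  fun_prop

theorem measurable_kernel_section' {D : KernelDom → ℝ} (hD : Measurable D) (p : Phase) :
    Measurable fun ω : S2 => D (p.1, p.2.1, ω, p.2.2) := by
  refine hD.comp ?_
  fun_prop

theorem mixedNorm_add_le {D D' : KernelDom → ℝ} (hD : Measurable D) :
    mixedNorm G E₀ Em (D + D') ≤ mixedNorm G E₀ Em D + mixedNorm G E₀ Em D' := by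
  refine essSup_le_of_ae_le _ ?_
  filter_upwards [ae_le_essSup (μ := phaseMeasure G E₀ Em)
    (f := fun p : Phase => ∫⁻ ω', ‖D (p.1, ω', p.2.1, p.2.2)‖ₑ ∂sphereMeasure),
    ae_le_essSup (μ := phaseMeasure G E₀ Em)
    (f := fun p : Phase => ∫⁻ ω', ‖D' (p.1, ω', p.2.1, p.2.2)‖ₑ ∂sphereMeasure)] with p h1 h2
  refine (lintegral_mono fun ω' =>
    enorm_add_le (D (p.1, ω', p.2.1, p.2.2)) (D' (p.1, ω', p.2.1, p.2.2))).trans ?_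
  rw [lintegral_add_left (measurable_kernel_section hD p).enorm]
  exact add_le_add h1 h2

theorem mixedNorm'_add_le {D D' : KernelDom → ℝ} (hD : Measurable D) :
    mixedNorm' G E₀ Em (D + D') ≤ mixedNorm' G E₀ Em D + mixedNorm' G E₀ Em D' := by
  refine essSup_le_of_ae_le _ ?_
  filter_upwards [ae_le_essSup (μ := phaseMeasure G E₀ Em)
    (f := fun p : Phase => ∫⁻ ω, ‖D (p.1, p.2.1, ω, p.2.2)‖ₑ ∂sphereMeasure),
    ae_le_essSup (μ := phaseMeasure G E₀ Em)
    (f := fun p : Phase => ∫⁻ ω, ‖D' (p.1, p.2.1, ω, p.2.2)‖ₑ ∂sphereMeasure)] with p h1 h2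
  refine (lintegral_mono fun ω =>
    enorm_add_le (D (p.1, p.2.1, ω, p.2.2)) (D' (p.1, p.2.1, ω, p.2.2))).trans ?_
  rw [lintegral_add_left (measurable_kernel_section' hD p).enorm]
  exact add_le_add h1 h2

/-- A kernel with finite mixed norms satisfies the hypotheses of the Schur test. -/
theorem schurKernel_of_mixedNorm_le {D : KernelDom → ℝ} (hD : Measurable D) {N₁ N₂ : ℝ≥0}
    (h₁ : mixedNorm G E₀ Em D ≤ N₁) (h₂ : mixedNorm' G E₀ Em D ≤ N₂) :
    SchurKernel (phaseMeasure G E₀ Em) sphereMeasure swapAngles (fun r => D (toKernelDom r))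
      N₁ N₂ where
  mp := measurePreserving_swapAngles G E₀ Em
  invol := fun _ => rfl
  measurable := hD.comp toKernelDom.measurable
  bound := by
    have : ∀ᵐ p ∂phaseMeasure G E₀ Em,
        ∫⁻ ω', ‖D (p.1, ω', p.2.1, p.2.2)‖ₑ ∂sphereMeasure ≤ mixedNorm G E₀ Em D := ae_le_essSup
    filter_upwards [this] with p hp using hp.trans h₁
  bound' := by
    have : ∀ᵐ p ∂phaseMeasure G E₀ Em,
        ∫⁻ ω, ‖D (p.1, p.2.1, ω, p.2.2)‖ₑ ∂sphereMeasure ≤ mixedNorm' G E₀ Em D := ae_le_essSup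
    filter_upwards [this] with p hp using hp.trans h₂

theorem isOpen_kernelSet : IsOpen ((univ : Set S2) ×ˢ ((univ : Set S2) ×ˢ Ioo E₀ Em)) :=
  isOpen_univ.prod (isOpen_univ.prod isOpen_Ioo)

theorem weakDerivs_ae_unique (hG : IsOpen G) {σ : KernelDom → ℝ}
    {D D' : MultiIdx m → KernelDom → ℝ} (hD : D ∈ weakDerivs m G E₀ Em σ)
    (hD' : D' ∈ weakDerivs m G E₀ Em σ) (α : MultiIdx m) :
    D α =ᵐ[kernelMeasure G E₀ Em] D' α :=
  (hD α).2.ae_unique hG isOpen_kernelSet (kernelMeasure_compl_eq_zero hG E₀ Em) (hD' α).2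

theorem weakDerivs_zero_ae_eq (hG : IsOpen G) {σ : KernelDom → ℝ}
    {D : MultiIdx m → KernelDom → ℝ} (hD : D ∈ weakDerivs m G E₀ Em σ) :
    D (MultiIdx.zero m) =ᵐ[kernelMeasure G E₀ Em] σ := by
  have h0 := (hD (MultiIdx.zero m)).2
  rw [MultiIdx.toFun_zero] at h0
  refine h0.ae_unique hG isOpen_kernelSet (kernelMeasure_compl_eq_zero hG E₀ Em) ?_
  intro φ hφ
  obtain ⟨h1, -, -⟩ := h0 φ hφ
  exact ⟨h1, h1, by simp [xPartial]⟩

/-- Weak derivatives are unique up to null sets, so all families in the infimum give the same value.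
-/
theorem kernelNorm_eq (hG : IsOpen G) {σ : KernelDom → ℝ}
    {D : MultiIdx m → KernelDom → ℝ} (hD : D ∈ weakDerivs m G E₀ Em σ) :
    kernelNorm m G E₀ Em σ = ⨆ α, mixedNorm G E₀ Em (D α) := by
  refine le_antisymm (iInf₂_le D hD) (le_iInf₂ fun D' hD' => ?_)
  exact iSup_mono fun α => (mixedNorm_congr (weakDerivs_ae_unique hG hD hD' α)).le

theorem kernelNorm'_eq (hG : IsOpen G) {σ : KernelDom → ℝ}
    {D : MultiIdx m → KernelDom → ℝ} (hD : D ∈ weakDerivs m G E₀ Em σ) :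
    kernelNorm' m G E₀ Em σ = ⨆ α, mixedNorm' G E₀ Em (D α) := by
  refine le_antisymm (iInf₂_le D hD) (le_iInf₂ fun D' hD' => ?_)
  exact iSup_mono fun α => (mixedNorm'_congr (weakDerivs_ae_unique hG hD hD' α)).le

/-- An infimum over no families would be `⊤`, so finiteness provides weak derivatives, which are
then replaced by measurable representatives. -/
theorem exists_measurable_weakDerivs {σ : KernelDom → ℝ}
    (h : kernelNorm' m G E₀ Em σ < ⊤) :
    ∃ D ∈ weakDerivs m G E₀ Em σ, ∀ α, Measurable (D α) := by
  obtain ⟨D, hD⟩ : (weakDerivs m G E₀ Em σ).Nonempty := by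
    by_contra hne
    rw [not_nonempty_iff_eq_empty] at hne
    simp [kernelNorm', hne] at h
  refine ⟨fun α => (hD α).1.mk _, fun α => ⟨(hD α).1.stronglyMeasurable_mk.aestronglyMeasurable,
    (hD α).2.congr (EventuallyEq.refl _ _) (hD α).1.ae_eq_mk⟩,
    fun α => (hD α).1.stronglyMeasurable_mk.measurable⟩

theorem weakDerivs_add {σ τ : KernelDom → ℝ} {D D' : MultiIdx m → KernelDom → ℝ}
    (hD : D ∈ weakDerivs m G E₀ Em σ) (hD' : D' ∈ weakDerivs m G E₀ Em τ) :
    (fun α => D α + D' α) ∈ weakDerivs m G E₀ Em (σ + τ) :=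
  fun α => ⟨(hD α).1.add (hD' α).1, (hD α).2.add (hD' α).2⟩

end Kernel

/-! ### Integration by parts -/

section ByParts

variable {G : Set E3} {E₀ Em : ℝ}

/-- Fubini reduces to fixed `(ω, E)`. There `φ` has compact support in `G`, so the integrals extend
to `ℝ³` and no boundary term appears, although `u` need not vanish at the boundary. -/
theorem integral_mul_xpd (hG : IsOpen G) (hGb : Bornology.IsBounded G) {u φ : Phase → ℝ}
    (hu : ClassCX ⊤ u) (hφ : IsTest G (univ ×ˢ Ioo E₀ Em) φ) (i : Fin 3) :
    ∫ p, u p * xpd i φ p ∂phaseMeasure G E₀ Em = -∫ p, xpd i u p * φ p ∂phaseMeasure G E₀ Em := by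
  have := isFiniteMeasure_restrict_of_isBounded hGb
  have := isFiniteMeasure_phaseMeasure hGb E₀ Em
  have hφ' : ClassCX ⊤ (xpd i φ) := hφ.1.xpd i
  have h_int : ∀ f : Phase → ℝ, Continuous f → Integrable f (phaseMeasure G E₀ Em) :=
    fun f hf => (memLp_of_continuous hG hGb hf).integrable one_le_two
  have i1 : Integrable (fun p => u p * xpd i φ p) (phaseMeasure G E₀ Em) :=
    h_int _ (hu.continuous.mul hφ'.continuous)
  have i2 : Integrable (fun p => xpd i u p * φ p) (phaseMeasure G E₀ Em) :=
    h_int _ ((hu.xpd i).continuous.mul hφ.1.continuous)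
  rw [phaseMeasure_eq] at i1 i2 ⊢
  rw [integral_prod_symm _ i1, integral_prod_symm _ i2, ← integral_neg]
  refine integral_congr_ae (ae_of_all _ fun y => ?_)
  simp only []
  have hG0 : ∀ x ∉ G, (x, y) ∉ tsupport φ := fun x hx hm => hx (hφ.2.2 hm).1
  rw [setIntegral_eq_integral_of_forall_compl_eq_zero (fun x hx => by
      rw [Function.notMem_support.1 fun hs => hG0 x hx (support_xpd_subset i φ hs), mul_zero]),
    setIntegral_eq_integral_of_forall_compl_eq_zero (fun x hx => by
      rw [image_eq_zero_of_notMem_tsupport (hG0 x hx), mul_zero])]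
  have hK : IsCompact (Prod.fst '' tsupport φ) := hφ.2.1.isCompact.image continuous_fst
  have hc : ∀ f g : Phase → ℝ, Continuous f → Continuous g → (∀ p, p ∉ tsupport φ → g p = 0) →
      Integrable fun x => f (x, y) * g (x, y) := by
    intro f g hf hg h0
    refine Continuous.integrable_of_hasCompactSupport (by fun_prop) ?_
    refine HasCompactSupport.intro hK fun x hx => ?_
    rw [h0 (x, y) fun hm => hx ⟨_, hm, rfl⟩, mul_zero]
  have z1 : ∀ p, p ∉ tsupport φ → φ p = 0 := fun p hp => image_eq_zero_of_notMem_tsupport hp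
  have z2 : ∀ p, p ∉ tsupport φ → xpd i φ p = 0 := fun p hp =>
    Function.notMem_support.1 fun hs => hp (support_xpd_subset i φ hs)
  exact integral_mul_fderiv_eq_neg_fderiv_mul_of_integrable
    (f := fun x => u (x, y)) (g := fun x => φ (x, y)) (v := EuclideanSpace.single i 1)
    (hc _ _ (hu.xpd i).continuous hφ.1.continuous z1)
    (hc _ _ hu.continuous hφ'.continuous z2)
    (hc _ _ hu.continuous hφ.1.continuous z1)
    (fun x _ => hu.differentiable y x) (fun x _ => hφ.1.differentiable y x)

theorem isTest_xpd {Y : Type*} [TopologicalSpace Y] {V : Set Y} {φ : E3 × Y → ℝ}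
    (hφ : IsTest G V φ) (i : Fin 3) : IsTest G V (xpd i φ) :=
  ⟨hφ.1.xpd i, HasCompactSupport.xpd hφ.2.1 i, (tsupport_xpd_subset i φ).trans hφ.2.2⟩

theorem isTest_iterate_xpd {Y : Type*} [TopologicalSpace Y] {V : Set Y} {φ : E3 × Y → ℝ}
    (hφ : IsTest G V φ) (i : Fin 3) (n : ℕ) : IsTest G V ((xpd i)^[n] φ) := by
  induction n with
  | zero => exact hφ
  | succ n ih => rw [Function.iterate_succ_apply']; exact isTest_xpd ih i

theorem xpd_clm_comp {Y X : Type*} [TopologicalSpace Y] [NormedAddCommGroup X] [NormedSpace ℝ X]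
    {F : E3 × Y → X} (hF : ClassCX ⊤ F) (L : X →L[ℝ] ℝ) (i : Fin 3) :
    xpd i (fun p => L (F p)) = fun p => L (xpd i F p) := by
  funext p
  have := (L.hasFDerivAt.comp p.1 (hF.differentiable p.2 p.1).hasFDerivAt).fderiv
  simp only [xpd]
  change fderiv ℝ (L ∘ fun x => F (x, p.2)) p.1 _ = _
  rw [this]
  rfl

/-- Iterated integration by parts in one variable, against a scalar component of a vector valued
function. -/
theorem exists_iterate_byParts (hG : IsOpen G) (hGb : Bornology.IsBounded G)
    {X : Type*} [NormedAddCommGroup X] [NormedSpace ℝ X] (i : Fin 3) (n : ℕ) {F : Phase → X}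
    (hF : ClassCX ⊤ F) (hFc : HasCompactSupport F) :
    ∃ F' : Phase → X, ClassCX ⊤ F' ∧ HasCompactSupport F' ∧ ∀ (L : X →L[ℝ] ℝ) (φ : Phase → ℝ),
      IsTest G (univ ×ˢ Ioo E₀ Em) φ →
      ∫ p, L (F p) * (xpd i)^[n] φ p ∂phaseMeasure G E₀ Em =
        (-1) ^ n * ∫ p, L (F' p) * φ p ∂phaseMeasure G E₀ Em := by
  induction n generalizing F with
  | zero => exact ⟨F, hF, hFc, fun L φ _ => by simp⟩
  | succ n ih =>
    -- The outermost derivative is moved first, and the induction continues with `∂_i F`. The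
    -- resulting `F'` does not depend on `L` or `φ`, so one vector-valued function serves all
    -- functionals.
    obtain ⟨F', h1, h2, h3⟩ := ih (hF.xpd i) (HasCompactSupport.xpd hFc i)
    refine ⟨F', h1, h2, fun L φ hφ => ?_⟩
    rw [Function.iterate_succ_apply', integral_mul_xpd hG hGb (hF.clm_comp L)
      (isTest_iterate_xpd hφ i n), xpd_clm_comp hF, h3 L φ hφ]
    ring

theorem exists_byParts (hG : IsOpen G) (hGb : Bornology.IsBounded G)
    {X : Type*} [NormedAddCommGroup X] [NormedSpace ℝ X] (α : Fin 3 → ℕ) {F : Phase → X}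
    (hF : ClassCX ⊤ F) (hFc : HasCompactSupport F) :
    ∃ F' : Phase → X, ClassCX ⊤ F' ∧ HasCompactSupport F' ∧ ∀ (L : X →L[ℝ] ℝ) (φ : Phase → ℝ),
      IsTest G (univ ×ˢ Ioo E₀ Em) φ →
      ∫ p, L (F p) * xPartial α φ p ∂phaseMeasure G E₀ Em =
        (-1) ^ (∑ i, α i) * ∫ p, L (F' p) * φ p ∂phaseMeasure G E₀ Em := by
  obtain ⟨F₀, h₀, c₀, e₀⟩ := exists_iterate_byParts (E₀ := E₀) (Em := Em) hG hGb 0 (α 0) hF hFc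
  obtain ⟨F₁, h₁, c₁, e₁⟩ := exists_iterate_byParts (E₀ := E₀) (Em := Em) hG hGb 1 (α 1) h₀ c₀
  obtain ⟨F₂, h₂, c₂, e₂⟩ := exists_iterate_byParts (E₀ := E₀) (Em := Em) hG hGb 2 (α 2) h₁ c₁
  refine ⟨F₂, h₂, c₂, fun L φ hφ => ?_⟩
  have t2 := isTest_iterate_xpd hφ 2 (α 2)
  rw [xPartial_eq_iterate_xpd, e₀ L _ (isTest_iterate_xpd t2 1 (α 1)), e₁ L _ t2, e₂ L φ hφ,
    Fin.sum_univ_three]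
  ring

end ByParts

/-! ### Kernels with smooth values in `L¹` -/

section SmoothKernel

variable {G : Set E3} {E₀ Em : ℝ} {m : ℕ}

theorem integrable_mul_continuousMap {w : S2 → ℝ} (hw : Integrable w sphereMeasure)
    (g : C(S2, ℝ)) : Integrable (fun ω => w ω * g ω) sphereMeasure :=
  hw.mul_bdd (c := ‖g‖) g.continuous.measurable.aestronglyMeasurable
    (ae_of_all _ fun ω => g.norm_coe_le_norm ω)

/-- The pairing `⟨g, w⟩ = ∫ w g dω` of continuous and of integrable functions on the sphere. -/
def pairing : C(S2, ℝ) →L[ℝ] Lp ℝ 1 sphereMeasure →L[ℝ] ℝ :=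
  LinearMap.mkContinuous₂
    (LinearMap.mk₂ ℝ (fun (g : C(S2, ℝ)) (w : Lp ℝ 1 sphereMeasure) =>
        ∫ ω, w ω * g ω ∂sphereMeasure)
      (fun g g' w => by
        simp only [ContinuousMap.add_apply, mul_add]
        exact integral_add (integrable_mul_continuousMap (L1.integrable_coeFn w) g)
          (integrable_mul_continuousMap (L1.integrable_coeFn w) g'))
      (fun c g w => by
        simp only [ContinuousMap.smul_apply, smul_eq_mul, mul_left_comm _ c]
        exact integral_const_mul _ _)
      (fun g w w' => by
        rw [← integral_add (integrable_mul_continuousMap (L1.integrable_coeFn w) g)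
          (integrable_mul_continuousMap (L1.integrable_coeFn w') g)]
        refine integral_congr_ae ?_
        filter_upwards [Lp.coeFn_add w w'] with ω hω
        rw [hω, Pi.add_apply, add_mul])
      (fun c g w => by
        rw [smul_eq_mul, ← integral_const_mul]
        refine integral_congr_ae ?_
        filter_upwards [Lp.coeFn_smul c w] with ω hω
        rw [hω, Pi.smul_apply, smul_eq_mul, mul_assoc]))
    1 (fun g w => by
      rw [LinearMap.mk₂_apply, one_mul, L1.norm_eq_integral_norm, ← integral_const_mul]
      refine norm_integral_le_of_norm_le ((L1.integrable_coeFn w).norm.const_mul _)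
        (ae_of_all _ fun ω => ?_)
      rw [norm_mul, mul_comm]
      exact mul_le_mul_of_nonneg_right (g.norm_coe_le_norm ω) (norm_nonneg _))

theorem pairing_apply (g : C(S2, ℝ)) (w : Lp ℝ 1 sphereMeasure) :
    pairing g w = ∫ ω, w ω * g ω ∂sphereMeasure := rfl

/-- The pairing is continuous in the continuous function, so a dense family suffices; continuous
functions separate `L¹`. -/
theorem eq_zero_of_pairing {w : Lp ℝ 1 sphereMeasure} {ι : Type*} {g : ι → C(S2, ℝ)}
    (hg : DenseRange g) (h : ∀ i, pairing (g i) w = 0) : w = 0 := by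
  have h0 : (fun g : C(S2, ℝ) => pairing g w) = fun _ => 0 :=
    hg.equalizer (by fun_prop) continuous_const (funext h)
  refine (Lp.eq_zero_iff_ae_eq_zero).2
    (ae_eq_zero_of_integral_mul_bcf (L1.integrable_coeFn w) fun F => ?_)
  exact congrFun h0 F.toContinuousMap

theorem integrable_of_mixedNorm'_lt_top (hGb : Bornology.IsBounded G) {D : KernelDom → ℝ}
    (hD : Measurable D) (h : mixedNorm' G E₀ Em D < ⊤) : Integrable D (kernelMeasure G E₀ Em) := by
  have := isFiniteMeasure_phaseMeasure hGb E₀ Em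
  refine ⟨hD.aestronglyMeasurable, ?_⟩
  have hb : ∀ᵐ p ∂phaseMeasure G E₀ Em,
      ∫⁻ ω, ‖D (p.1, p.2.1, ω, p.2.2)‖ₑ ∂sphereMeasure ≤ mixedNorm' G E₀ Em D := ae_le_essSup
  have hm : Measurable fun r => ‖D (toKernelDom (swapAngles r))‖ₑ :=
    ((hD.comp toKernelDom.measurable).comp (measurePreserving_swapAngles G E₀ Em).measurable).enorm
  rw [HasFiniteIntegral, ← (measurePreserving_toKernelDom G E₀ Em).lintegral_comp hD.enorm,
    ← (measurePreserving_swapAngles G E₀ Em).lintegral_comp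
      (f := fun r => ‖D (toKernelDom r)‖ₑ) (hD.comp toKernelDom.measurable).enorm]
  refine lt_of_eq_of_lt (lintegral_prod _ hm.aemeasurable) ?_
  refine (lintegral_mono_ae hb).trans_lt ?_
  rw [lintegral_const]
  exact ENNReal.mul_lt_top h (measure_lt_top _ _)

/-- Fubini's theorem for the product of a kernel with `g(ω') χ(x, ω, E)`. -/
theorem integral_kernelMeasure_mul {u : KernelDom → ℝ} {g : S2 → ℝ} {χ : Phase → ℝ}
    (h : Integrable (fun q : KernelDom => u q * (g q.2.1 * χ (q.1, q.2.2)))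
      (kernelMeasure G E₀ Em)) :
    Integrable (fun p => (∫ ω', u (p.1, ω', p.2.1, p.2.2) * g ω' ∂sphereMeasure) * χ p)
        (phaseMeasure G E₀ Em) ∧
      ∫ q, u q * (g q.2.1 * χ (q.1, q.2.2)) ∂kernelMeasure G E₀ Em =
        ∫ p, (∫ ω', u (p.1, ω', p.2.1, p.2.2) * g ω' ∂sphereMeasure) * χ p
          ∂phaseMeasure G E₀ Em := by
  have mp := measurePreserving_toKernelDom G E₀ Em
  have hi := (mp.integrable_comp_emb toKernelDom.measurableEmbedding).2 h
  have e : ∀ p : Phase, ∫ ω', ((fun q : KernelDom => u q * (g q.2.1 * χ (q.1, q.2.2))) ∘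
      toKernelDom) (p, ω') ∂sphereMeasure =
      (∫ ω', u (p.1, ω', p.2.1, p.2.2) * g ω' ∂sphereMeasure) * χ p := by
    intro p
    rw [← integral_mul_const]
    refine integral_congr_ae (ae_of_all _ fun ω' => ?_)
    change u (p.1, ω', p.2.1, p.2.2) * (g ω' * χ p) = u (p.1, ω', p.2.1, p.2.2) * g ω' * χ p
    ring
  refine ⟨hi.integral_prod_left.congr (ae_of_all _ e), ?_⟩
  rw [← mp.integral_comp toKernelDom.measurableEmbedding]
  refine (integral_prod _ hi).trans ?_
  exact integral_congr_ae (ae_of_all _ e)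

/-- Compactness of the sphere keeps the support compact after adding the free variable `ω'`. -/
theorem IsTest.kernelLift {φ : Phase → ℝ} (hφ : IsTest G (univ ×ˢ Ioo E₀ Em) φ) {g : S2 → ℝ}
    (hg : Continuous g) :
    IsTest G (univ ×ˢ (univ ×ˢ Ioo E₀ Em))
      (fun q : KernelDom => g q.2.1 * φ (q.1, q.2.2)) := by
  have hc : ClassCX ⊤ (fun q : KernelDom => g q.2.1 * φ (q.1, q.2.2)) :=
    (classCX_of_continuous (Y := S2 × (S2 × ℝ)) (g := fun y => g y.1)
      (hg.comp continuous_fst)).mul (hφ.1.comp_right continuous_snd)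
  have hcl : IsClosed {q : KernelDom | (q.1, q.2.2) ∈ tsupport φ} :=
    (isClosed_tsupport φ).preimage (by fun_prop)
  have hsub : tsupport (fun q : KernelDom => g q.2.1 * φ (q.1, q.2.2)) ⊆
      {q | (q.1, q.2.2) ∈ tsupport φ} := by
    refine closure_minimal (fun q hq => subset_tsupport φ ?_) hcl
    exact right_ne_zero_of_mul (show g q.2.1 * φ (q.1, q.2.2) ≠ 0 from hq)
  have hK : IsCompact ((fun r : Phase × S2 => ((r.1.1, r.2, r.1.2) : KernelDom)) ''
      (tsupport φ ×ˢ univ)) :=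
    (hφ.2.1.isCompact.prod isCompact_univ).image (by fun_prop)
  refine ⟨hc, hK.of_isClosed_subset (isClosed_tsupport _) (hsub.trans ?_), fun q hq => ?_⟩
  · intro q hq
    exact ⟨((q.1, q.2.2), q.2.1), ⟨hq, mem_univ _⟩, rfl⟩
  · have := hφ.2.2 (hsub hq)
    exact ⟨this.1, mem_univ _, this.2⟩

theorem xPartial_kernelLift {φ : Phase → ℝ} (hφ : ClassCX ⊤ φ) (g : S2 → ℝ) (α : Fin 3 → ℕ)
    (q : KernelDom) :
    xPartial α (fun q : KernelDom => g q.2.1 * φ (q.1, q.2.2)) q =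
      g q.2.1 * xPartial α φ (q.1, q.2.2) :=
  xPartial_const_mul (Y := S2 × (S2 × ℝ)) (φ := fun q => φ (q.1, q.2.2))
    (hφ.comp_right continuous_snd) (fun y => g y.1) α q

/-- The smooth `L¹(S')`-valued function behind `τ` has a classical derivative `F'`, bounded in `L¹`.
Testing with `g(ω') φ(x, ω, E)` shows that the slices of the scalar weak derivative `D` have the
same pairings as `F'`, so they agree with it in `L¹` and inherit its bound. The finite `mixedNorm'`
supplies integrability of the slices. -/
theorem IsSmoothKernel.mixedNorm_lt_top (hG : IsOpen G) (hGb : Bornology.IsBounded G)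
    {τ : KernelDom → ℝ} (hτ : IsSmoothKernel G E₀ Em τ) {α : Fin 3 → ℕ} {D : KernelDom → ℝ}
    (hDm : Measurable D) (hD' : mixedNorm' G E₀ Em D < ⊤)
    (hD : HasWeakXDeriv G (univ ×ˢ (univ ×ˢ Ioo E₀ Em)) (kernelMeasure G E₀ Em) α τ D) :
    mixedNorm G E₀ Em D < ⊤ := by
  obtain ⟨F, ⟨⟨F₁, hF₁, hF₁c, hFF⟩, -⟩, hτF⟩ := hτ
  obtain ⟨F', hF', hF'c, hbp⟩ := exists_byParts (E₀ := E₀) (Em := Em) hG hGb α hF₁ hF₁c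
  have hmem : ∀ᵐ p ∂phaseMeasure G E₀ Em, p ∈ G ×ˢ ((univ : Set S2) ×ˢ Ioo E₀ Em) :=
    phaseMeasure_compl_eq_zero hG E₀ Em
  have := isFiniteMeasure_phaseMeasure hGb E₀ Em
  have h_int := integrable_of_mixedNorm'_lt_top hGb hDm hD'
  have hsec : ∀ᵐ p ∂phaseMeasure G E₀ Em,
      Integrable (fun ω' => D (p.1, ω', p.2.1, p.2.2)) sphereMeasure :=
    (((measurePreserving_toKernelDom G E₀ Em).integrable_comp_emb
      toKernelDom.measurableEmbedding).2 h_int).prod_right_ae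
  have key : ∀ g : C(S2, ℝ), ∀ᵐ p ∂phaseMeasure G E₀ Em,
      ∫ ω', D (p.1, ω', p.2.1, p.2.2) * g ω' ∂sphereMeasure = pairing g (F' p) := by
    intro g
    have h0 := ae_eq_zero_of_forall_isTest (Y := S2 × ℝ) hG (isOpen_univ.prod isOpen_Ioo)
      (phaseMeasure_compl_eq_zero hG E₀ Em)
      (w := fun p => ∫ ω', D (p.1, ω', p.2.1, p.2.2) * g ω' ∂sphereMeasure - pairing g (F' p)) ?_
    · filter_upwards [h0] with p hp using sub_eq_zero.1 hp
    intro φ hφ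
    obtain ⟨i1, i2, e⟩ := hD _ (hφ.kernelLift g.continuous)
    simp only [xPartial_kernelLift hφ.1] at i1 e
    obtain ⟨j1, e1⟩ := integral_kernelMeasure_mul i1
    obtain ⟨j2, e2⟩ := integral_kernelMeasure_mul i2
    have j3 : Integrable (fun p => pairing g (F' p) * φ p) (phaseMeasure G E₀ Em) :=
      (memLp_of_continuous hG hGb
        (((pairing g).continuous.comp hF'.continuous).mul hφ.1.continuous)).integrable one_le_two
    simp only [sub_mul]
    refine ⟨j2.sub j3, ?_⟩
    rw [integral_sub j2 j3, sub_eq_zero, ← e2]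
    rw [e1] at e
    have e3 : ∫ p, (∫ ω', τ (p.1, ω', p.2.1, p.2.2) * g ω' ∂sphereMeasure) * xPartial α φ p
        ∂phaseMeasure G E₀ Em = ∫ p, pairing g (F₁ p) * xPartial α φ p ∂phaseMeasure G E₀ Em := by
      refine integral_congr_ae ?_
      filter_upwards [hτF, hmem] with p hp hpm
      rw [← hFF hpm, pairing_apply]
      congr 1
      refine integral_congr_ae ?_
      filter_upwards [hp] with ω' hω'
      rw [hω']
    rw [e3, hbp (pairing g) φ hφ] at e
    exact (mul_left_cancel₀ (pow_ne_zero _ (by norm_num)) e).symm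
  -- The exceptional null set depends on `g`. Separability of `C(S2, ℝ)` leaves countably many `g`,
  -- hence a common null set.
  have hall : ∀ᵐ p ∂phaseMeasure G E₀ Em, ∀ n,
      ∫ ω', D (p.1, ω', p.2.1, p.2.2) * TopologicalSpace.denseSeq C(S2, ℝ) n ω' ∂sphereMeasure =
        pairing (TopologicalSpace.denseSeq C(S2, ℝ) n) (F' p) :=
    ae_all_iff.2 fun n => key _
  obtain ⟨M, hM⟩ := hF'.continuous.bounded_above_of_compact_support hF'c
  have hle : mixedNorm G E₀ Em D ≤ ENNReal.ofReal M := by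
    refine essSup_le_of_ae_le _ ?_
    filter_upwards [hall, hsec] with p hp hip
    have hw : hip.toL1 _ = F' p := by
      refine sub_eq_zero.1 (eq_zero_of_pairing (TopologicalSpace.denseRange_denseSeq C(S2, ℝ))
        fun n => ?_)
      rw [map_sub, sub_eq_zero, ← hp n, pairing_apply]
      refine integral_congr_ae ?_
      filter_upwards [hip.coeFn_toL1] with ω' hω'
      rw [hω']
    calc ∫⁻ ω', ‖D (p.1, ω', p.2.1, p.2.2)‖ₑ ∂sphereMeasure = ‖F' p‖ₑ := by
          rw [← hw, Lp.enorm_def, eLpNorm_one_eq_lintegral_enorm]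
          refine lintegral_congr_ae ?_
          filter_upwards [hip.coeFn_toL1] with ω' hω'
          rw [hω']
      _ ≤ ENNReal.ofReal M := by
          rw [← ofReal_norm]
          exact ENNReal.ofReal_le_ofReal (hM p)
  exact hle.trans_lt ENNReal.ofReal_lt_top

end SmoothKernel

/-! ### The operator on families of derivatives -/

theorem SchurKernel.toCLM_eq_add {P A : Type*} [MeasurableSpace P] [MeasurableSpace A]
    {μ : Measure P} {ν : Measure A} [SFinite μ] [SFinite ν] {s : P × A → P × A}
    {κ κ₁ κ₂ : P × A → ℝ} {N₁ N₂ M₁ M₂ L₁ L₂ : ℝ≥0} (h : SchurKernel μ ν s κ N₁ N₂)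
    (h₁ : SchurKernel μ ν s κ₁ M₁ M₂) (h₂ : SchurKernel μ ν s κ₂ L₁ L₂)
    (e : κ =ᵐ[μ.prod ν] κ₁ + κ₂) : h.toCLM = h₁.toCLM + h₂.toCLM := by
  refine ContinuousLinearMap.ext fun f => Lp.ext ?_
  rw [add_apply]
  filter_upwards [h.coeFn_toCLM f, h₁.coeFn_toCLM f, h₂.coeFn_toCLM f,
    Lp.coeFn_add (h₁.toCLM f) (h₂.toCLM f),
    h₁.ae_integrable (Lp.stronglyMeasurable f).measurable (Lp.memLp f),
    h₂.ae_integrable (Lp.stronglyMeasurable f).measurable (Lp.memLp f),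
    Measure.ae_ae_of_ae_prod e] with p a b c d i₁ i₂ hp
  rw [a, d, Pi.add_apply, b, c]
  simp only [schurFun]
  rw [← integral_add i₁ i₂]
  refine integral_congr_ae ?_
  filter_upwards [hp] with b hb
  rw [hb, Pi.add_apply, add_mul]

/-- Families of `L²` functions indexed by the multi-indices of order at most `m`. -/
abbrev Family (m : ℕ) (G : Set E3) (E₀ Em : ℝ) : Type :=
  PiLp 2 (fun _ : MultiIdx m => L2Phase G E₀ Em)

section Operator

variable {G : Set E3} {E₀ Em : ℝ} {m : ℕ}

/-- The operator `(u_γ)_γ ↦ (∑_{β,γ} c(α,β,γ) T_β u_γ)_α`. -/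
def leibnizOp (c : MultiIdx m → MultiIdx m → MultiIdx m → ℝ)
    (T : MultiIdx m → L2Phase G E₀ Em →L[ℝ] L2Phase G E₀ Em) :
    Family m G E₀ Em →L[ℝ] Family m G E₀ Em :=
  (PiLp.continuousLinearEquiv 2 ℝ fun _ : MultiIdx m => L2Phase G E₀ Em).symm.toContinuousLinearMap
    ∘L ContinuousLinearMap.pi fun α => ∑ β, ∑ γ, c α β γ •
      (T β ∘L PiLp.proj 2 (𝕜 := ℝ) (fun _ : MultiIdx m => L2Phase G E₀ Em) γ)

theorem leibnizOp_apply (c : MultiIdx m → MultiIdx m → MultiIdx m → ℝ)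
    (T : MultiIdx m → L2Phase G E₀ Em →L[ℝ] L2Phase G E₀ Em) (u : Family m G E₀ Em)
    (α : MultiIdx m) : leibnizOp c T u α = ∑ β, ∑ γ, c α β γ • T β (u γ) := by
  simp [leibnizOp]

theorem norm_family_le_sum (u : Family m G E₀ Em) : ‖u‖ ≤ ∑ α, ‖u α‖ := by
  rw [PiLp.norm_eq_of_L2]
  exact Real.sqrt_le_iff.2 ⟨Finset.sum_nonneg fun _ _ => norm_nonneg _,
    Finset.sum_sq_le_sq_sum_of_nonneg fun _ _ => norm_nonneg _⟩

theorem norm_leibnizOp_le (c : MultiIdx m → MultiIdx m → MultiIdx m → ℝ)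
    {T : MultiIdx m → L2Phase G E₀ Em →L[ℝ] L2Phase G E₀ Em} {N : ℝ}
    (hT : ∀ β, ‖T β‖ ≤ N) : ‖leibnizOp c T‖ ≤ (∑ α, ∑ β, ∑ γ, |c α β γ|) * N := by
  have hN : 0 ≤ N := (norm_nonneg _).trans (hT (MultiIdx.zero m))
  refine ContinuousLinearMap.opNorm_le_bound _ (mul_nonneg (Finset.sum_nonneg fun _ _ =>
    Finset.sum_nonneg fun _ _ => Finset.sum_nonneg fun _ _ => abs_nonneg _) hN) fun u => ?_
  refine (norm_family_le_sum _).trans ?_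
  simp only [leibnizOp_apply, Finset.sum_mul]
  refine Finset.sum_le_sum fun α _ => (norm_sum_le _ _).trans <| Finset.sum_le_sum fun β _ =>
    (norm_sum_le _ _).trans <| Finset.sum_le_sum fun γ _ => ?_
  rw [norm_smul, Real.norm_eq_abs, mul_assoc]
  refine mul_le_mul_of_nonneg_left ?_ (abs_nonneg _)
  exact ((T β).le_of_opNorm_le (hT β) _).trans
    (mul_le_mul_of_nonneg_left (PiLp.norm_apply_le u γ) hN)

theorem leibnizOp_sub (c : MultiIdx m → MultiIdx m → MultiIdx m → ℝ)
    (T T' : MultiIdx m → L2Phase G E₀ Em →L[ℝ] L2Phase G E₀ Em) :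
    leibnizOp c T - leibnizOp c T' = leibnizOp c (fun β => T β - T' β) := by
  refine ContinuousLinearMap.ext fun u => ?_
  ext1 α
  rw [sub_apply, PiLp.sub_apply]
  simp only [leibnizOp_apply, sub_apply, smul_sub, Finset.sum_sub_distrib]

/-- `D` is the family of weak derivatives of `σ`, with mixed norms bounded by `N₁` and `N₂`. -/
structure IsKernelFamily (m : ℕ) (G : Set E3) (E₀ Em : ℝ) (σ : KernelDom → ℝ)
    (D : MultiIdx m → KernelDom → ℝ) (N₁ N₂ : ℝ≥0) : Prop where
  mem : D ∈ weakDerivs m G E₀ Em σ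
  measurable : ∀ α, Measurable (D α)
  le₁ : ∀ α, mixedNorm G E₀ Em (D α) ≤ N₁
  le₂ : ∀ α, mixedNorm' G E₀ Em (D α) ≤ N₂

theorem IsKernelFamily.schur {σ : KernelDom → ℝ} {D : MultiIdx m → KernelDom → ℝ} {N₁ N₂ : ℝ≥0}
    (h : IsKernelFamily m G E₀ Em σ D N₁ N₂) (α : MultiIdx m) :
    SchurKernel (phaseMeasure G E₀ Em) sphereMeasure swapAngles
      (fun r => D α (toKernelDom r)) N₁ N₂ :=
  schurKernel_of_mixedNorm_le (h.measurable α) (h.le₁ α) (h.le₂ α)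

/-- The operator which maps the derivatives of `ψ` to the derivatives of
`∫ σ(x, ω', ω, E) ψ(x, ω', E) dω'`. -/
def IsKernelFamily.op {σ : KernelDom → ℝ} {D : MultiIdx m → KernelDom → ℝ} {N₁ N₂ : ℝ≥0}
    (c : MultiIdx m → MultiIdx m → MultiIdx m → ℝ) (h : IsKernelFamily m G E₀ Em σ D N₁ N₂) :
    Family m G E₀ Em →L[ℝ] Family m G E₀ Em :=
  leibnizOp c fun β => (h.schur β).toCLM

theorem IsKernelFamily.norm_op_le {σ : KernelDom → ℝ} {D : MultiIdx m → KernelDom → ℝ}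
    {N₁ N₂ : ℝ≥0} (c : MultiIdx m → MultiIdx m → MultiIdx m → ℝ)
    (h : IsKernelFamily m G E₀ Em σ D N₁ N₂) :
    ‖h.op c‖ ≤ (∑ α, ∑ β, ∑ γ, |c α β γ|) * √(N₁ * N₂) :=
  norm_leibnizOp_le c fun β => (h.schur β).norm_toCLM_le

/-- Uniqueness of weak derivatives gives `D = D' + D''` a.e., so the difference of the operators is
the operator of `σ - τ`, whose Schur bound is `√(ε · ε) = ε`. -/
theorem IsKernelFamily.norm_op_sub_le (hG : IsOpen G) {σ τ : KernelDom → ℝ}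
    {D D' D'' : MultiIdx m → KernelDom → ℝ} {N₁ N₂ N₁' N₂' ε : ℝ≥0}
    (c : MultiIdx m → MultiIdx m → MultiIdx m → ℝ) (h : IsKernelFamily m G E₀ Em σ D N₁ N₂)
    (h' : IsKernelFamily m G E₀ Em τ D' N₁' N₂')
    (h'' : IsKernelFamily m G E₀ Em (σ - τ) D'' ε ε) :
    ‖h.op c - h'.op c‖ ≤ (∑ α, ∑ β, ∑ γ, |c α β γ|) * ε := by
  unfold IsKernelFamily.op
  rw [leibnizOp_sub]
  refine norm_leibnizOp_le c fun β => ?_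
  have hmem := weakDerivs_add h'.mem h''.mem
  rw [add_sub_cancel] at hmem
  have e := (measurePreserving_toKernelDom G E₀ Em).quasiMeasurePreserving.ae_eq_comp
    (weakDerivs_ae_unique hG h.mem hmem β)
  rw [(h.schur β).toCLM_eq_add (h'.schur β) (h''.schur β) e, add_sub_cancel_left]
  refine (h''.schur β).norm_toCLM_le.trans_eq ?_
  rw [Real.sqrt_mul_self (NNReal.coe_nonneg _)]

/-! ### Finiteness of the kernel norms. -/

theorem exists_isKernelFamily {σ : KernelDom → ℝ} {D : MultiIdx m → KernelDom → ℝ}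
    (hD : D ∈ weakDerivs m G E₀ Em σ) (hm : ∀ α, Measurable (D α))
    (h₁ : ∀ α, mixedNorm G E₀ Em (D α) < ⊤) (h₂ : ∀ α, mixedNorm' G E₀ Em (D α) < ⊤) :
    ∃ N₁ N₂, IsKernelFamily m G E₀ Em σ D N₁ N₂ := by
  have hb : ∀ f : MultiIdx m → ℝ≥0∞, (∀ α, f α < ⊤) → ∃ N : ℝ≥0, ∀ α, f α ≤ N := by
    intro f hf
    refine ⟨∑ α, (f α).toNNReal, fun α => ?_⟩
    rw [← ENNReal.coe_toNNReal (hf α).ne]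
    exact_mod_cast Finset.single_le_sum (f := fun α => (f α).toNNReal) (fun _ _ => zero_le)
      (Finset.mem_univ α)
  obtain ⟨N₁, h1⟩ := hb _ h₁
  obtain ⟨N₂, h2⟩ := hb _ h₂
  exact ⟨N₁, N₂, hD, hm, h1, h2⟩

theorem exists_isKernelFamily_of_kernelNorm_le (hG : IsOpen G) {σ : KernelDom → ℝ} {N₁ N₂ : ℝ≥0}
    (h₁ : kernelNorm m G E₀ Em σ ≤ N₁) (h₂ : kernelNorm' m G E₀ Em σ ≤ N₂) :
    ∃ D, IsKernelFamily m G E₀ Em σ D N₁ N₂ := by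
  obtain ⟨D, hD, hm⟩ := exists_measurable_weakDerivs (h₂.trans_lt ENNReal.coe_lt_top)
  rw [kernelNorm_eq hG hD] at h₁
  rw [kernelNorm'_eq hG hD] at h₂
  exact ⟨D, hD, hm, fun α => (le_iSup _ α).trans h₁, fun α => (le_iSup _ α).trans h₂⟩

theorem IsSmoothKernel.exists_isKernelFamily (hG : IsOpen G) (hGb : Bornology.IsBounded G)
    {τ : KernelDom → ℝ} (hτ : IsSmoothKernel G E₀ Em τ) (h : kernelNorm' m G E₀ Em τ < ⊤) :
    ∃ D N₁ N₂, IsKernelFamily m G E₀ Em τ D N₁ N₂ := by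
  obtain ⟨D, hD, hm⟩ := exists_measurable_weakDerivs h
  rw [kernelNorm'_eq hG hD] at h
  have h₂ : ∀ α, mixedNorm' G E₀ Em (D α) < ⊤ := fun α => (le_iSup _ α).trans_lt h
  exact ⟨D, Transport.exists_isKernelFamily hD hm
    (fun α => hτ.mixedNorm_lt_top hG hGb (hm α) (h₂ α) (hD α).2) h₂⟩

/-- Approximation to within `1` writes `σ` as a smooth kernel plus one of norm below `1`, and the
triangle inequality applies to each derivative. -/
theorem MemW0.kernelNorm_lt_top (hG : IsOpen G) (hGb : Bornology.IsBounded G)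
    {σ : KernelDom → ℝ} (hσ : MemW0 m G E₀ Em σ) :
    kernelNorm m G E₀ Em σ < ⊤ ∧ kernelNorm' m G E₀ Em σ < ⊤ := by
  obtain ⟨τ, -, hτ, hτ', hlt⟩ := hσ 1 one_pos
  obtain ⟨D, N₁, N₂, hD⟩ := hτ.exists_isKernelFamily hG hGb hτ'
  obtain ⟨D', hD'⟩ := exists_isKernelFamily_of_kernelNorm_le (m := m) (N₁ := 1) (N₂ := 1) hG
    (le_self_add.trans hlt.le) (le_add_self.trans hlt.le)
  have hmem := weakDerivs_add hD.mem hD'.mem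
  rw [add_sub_cancel] at hmem
  rw [kernelNorm_eq hG hmem, kernelNorm'_eq hG hmem]
  constructor
  · refine (iSup_le fun α => (mixedNorm_add_le (hD.measurable α)).trans
      (add_le_add (hD.le₁ α) (hD'.le₁ α))).trans_lt ?_
    exact ENNReal.add_lt_top.2 ⟨ENNReal.coe_lt_top, ENNReal.coe_lt_top⟩
  · refine (iSup_le fun α => (mixedNorm'_add_le (hD.measurable α)).trans
      (add_le_add (hD.le₂ α) (hD'.le₂ α))).trans_lt ?_
    exact ENNReal.add_lt_top.2 ⟨ENNReal.coe_lt_top, ENNReal.coe_lt_top⟩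

/-! ### Closedness of the Sobolev space -/

theorem exists_clm_integral_mul {χ : Phase → ℝ} (hχ : MemLp χ 2 (phaseMeasure G E₀ Em)) :
    ∃ L : L2Phase G E₀ Em →L[ℝ] ℝ, ∀ u : L2Phase G E₀ Em,
      Integrable (fun p => u p * χ p) (phaseMeasure G E₀ Em) ∧
        L u = ∫ p, u p * χ p ∂phaseMeasure G E₀ Em := by
  refine ⟨innerSL ℝ (hχ.toLp χ), fun u => ?_⟩
  have e : (fun p => inner ℝ ((hχ.toLp χ) p) (u p)) =ᵐ[phaseMeasure G E₀ Em]
      fun p => u p * χ p := by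
    filter_upwards [hχ.coeFn_toLp] with p hp
    rw [hp]
    simp
  refine ⟨(L2.integrable_inner _ _).congr e, ?_⟩
  rw [innerSL_apply_apply, L2.inner_def]
  exact integral_congr_ae e

/-- Test functions and their derivatives are bounded on the finite measure space, so the
integrability requirements are automatic and each remaining condition is an equation between
continuous linear functionals. -/
theorem isClosed_sobolevH (hG : IsOpen G) (hGb : Bornology.IsBounded G) :
    IsClosed (sobolevH m G E₀ Em : Set (Family m G E₀ Em)) := by
  have e : (sobolevH m G E₀ Em : Set (Family m G E₀ Em)) =
      ⋂ (α : MultiIdx m) (φ : Phase → ℝ) (_ : IsTest G (univ ×ˢ Ioo E₀ Em) φ),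
        {u | ∫ p, u (MultiIdx.zero m) p * xPartial α.toFun φ p ∂phaseMeasure G E₀ Em =
          (-1) ^ (∑ i, α.toFun i) * ∫ p, u α p * φ p ∂phaseMeasure G E₀ Em} := by
    ext u
    simp only [mem_iInter, mem_ofPred_eq]
    refine ⟨fun h α φ hφ => (h α φ hφ).2.2, fun h α φ hφ => ?_⟩
    obtain ⟨L, hL⟩ := exists_clm_integral_mul (E₀ := E₀) (Em := Em)
      (memLp_of_continuous hG hGb (hφ.1.xPartial α.toFun).continuous)
    obtain ⟨L', hL'⟩ := exists_clm_integral_mul (E₀ := E₀) (Em := Em)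
      (memLp_of_continuous hG hGb hφ.1.continuous)
    exact ⟨(hL _).1, (hL' _).1, h α φ hφ⟩
  rw [e]
  refine isClosed_iInter fun α => isClosed_iInter fun φ => isClosed_iInter fun hφ => ?_
  obtain ⟨L, hL⟩ := exists_clm_integral_mul (E₀ := E₀) (Em := Em)
    (memLp_of_continuous hG hGb (hφ.1.xPartial α.toFun).continuous)
  obtain ⟨L', hL'⟩ := exists_clm_integral_mul (E₀ := E₀) (Em := Em)
    (memLp_of_continuous hG hGb hφ.1.continuous)
  simp only [← (hL _).2, ← (hL' _).2]
  exact isClosed_eq (by fun_prop) (by fun_prop)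

/-- The families of derivatives of smooth functions vanishing near the inflow boundary. -/
def smoothFamilies (m : ℕ) (G : Set E3) (E₀ Em : ℝ) : Submodule ℝ (Family m G E₀ Em) :=
  (smoothVanishing m G E₀ Em).map (sobolevH m G E₀ Em).subtype

/-- Because `sobolevH` is closed, its inclusion is a closed embedding, so a closure formed among all
families is already the closure formed inside `sobolevH`. -/
theorem exists_mem_sobolevH0 (hG : IsOpen G) (hGb : Bornology.IsBounded G)
    {u : Family m G E₀ Em} (hu : u ∈ (smoothFamilies m G E₀ Em).topologicalClosure) :
    ∃ z ∈ sobolevH0 m G E₀ Em, (z : Family m G E₀ Em) = u := by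
  have h : u ∈ closure (Subtype.val '' (smoothVanishing m G E₀ Em : Set (sobolevH m G E₀ Em))) :=
    hu
  rw [(isClosed_sobolevH hG hGb).isClosedEmbedding_subtypeVal.closure_image_eq] at h
  exact h

end Operator

/-! ### The operator on tensor products, for smooth kernels -/

section Tensor

variable {G : Set E3} {E₀ Em : ℝ} {m : ℕ}

/-- The partial integral `∫ D(x, ω', ω, E) g(ω') dω'`. -/
def angleInt (D : KernelDom → ℝ) (g : S2 → ℝ) (p : Phase) : ℝ :=
  ∫ ω', D (p.1, ω', p.2.1, p.2.2) * g ω' ∂sphereMeasure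

theorem collision_tensorFn (D : KernelDom → ℝ) (a : E3 → ℝ) (g : S2 → ℝ) (h : ℝ → ℝ)
    (p : Phase) : collision D (tensorFn a g h) p = angleInt D g p * (a p.1 * h p.2.2) := by
  rw [angleInt, ← integral_mul_const]
  refine integral_congr_ae (ae_of_all _ fun ω' => ?_)
  simp only [collisionIntegrand, tensorFn]
  ring

/-- The coefficients `c` express `f ∂^α φ` by the derivatives of the products `φ ∂^γ f`. -/
def IsOuterLeibniz (c : MultiIdx m → MultiIdx m → MultiIdx m → ℝ) : Prop :=
  (∀ α, ∀ f φ : E3 → ℝ, ContDiff ℝ (⊤ : ℕ∞) f → ContDiff ℝ (⊤ : ℕ∞) φ → ∀ x,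
    f x * mpd α.toFun φ x =
      ∑ β, ∑ γ, c α β γ * mpd β.toFun (fun x => φ x * mpd γ.toFun f x) x) ∧
  ∀ β γ, c (MultiIdx.zero m) β γ =
    if β = MultiIdx.zero m ∧ γ = MultiIdx.zero m then 1 else 0

/-- The coefficients of the dual formula, which expresses `∂^α (K f)` by the operators with kernel
`∂^β σ` applied to `∂^γ f`. -/
def dualCoeff (c : MultiIdx m → MultiIdx m → MultiIdx m → ℝ) (α β γ : MultiIdx m) : ℝ :=
  (-1) ^ (∑ i, α.toFun i) * ((-1) ^ (∑ i, β.toFun i) * c α β γ)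

variable {c : MultiIdx m → MultiIdx m → MultiIdx m → ℝ} {σ : KernelDom → ℝ}
  {D : MultiIdx m → KernelDom → ℝ} {N₁ N₂ : ℝ≥0}

theorem dualCoeff_zero (hc : IsOuterLeibniz c) (β γ : MultiIdx m) :
    dualCoeff c (MultiIdx.zero m) β γ =
      if β = MultiIdx.zero m ∧ γ = MultiIdx.zero m then 1 else 0 := by
  rw [dualCoeff, hc.2]
  split_ifs with h
  · rw [h.1, MultiIdx.toFun_zero]
    simp
  · simp

/-- This is where the normalisation of the coefficients at `α = 0` is used: it identifies the
function underlying the output family with the collision integral. -/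
theorem IsKernelFamily.op_zero (hc : IsOuterLeibniz c) (h : IsKernelFamily m G E₀ Em σ D N₁ N₂)
    (u : Family m G E₀ Em) : h.op (dualCoeff c) u (MultiIdx.zero m) =
      (h.schur (MultiIdx.zero m)).toCLM (u (MultiIdx.zero m)) := by
  rw [IsKernelFamily.op, leibnizOp_apply,
    Finset.sum_eq_single_of_mem (MultiIdx.zero m) (Finset.mem_univ _),
    Finset.sum_eq_single_of_mem (MultiIdx.zero m) (Finset.mem_univ _)]
  · simp [dualCoeff_zero hc]
  · intro γ _ hγ
    simp [dualCoeff_zero hc, hγ]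
  · intro β _ hβ
    simp [dualCoeff_zero hc, hβ]

theorem IsKernelFamily.toCLM_tensor (h : IsKernelFamily m G E₀ Em σ D N₁ N₂)
    {v : L2Phase G E₀ Em} {a : E3 → ℝ} {g : S2 → ℝ} {e : ℝ → ℝ}
    (hv : v =ᵐ[phaseMeasure G E₀ Em] tensorFn a g e) (β : MultiIdx m) :
    (h.schur β).toCLM v =ᵐ[phaseMeasure G E₀ Em]
      fun p => angleInt (D β) g p * (a p.1 * e p.2.2) := by
  refine ((h.schur β).coeFn_toCLM v).trans ((schurFun_congr (h.schur β).mp hv).trans ?_)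
  rw [← collision_eq_schurFun]
  exact ae_of_all _ (collision_tensorFn (D β) a g e)

theorem angleInt_congr {D D' : KernelDom → ℝ} (h : D =ᵐ[kernelMeasure G E₀ Em] D')
    (g : S2 → ℝ) : angleInt D g =ᵐ[phaseMeasure G E₀ Em] angleInt D' g := by
  filter_upwards [ae_ae_of_ae_kernelMeasure h] with p hp
  refine integral_congr_ae ?_
  filter_upwards [hp] with ω' hω'
  rw [hω']

/-- Test functions of the form `g(ω') φ(x, ω, E)` are admissible for the kernel, and Fubini
integrates `ω'` out. -/
theorem HasWeakXDeriv.angleInt {α : Fin 3 → ℕ} {u v : KernelDom → ℝ}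
    (h : HasWeakXDeriv G (univ ×ˢ (univ ×ˢ Ioo E₀ Em)) (kernelMeasure G E₀ Em) α u v)
    {g : S2 → ℝ} (hg : Continuous g) :
    HasWeakXDeriv G (univ ×ˢ Ioo E₀ Em) (phaseMeasure G E₀ Em) α (angleInt u g)
      (angleInt v g) := by
  intro φ hφ
  obtain ⟨i1, i2, e⟩ := h _ (hφ.kernelLift hg)
  simp only [xPartial_kernelLift hφ.1] at i1 e
  obtain ⟨j1, e1⟩ := integral_kernelMeasure_mul i1
  obtain ⟨j2, e2⟩ := integral_kernelMeasure_mul i2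
  rw [e1, e2] at e
  exact ⟨j1, j2, e⟩

/-- The Leibniz rule for a product `w f h` with `f` smooth in `x` and `h` a function of the
energy. -/
theorem hasWeakXDeriv_mul (hc : IsOuterLeibniz c) {w : MultiIdx m → Phase → ℝ} {w₀ : Phase → ℝ}
    (hw : ∀ β : MultiIdx m, HasWeakXDeriv G (univ ×ˢ Ioo E₀ Em) (phaseMeasure G E₀ Em) β.toFun
      w₀ (w β))
    {f : E3 → ℝ} (hf : ContDiff ℝ (⊤ : ℕ∞) f) {e : ℝ → ℝ} (he : Continuous e) (α : MultiIdx m) :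
    HasWeakXDeriv G (univ ×ˢ Ioo E₀ Em) (phaseMeasure G E₀ Em) α.toFun
      (fun p => w₀ p * (f p.1 * e p.2.2))
      (fun p => ∑ β, ∑ γ, dualCoeff c α β γ * (w β p * (mpd γ.toFun f p.1 * e p.2.2))) := by
  intro φ hφ
  have hφe : IsTest G (univ ×ˢ Ioo E₀ Em) (fun p : Phase => φ p * e p.2.2) :=
    hφ.mul_classCX (classCX_of_continuous (Y := S2 × ℝ) (g := fun y => e y.2)
      (he.comp continuous_snd))
  have ht : ∀ γ : MultiIdx m, IsTest G (univ ×ˢ Ioo E₀ Em)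
      (fun p : Phase => φ p * e p.2.2 * mpd γ.toFun f p.1) := fun γ =>
    hφe.mul_classCX (classCX_of_contDiff (mpd_contDiff hf γ.toFun))
  have eα : ∀ p : Phase, e p.2.2 * xPartial α.toFun φ p =
      xPartial α.toFun (fun p : Phase => φ p * e p.2.2) p := by
    intro p
    rw [← xPartial_const_mul hφ.1 (fun y => e y.2) α.toFun p]
    simp only [mul_comm]
  -- The factor `e` is constant in `x` and is absorbed into the test function. The dual Leibniz rule
  -- then leaves only outer derivatives, of test functions, and these pair with the weak derivatives
  -- of `w₀`.
  have e1 : ∀ p : Phase, w₀ p * (f p.1 * e p.2.2) * xPartial α.toFun φ p =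
      ∑ β, ∑ γ, c α β γ * (w₀ p * xPartial β.toFun
        (fun p : Phase => φ p * e p.2.2 * mpd γ.toFun f p.1) p) := by
    intro p
    rw [mul_assoc, mul_assoc, eα, xPartial_apply, hc.1 α f _ hf (hφe.1.1 p.2) p.1, Finset.mul_sum]
    refine Finset.sum_congr rfl fun β _ => ?_
    rw [Finset.mul_sum]
    refine Finset.sum_congr rfl fun γ _ => ?_
    rw [mul_left_comm]
    rfl
  have e2 : ∀ p : Phase,
      (∑ β, ∑ γ, dualCoeff c α β γ * (w β p * (mpd γ.toFun f p.1 * e p.2.2))) * φ p =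
      ∑ β, ∑ γ, dualCoeff c α β γ *
        (w β p * (φ p * e p.2.2 * mpd γ.toFun f p.1)) := by
    intro p
    simp only [Finset.sum_mul]
    refine Finset.sum_congr rfl fun β _ => Finset.sum_congr rfl fun γ _ => ?_
    ring
  simp only [e1, e2]
  have i1 : ∀ β γ : MultiIdx m, Integrable (fun p => c α β γ * (w₀ p * xPartial β.toFun
        (fun p : Phase => φ p * e p.2.2 * mpd γ.toFun f p.1) p)) (phaseMeasure G E₀ Em) :=
    fun β γ => (hw β _ (ht γ)).1.const_mul _
  have i2 : ∀ β γ : MultiIdx m, Integrable (fun p => dualCoeff c α β γ *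
        (w β p * (φ p * e p.2.2 * mpd γ.toFun f p.1))) (phaseMeasure G E₀ Em) :=
    fun β γ => (hw β _ (ht γ)).2.1.const_mul _
  refine ⟨integrable_finsetSum _ fun β _ => integrable_finsetSum _ fun γ _ => i1 β γ,
    integrable_finsetSum _ fun β _ => integrable_finsetSum _ fun γ _ => i2 β γ, ?_⟩
  rw [integral_finsetSum _ fun β _ => integrable_finsetSum _ fun γ _ => i1 β γ,
    integral_finsetSum _ fun β _ => integrable_finsetSum _ fun γ _ => i2 β γ, Finset.mul_sum]
  refine Finset.sum_congr rfl fun β _ => ?_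
  rw [integral_finsetSum _ fun γ _ => i1 β γ, integral_finsetSum _ fun γ _ => i2 β γ,
    Finset.mul_sum]
  refine Finset.sum_congr rfl fun γ _ => ?_
  rw [integral_const_mul, integral_const_mul, (hw β _ (ht γ)).2.2, dualCoeff]
  have hs : ((-1 : ℝ) ^ (∑ i, α.toFun i)) * (-1) ^ (∑ i, α.toFun i) = 1 := by
    rw [← mul_pow]; simp
  linear_combination (-(c α β γ * ((-1) ^ (∑ i, β.toFun i)) *
    ∫ p, w β p * (φ p * e p.2.2 * mpd γ.toFun f p.1) ∂phaseMeasure G E₀ Em)) * hs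

/-- Pairing with `g` is a continuous linear functional, so smoothness in `x` passes from the
vector-valued kernel to the scalar function. Neither the pairing nor multiplication by `f e`
enlarges the support, which therefore still avoids `Γ₋ ∪ Γ₀`. -/
theorem IsSmoothKernel.classC0 {τ : KernelDom → ℝ} (hτ : IsSmoothKernel G E₀ Em τ) {f : E3 → ℝ}
    (hf : ContDiff ℝ (⊤ : ℕ∞) f) {g : S2 → ℝ} (hg : Continuous g) {e : ℝ → ℝ}
    (he : Continuous e) : ∃ k : Phase → ℝ, ClassC0 ⊤ G E₀ Em k ∧
      (fun p => angleInt τ g p * (f p.1 * e p.2.2)) =ᵐ[phaseMeasure G E₀ Em] k := by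
  obtain ⟨F, ⟨⟨F₁, hF₁, hF₁c, hFF⟩, hd⟩, hτF⟩ := hτ
  have hs : Function.support (fun p => pairing ⟨g, hg⟩ (F p) * (f p.1 * e p.2.2)) ⊆
      Function.support F := by
    intro p hp h0
    exact hp (by simp [h0])
  refine ⟨fun p => pairing ⟨g, hg⟩ (F p) * (f p.1 * e p.2.2),
    ⟨⟨fun p => pairing ⟨g, hg⟩ (F₁ p) * (f p.1 * e p.2.2), ?_, ?_, ?_⟩, ?_⟩, ?_⟩
  · exact (hF₁.clm_comp (pairing ⟨g, hg⟩)).mul ((classCX_of_contDiff hf).mul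
      (classCX_of_continuous (Y := S2 × ℝ) (g := fun y => e y.2) (he.comp continuous_snd)))
  · exact (hF₁c.comp_left (g := fun w => pairing ⟨g, hg⟩ w) (map_zero _)).mul_right
  · intro p hp
    simp only [hFF hp]
  · exact hd.mono_left (closure_mono (inter_subset_inter_left _ hs))
  · filter_upwards [hτF] with p hp
    rw [pairing_apply, angleInt]
    congr 1
    refine integral_congr_ae ?_
    filter_upwards [hp] with ω' hω'
    rw [hω']
    rfl

theorem ClassC0.of_top {f : Phase → ℝ} (h : ClassC0 ⊤ G E₀ Em f) (k : ℕ∞) :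
    ClassC0 k G E₀ Em f := by
  obtain ⟨⟨F, hF, hFc, e⟩, hd⟩ := h
  exact ⟨⟨F, hF.of_le le_top, hFc, e⟩, hd⟩

/-- On a tensor product every term is `∫ ∂^β σ g dω'` times `∂^γ f · e`. The product rule for weak
derivatives shows that the output family consists of the derivatives of its zeroth member, which is
a smooth function vanishing near the inflow boundary. -/
theorem IsKernelFamily.op_tensor_mem (hG : IsOpen G) (hc : IsOuterLeibniz c)
    (h : IsKernelFamily m G E₀ Em σ D N₁ N₂) (hσ : IsSmoothKernel G E₀ Em σ)
    {u : Family m G E₀ Em} (hu : IsTensorFamily m G E₀ Em u) :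
    h.op (dualCoeff c) u ∈ smoothFamilies m G E₀ Em := by
  obtain ⟨f, g, e, hf, hg, he, hu⟩ := hu
  have h0 : h.op (dualCoeff c) u (MultiIdx.zero m) =ᵐ[phaseMeasure G E₀ Em]
      fun p => angleInt σ g p * (f p.1 * e p.2.2) := by
    rw [h.op_zero hc]
    refine (h.toCLM_tensor (hu _) _).trans ?_
    rw [MultiIdx.toFun_zero]
    filter_upwards [angleInt_congr (weakDerivs_zero_ae_eq hG h.mem) g] with p hp
    rw [hp]
    rfl
  have hα : ∀ α, h.op (dualCoeff c) u α =ᵐ[phaseMeasure G E₀ Em] fun p =>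
      ∑ β, ∑ γ, dualCoeff c α β γ * (angleInt (D β) g p * (mpd γ.toFun f p.1 * e p.2.2)) := by
    intro α
    rw [IsKernelFamily.op, leibnizOp_apply]
    have e1 := Lp.coeFn_finsetSum (Finset.univ : Finset (MultiIdx m))
      (fun β => ∑ γ, dualCoeff c α β γ • (h.schur β).toCLM (u γ))
    have e2 : ∀ᵐ p ∂phaseMeasure G E₀ Em, ∀ β, (∑ γ, dualCoeff c α β γ •
        (h.schur β).toCLM (u γ) : L2Phase G E₀ Em) p =
        (∑ γ, ⇑(dualCoeff c α β γ • (h.schur β).toCLM (u γ) : L2Phase G E₀ Em)) p :=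
      ae_all_iff.2 fun β => Lp.coeFn_finsetSum (Finset.univ : Finset (MultiIdx m)) _
    have e3 : ∀ᵐ p ∂phaseMeasure G E₀ Em, ∀ β γ,
        (dualCoeff c α β γ • (h.schur β).toCLM (u γ) : L2Phase G E₀ Em) p =
        dualCoeff c α β γ * (angleInt (D β) g p * (mpd γ.toFun f p.1 * e p.2.2)) :=
      ae_all_iff.2 fun β => ae_all_iff.2 fun γ => by
        filter_upwards [Lp.coeFn_smul (dualCoeff c α β γ) ((h.schur β).toCLM (u γ)),
          h.toCLM_tensor (hu γ) β] with p h1 h2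
        rw [h1, Pi.smul_apply, h2, smul_eq_mul]
    filter_upwards [e1, e2, e3] with p h1 h2 h3
    rw [h1, Finset.sum_apply]
    refine Finset.sum_congr rfl fun β _ => ?_
    rw [h2, Finset.sum_apply]
    exact Finset.sum_congr rfl fun γ _ => h3 β γ
  have hmem : h.op (dualCoeff c) u ∈ sobolevH m G E₀ Em := fun α =>
    (hasWeakXDeriv_mul hc (fun β => (h.mem β).2.angleInt hg) hf he α).congr h0.symm (hα α).symm
  obtain ⟨k, hk, hke⟩ := hσ.classC0 hf hg he
  exact ⟨⟨_, hmem⟩, ⟨k, fun n _ => hk.of_top n, h0.trans hke⟩, rfl⟩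

/-! ### Passage to the limit, in the function and then in the kernel. -/

theorem IsKernelFamily.op_mem_of_smooth (hG : IsOpen G) (hGb : Bornology.IsBounded G)
    (hconv : Convex ℝ G) (hc : IsOuterLeibniz c)
    (h : IsKernelFamily m G E₀ Em σ D N₁ N₂) (hσ : IsSmoothKernel G E₀ Em σ)
    (ψ : sobolevH m G E₀ Em) :
    h.op (dualCoeff c) ψ ∈ (smoothFamilies m G E₀ Em).topologicalClosure := by
  have hle : (Submodule.span ℝ {u | IsTensorFamily m G E₀ Em u}).topologicalClosure ≤
      (smoothFamilies m G E₀ Em).topologicalClosure.comap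
        (h.op (dualCoeff c)).toLinearMap := by
    refine Submodule.topologicalClosure_minimal _ (Submodule.span_le.2 fun u hu => ?_) ?_
    · exact Submodule.le_topologicalClosure _ (h.op_tensor_mem hG hc hσ hu)
    · exact (Submodule.isClosed_topologicalClosure _).preimage (h.op (dualCoeff c)).continuous
  exact hle (mem_closure_span_isTensorFamily hG hGb hconv ψ)

/-- The target is closed, and the operator of `σ` is a limit in operator norm of operators of smooth
kernels. -/
theorem IsKernelFamily.op_mem (hG : IsOpen G) (hGb : Bornology.IsBounded G)
    (hconv : Convex ℝ G) (hc : IsOuterLeibniz c)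
    (h : IsKernelFamily m G E₀ Em σ D N₁ N₂) (hσ : MemW0 m G E₀ Em σ)
    (ψ : sobolevH m G E₀ Em) :
    h.op (dualCoeff c) ψ ∈ (smoothFamilies m G E₀ Em).topologicalClosure := by
  obtain ⟨C, hC⟩ : ∃ C, C = ∑ α, ∑ β, ∑ γ, |dualCoeff c α β γ| := ⟨_, rfl⟩
  have hC0 : 0 ≤ C := hC ▸ Finset.sum_nonneg fun _ _ =>
    Finset.sum_nonneg fun _ _ => Finset.sum_nonneg fun _ _ => abs_nonneg _
  have hcl := Submodule.isClosed_topologicalClosure (smoothFamilies m G E₀ Em)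
  rw [← SetLike.mem_coe, ← hcl.closure_eq, Metric.mem_closure_iff]
  intro ε hε
  -- Chosen so that `C δ ‖ψ‖ < ε`; the `+ 1` avoids division by zero.
  set δ : ℝ := ε / (C * ‖(ψ : Family m G E₀ Em)‖ + 1) with hδ
  have hpos : 0 < C * ‖(ψ : Family m G E₀ Em)‖ + 1 := by positivity
  have hδ0 : 0 < δ := div_pos hε hpos
  obtain ⟨τ, -, hτ, hτ', hlt⟩ := hσ (δ.toNNReal : ℝ≥0∞) (by simpa using hδ0)
  obtain ⟨D', M₁, M₂, h'⟩ := hτ.exists_isKernelFamily hG hGb hτ'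
  obtain ⟨D'', h''⟩ := exists_isKernelFamily_of_kernelNorm_le (m := m) hG
    (le_self_add.trans hlt.le) (le_add_self.trans hlt.le)
  refine ⟨h'.op (dualCoeff c) ψ, h'.op_mem_of_smooth hG hGb hconv hc hτ ψ, ?_⟩
  rw [dist_eq_norm, ← sub_apply]
  refine (ContinuousLinearMap.le_of_opNorm_le _
    (h.norm_op_sub_le hG (dualCoeff c) h' h'') _).trans_lt ?_
  rw [← hC, Real.coe_toNNReal _ hδ0.le]
  calc C * δ * ‖(ψ : Family m G E₀ Em)‖ = δ * (C * ‖(ψ : Family m G E₀ Em)‖) := by ring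
    _ < δ * (C * ‖(ψ : Family m G E₀ Em)‖ + 1) := mul_lt_mul_of_pos_left (lt_add_one _) hδ0
    _ = ε := div_mul_cancel₀ _ hpos.ne'

/-- Both the measurable representative of `σ` used by the Schur operator and the chosen `f` differ
from the given data only on null sets, which meet almost every fibre in a null set. -/
theorem IsKernelFamily.ae_collision (hG : IsOpen G) (hc : IsOuterLeibniz c)
    (h : IsKernelFamily m G E₀ Em σ D N₁ N₂) (u : Family m G E₀ Em) {f : Phase → ℝ}
    (hf : u (MultiIdx.zero m) =ᵐ[phaseMeasure G E₀ Em] f) :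
    ∀ᵐ p ∂phaseMeasure G E₀ Em, Integrable (collisionIntegrand σ f p) sphereMeasure ∧
      h.op (dualCoeff c) u (MultiIdx.zero m) p = collision σ f p := by
  rw [h.op_zero hc]
  have hs := h.schur (MultiIdx.zero m)
  filter_upwards [hs.coeFn_toCLM (u (MultiIdx.zero m)),
    hs.ae_integrable (Lp.stronglyMeasurable _).measurable (Lp.memLp (u (MultiIdx.zero m))),
    ae_ae_of_ae_kernelMeasure (weakDerivs_zero_ae_eq hG h.mem),
    MeasurePreserving.ae_ae_comp_fst hs.mp hf] with p h1 h2 h3 h4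
  have e : (fun ω' => D (MultiIdx.zero m) (toKernelDom (p, ω')) *
      u (MultiIdx.zero m) (swapAngles (p, ω')).1) =ᵐ[sphereMeasure] collisionIntegrand σ f p := by
    filter_upwards [h3, h4] with ω' a b
    rw [b, toKernelDom_apply, a]
    rfl
  refine ⟨h2.congr e, ?_⟩
  rw [h1]
  exact integral_congr_ae e

theorem norm_le_of_coe_eq {V : Type*} [NormedAddCommGroup V] [NormedSpace ℝ V]
    {H : Submodule ℝ V} {H₀ : Submodule ℝ H} {T : V →L[ℝ] V} {M : ℝ} (hT : ‖T‖ ≤ M)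
    (K : H →L[ℝ] H₀) (hK : ∀ ψ, ((K ψ : H) : V) = T ψ) : ‖K‖ ≤ M :=
  ContinuousLinearMap.opNorm_le_bound _ ((norm_nonneg _).trans hT) fun ψ => by
    rw [Submodule.coe_norm, Submodule.coe_norm, hK]
    exact T.le_of_opNorm_le hT ψ

end Tensor

end Transport

end

/-! ### The main theorem. -/

theorem theorem3p9 (m : ℕ) :
    ∃ C : ℝ, 0 < C ∧
      ∀ (G : Set Transport.E3) (E₀ Em : ℝ) (σ : Transport.KernelDom → ℝ),
        IsOpen G → Bornology.IsBounded G → Transport.HasSmoothBoundary G →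
        StrictConvex ℝ (closure G) → 0 ≤ E₀ → E₀ < Em →
        Measurable σ →
        (∀ x ∈ G, ∀ ω' ω : Transport.S2, ∀ E ∈ Set.Icc E₀ Em, 0 ≤ σ (x, ω', ω, E)) →
        Transport.MemW0 m G E₀ Em σ →
        ∃ K : Transport.sobolevH m G E₀ Em →L[ℝ] Transport.sobolevH0 m G E₀ Em,
          (∀ (ψ : Transport.sobolevH m G E₀ Em) (f : Transport.Phase → ℝ),
            Transport.toL2 ψ =ᵐ[Transport.phaseMeasure G E₀ Em] f →
            ∀ᵐ p ∂Transport.phaseMeasure G E₀ Em,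
              MeasureTheory.Integrable (Transport.collisionIntegrand σ f p)
                Transport.sphereMeasure ∧
              Transport.toL2 (K ψ : Transport.sobolevH m G E₀ Em) p = Transport.collision σ f p) ∧
          Transport.kernelNorm m G E₀ Em σ < ⊤ ∧ Transport.kernelNorm' m G E₀ Em σ < ⊤ ∧
          ‖K‖ ^ 2 ≤ C * (Transport.kernelNorm m G E₀ Em σ).toReal *
            (Transport.kernelNorm' m G E₀ Em σ).toReal := by
  obtain ⟨c, hc⟩ := Transport.exists_outerLeibniz_coeff m
  obtain ⟨C, hC⟩ : ∃ C, C = ∑ α, ∑ β, ∑ γ, |Transport.dualCoeff c α β γ| := ⟨_, rfl⟩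
  -- The coefficients, and hence `C`, are fixed before `G`, `E₀`, `Em` and `σ`. The operator bound
  -- squared gives `C ^ 2`; the `+ 1` makes positivity immediate.
  refine ⟨C ^ 2 + 1, by positivity, fun G E₀ Em σ hG hGb hs hconv _ _ _ _ hσ => ?_⟩
  have hconv' := Transport.convex_of_hasSmoothBoundary hG hs hconv.convex
  obtain ⟨h₁, h₂⟩ := hσ.kernelNorm_lt_top hG hGb
  -- The Schur bounds are taken equal to the kernel norms themselves, so that `√(N₁ N₂)` is the
  -- desired quantity.
  obtain ⟨D, h⟩ := Transport.exists_isKernelFamily_of_kernelNorm_le (m := m) hG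
    (ENNReal.coe_toNNReal h₁.ne).ge (ENNReal.coe_toNNReal h₂.ne).ge
  have hmem := h.op_mem hG hGb hconv' hc hσ
  have hz := fun ψ => Transport.exists_mem_sobolevH0 hG hGb (hmem ψ)
  have hH : ∀ ψ : Transport.sobolevH m G E₀ Em,
      h.op (Transport.dualCoeff c) ψ ∈ Transport.sobolevH m G E₀ Em := fun ψ => by
    obtain ⟨z, -, e⟩ := hz ψ
    exact e ▸ z.2
  let K₁ : Transport.sobolevH m G E₀ Em →L[ℝ] Transport.sobolevH m G E₀ Em :=
    (h.op (Transport.dualCoeff c) ∘L (Transport.sobolevH m G E₀ Em).subtypeL).codRestrict _ hH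
  have hK₁ : ∀ ψ, K₁ ψ ∈ Transport.sobolevH0 m G E₀ Em := fun ψ => by
    obtain ⟨z, hz0, e⟩ := hz ψ
    have : z = K₁ ψ := Subtype.ext e
    exact this ▸ hz0
  refine ⟨K₁.codRestrict _ hK₁, fun ψ f hf => h.ae_collision hG hc _ hf, h₁, h₂, ?_⟩
  have hC0 : 0 ≤ C := hC ▸ Finset.sum_nonneg fun _ _ =>
    Finset.sum_nonneg fun _ _ => Finset.sum_nonneg fun _ _ => abs_nonneg _
  have hn : ‖K₁.codRestrict _ hK₁‖ ≤ C * √((Transport.kernelNorm m G E₀ Em σ).toReal *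
      (Transport.kernelNorm' m G E₀ Em σ).toReal) :=
    Transport.norm_le_of_coe_eq (hC ▸ h.norm_op_le (Transport.dualCoeff c)) _ fun _ => rfl
  calc ‖K₁.codRestrict _ hK₁‖ ^ 2 ≤ (C * √((Transport.kernelNorm m G E₀ Em σ).toReal *
      (Transport.kernelNorm' m G E₀ Em σ).toReal)) ^ 2 := by gcongr
    _ = C ^ 2 * ((Transport.kernelNorm m G E₀ Em σ).toReal *
      (Transport.kernelNorm' m G E₀ Em σ).toReal) := by
        rw [mul_pow, Real.sq_sqrt (by positivity)]
    _ ≤ (C ^ 2 + 1) * ((Transport.kernelNorm m G E₀ Em σ).toReal *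
      (Transport.kernelNorm' m G E₀ Em σ).toReal) := by
        gcongr
        linarith
    _ = _ := by ring
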